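/- **Setting.** Let $H$ be a real separable Hilbert space, $\rho$ a Borel probability measure on $H\times\mathbb R$ with marginal $\rho_X$ on $H$ and conditional distributions $\rho(\cdot\mid x)$. Assume that the support of $\rho_X$ is compact and $\langle x,x'\rangle\le\kappa^2$ for $\rho_X$-almost all $x,x'$, where $\kappa\ge 1$. Write $\|\cdot\|_\rho$ for the norm of $L^2(\rho_X)$. Let $S:H\to L^2(\rho_X)$, $S\omega=\langle\omega,\cdot\rangle$, $T=S^*S$, $L_K=SS^*$, let $f_\rho(x)=\int y\,d\rho(y\mid x)$ and let $f_H$ be the orthogonal projection of $f_\rho$ onto the closure of $S(H)$ in $L^2(\rho_X)$. Functions $g(A)$ of a self-adjoint compact operator $A$ are defined by $g(A)=\sum_i g(\sigma_i)\,\psi_i\otimes\psi_i$ for an orthonormal basis of eigenvectors $\psi_i$ with eigenvalues $\sigma_i$; for $a>0$, the terms of $L_K^{-a}$ with $\sigma_i=0$ are omitted, and $L_K^{0}=I$. Let $\tau\ge1$, $0\le\zeta\le\tau$, $0\le a\le\min(\tfrac12,\zeta)$, $\gamma\in(0,1]$, $c_\gamma,M,Q,E,F_\tau>0$ and $B,R\ge0$.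 Assume: - $\int|y|^l\,d\rho(y\mid x)\le\frac12\,l!\,M^{l-2}Q^2$ for all integers $l\ge2$ and $\rho_X$-almost all $x$; - $\int (f_H(x)-f_\rho(x))^2\,x\otimes x\,d\rho_X(x)\preceq B^2T$; - $f_H=\phi(L_K)g_0$ for some $g_0\in L^2(\rho_X)$ with $\|g_0\|_\rho\le R$, where $\phi(u)=\kappa^{-2\max(\zeta-1,0)}u^\zeta$ (with $0^0=1$); - $\operatorname{tr}\big(T(T+l I)^{-1}\big)\le c_\gamma l^{-\gamma}$ for all $l>0$. Let $\Lambda\subseteq(0,\infty)$ and let $G_\lambda:[0,\kappa^2]\to[0,\infty)$, $\lambda\in\Lambda$, satisfy, for all $\lambda\in\Lambda$ and $u\in(0,\kappa^2]$, $\;u^\alpha G_\lambda(u)\lambda^{1-\alpha}\le E$ for $\alpha\in[0,1]$ and $|1-G_\lambda(u)u|\,u^\alpha\lambda^{-\alpha}\le F_\tau$ for $\alpha\in[0,\tau]$. Let $(x_i,y_i)_{i\ge1}$ be independent with law $\rho$. For $n\ge1$ put $\lambda=\lambda_n=n^{-1/\max(1,2\zeta+\gamma)}$ and, when $\lambda_n\in\Lambda$,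 $\hat\omega_\lambda=G_\lambda(T_{\mathbf x})\,\frac1n\sum_{i=1}^n y_ix_i$ with $T_{\mathbf x}=\frac1n\sum_{i=1}^n\langle\cdot,x_i\rangle x_i$, and $\hat f_\lambda=S\hat\omega_\lambda$. **Claim.** $\hat f_\lambda-f_H$ always lies in the domain of $L_K^{-a}$, and there are positive constants $C_q$ ($q\in\mathbb N$) and $C'$ that depend only on $\kappa,c_\gamma,\gamma,\zeta,\tau,B,M,Q,R,E,F_\tau,a$ and $\|T\|$ ($C_q$ also on $q$), such that the following hold. 1. For all integers $q\ge1$ and $n\ge1$ with $\lambda_n\in\Lambda$, $$\mathbb E\,\|L_K^{-a}(\hat f_\lambda-f_H)\|_\rho^q\le C_q\begin{cases} n^{-\frac{q(\zeta-a)}{2\zeta+\gamma}} & \text{if } 2\zeta+\gamma>1,\\[2pt] n^{-q(\zeta-a)}\,\max(1,\log n^\gamma)^{q(1-a)} & \text{if } 2\zeta+\gamma\le1.\end{cases}$$ 2. If $\lambda_n\in\Lambda$ for all large $n$, then for every $0<\epsilon<\zeta-a$, almost surely, $$\lim_{n\to\infty}\|L_K^{-a}(\hat f_{\lambda_n}-f_H)\|_\rho\;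 n^{\frac{\zeta-a-\epsilon}{\max(1,2\zeta+\gamma)}}=0.$$ 3. If $\zeta\ge\frac12$, then $f_H=S\omega_H$ for some $\omega_H\in H$, and, for the solution $\omega_H$ of minimal norm, for all $n\ge1$ with $\lambda_n\in\Lambda$ and all $\delta\in(0,1)$, with probability at least $1-\delta$, $$\|T^{\frac12-a}(\hat\omega_\lambda-\omega_H)\|_H\le C'\,n^{-\frac{\zeta-a}{2\zeta+\gamma}}\log^{2-a}\frac6\delta .$$ -/

import Mathlib

open MeasureTheory ProbabilityTheory Filter Topology
open scoped ENNReal RealInnerProductSpace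

set_option linter.unusedSectionVars false

noncomputable section

namespace SpectralReg

/-! ### Spectral calculus of self-adjoint compact operators -/

section Calculus

variable {V : Type*} [NormedAddCommGroup V] [InnerProductSpace ℝ V] [CompleteSpace V]

/-- The orthogonal projection of `V` onto the eigenspace `ker (A - σ I)`
(it is `0` when `σ` is not an eigenvalue). -/
def eigenProj (A : V →L[ℝ] V) (σ : ℝ) : V →L[ℝ] V :=
  (A - σ • ContinuousLinearMap.id ℝ V).ker.starProjection

/-- `v` lies in the domain of `g(A)`: the orthogonal series `∑_σ g(σ) P_σ v` over the
eigenvalues `σ` of `A` converges in `V`. -/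
def InDomain (A : V →L[ℝ] V) (g : ℝ → ℝ) (v : V) : Prop :=
  Summable fun σ : ℝ => g σ • eigenProj A σ v

/-- Spectral calculus of a self-adjoint compact operator: `g(A) v = ∑_σ g(σ) P_σ v`, the sum
being over the eigenvalues `σ` of `A`. Grouping equal eigenvalues, this is
`∑ᵢ g(σᵢ) ⟪ψᵢ, v⟫ ψᵢ` for any orthonormal basis `ψᵢ` of eigenvectors of `A`.
For `g u = u ^ (-a)` with `a > 0` the convention `0 ^ (-a) = 0` makes it the (pseudo-)inverse
power, which vanishes on `ker A`. The value is meaningful when `InDomain A g v`. -/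
def specCalc (A : V →L[ℝ] V) (g : ℝ → ℝ) (v : V) : V :=
  ∑' σ : ℝ, g σ • eigenProj A σ v

/-- The trace of a positive operator, as the supremum of `∑_{e ∈ s} ⟪e, A e⟫` over finite
orthonormal sets `s`; for positive `A` this is `∑ᵢ ⟪eᵢ, A eᵢ⟫` for any orthonormal basis. -/
def posTrace (A : V →L[ℝ] V) : ℝ≥0∞ :=
  ⨆ (s : Finset V) (_ : Orthonormal ℝ (fun e : s => (e : V))),
    ∑ e ∈ s, ENNReal.ofReal ⟪e, A e⟫

/-- `𝒩(l) = tr (A (A + l I)⁻¹)`, the effective dimension. -/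
def effDim (A : V →L[ℝ] V) (l : ℝ) : ℝ≥0∞ :=
  posTrace (A * Ring.inverse (A + l • 1))

end Calculus

/-! ### Operators attached to the input distribution -/

section Operators

variable {H : Type*} [NormedAddCommGroup H] [InnerProductSpace ℝ H] [CompleteSpace H]
  [TopologicalSpace.SeparableSpace H] [MeasurableSpace H] [BorelSpace H]

/-- `⟪x, x'⟫ ≤ κ²` for almost every `x` and `x'`. -/
def BoundedKernel (μ : Measure H) (κ : ℝ) : Prop :=
  ∀ᵐ x ∂μ, ∀ᵐ x' ∂μ, ⟪x, x'⟫ ≤ κ ^ 2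

/-- Under `BoundedKernel`, `‖x‖ ≤ κ` almost everywhere. -/
theorem BoundedKernel.norm_le {μ : Measure H} {κ : ℝ} (hκ : 0 ≤ κ) (h : BoundedKernel μ κ) :
    ∀ᵐ x ∂μ, ‖x‖ ≤ κ := by
  filter_upwards [μ.support_mem_ae] with x hx
  by_contra hlt
  push Not at hlt
  have hxx : κ ^ 2 < ⟪x, x⟫ := by
    rw [real_inner_self_eq_norm_sq]
    exact pow_lt_pow_left₀ hlt hκ two_ne_zero
  have hopen : {p : H × H | κ ^ 2 < ⟪p.1, p.2⟫} ∈ 𝓝 (x, x) :=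
    (isOpen_lt continuous_const (continuous_fst.inner continuous_snd)).mem_nhds hxx
  rw [nhds_prod_eq] at hopen
  obtain ⟨U, hU, hUU⟩ := Filter.mem_prod_self_iff.1 hopen
  have hpos : 0 < μ U := (Measure.mem_support_iff_forall x).1 hx U hU
  have hfr : ∃ᵐ y ∂μ, y ∈ U := frequently_ae_mem_iff.2 hpos.ne'
  obtain ⟨y, hyU, hy⟩ := (hfr.and_eventually h).exists
  obtain ⟨w, hwU, hw⟩ := (hfr.and_eventually hy).exists
  exact absurd (hUU (Set.mk_mem_prod hyU hwU)) (not_lt.2 hw)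

/-- Under `BoundedKernel`, `x ↦ x` is square integrable. -/
theorem BoundedKernel.memLp {μ : Measure H} [IsFiniteMeasure μ] {κ : ℝ} (hκ : 0 ≤ κ)
    (h : BoundedKernel μ κ) : MemLp (fun x : H => x) 2 μ :=
  MemLp.of_bound measurable_id.aestronglyMeasurable κ (h.norm_le hκ)

/-- The inclusion `S : H → L²(μ)`, `S ω = ⟪ω, ·⟫` (see `inclusion_apply`). It makes sense when
`x ↦ x` is square integrable, in particular under `BoundedKernel`; otherwise it is set to `0`. -/
def inclusion (μ : Measure H) : H →L[ℝ] Lp ℝ 2 μ :=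
  open Classical in
  if h : MemLp (fun x : H => x) 2 μ then
    LinearMap.mkContinuous
      { toFun := fun w => (innerSL ℝ w).compLp (h.toLp _)
        map_add' := fun v w => by rw [map_add, ContinuousLinearMap.add_compLp]
        map_smul' := fun c w => by
          rw [map_smul, ContinuousLinearMap.smul_compLp, RingHom.id_apply] }
      ‖h.toLp (fun x : H => x)‖
      (fun w => by
        have := (innerSL ℝ w).norm_compLp_le (h.toLp (fun x : H => x))
        rw [innerSL_apply_norm, mul_comm] at this
        exact this)
  else 0

/-- `(S ω)(x) = ⟪ω, x⟫` for almost every `x`. -/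
theorem inclusion_apply {μ : Measure H} (h : MemLp (fun x : H => x) 2 μ) (w : H) :
    inclusion μ w =ᵐ[μ] fun x => ⟪w, x⟫ := by
  have h1 : inclusion μ w = (innerSL ℝ w).compLp (h.toLp _) := by
    simp only [inclusion, dif_pos h]
    rfl
  rw [h1]
  filter_upwards [(innerSL ℝ w).coeFn_compLp (h.toLp _), h.coeFn_toLp] with x hx hx'
  rw [hx, hx', innerSL_apply_apply]

/-- Covariance operator `T = S* S = ∫ ⟪·, x⟫ x dμ(x)`. -/
def covOp (μ : Measure H) : H →L[ℝ] H :=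
  (ContinuousLinearMap.adjoint (inclusion μ)).comp (inclusion μ)

/-- Integral operator `L = S S*` on `L²(μ)`. -/
def intOp (μ : Measure H) : Lp ℝ 2 μ →L[ℝ] Lp ℝ 2 μ :=
  (inclusion μ).comp (ContinuousLinearMap.adjoint (inclusion μ))

/-- Regression function `f_ρ(x) = ∫ y dρ(y | x)`. -/
def regFun (ρ : Measure (H × ℝ)) [IsFiniteMeasure ρ] (x : H) : ℝ :=
  ∫ y, y ∂(ρ.condKernel x)

/-- Moment condition on the output: `∫ |y|^l dρ(y | x) ≤ ½ l! M^(l-2) Q²` for all `l ≥ 2`,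
for almost every `x`. -/
def MomentCondition (ρ : Measure (H × ℝ)) [IsFiniteMeasure ρ] (M Q : ℝ) : Prop :=
  ∀ᵐ x ∂ρ.fst, ∀ l : ℕ, 2 ≤ l →
    ∫⁻ y, ENNReal.ofReal (|y| ^ l) ∂(ρ.condKernel x) ≤
      ENNReal.ofReal (1 / 2 * (l.factorial : ℝ) * M ^ (l - 2) * Q ^ 2)

/-- Under the moment condition, the regression function is square integrable. -/
theorem memLp_regFun {ρ : Measure (H × ℝ)} [IsFiniteMeasure ρ] {M Q : ℝ}
    (h : MomentCondition ρ M Q) : MemLp (regFun ρ) 2 ρ.fst := by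
  have hmeas : StronglyMeasurable (regFun ρ) :=
    MeasureTheory.StronglyMeasurable.integral_kernel_prod_right'
      (κ := ρ.condKernel) measurable_snd.stronglyMeasurable
  refine MemLp.of_bound hmeas.aestronglyMeasurable (1 + Q ^ 2) ?_
  filter_upwards [h] with x hx
  have h2 : ∫⁻ y, ENNReal.ofReal (|y| ^ 2) ∂(ρ.condKernel x) ≤ ENNReal.ofReal (Q ^ 2) := by
    refine (hx 2 le_rfl).trans (le_of_eq ?_)
    norm_num
  have h1 : ∫⁻ y, ‖y‖ₑ ∂(ρ.condKernel x) ≤ ENNReal.ofReal (1 + Q ^ 2) := by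
    calc ∫⁻ y, ‖y‖ₑ ∂(ρ.condKernel x)
        ≤ ∫⁻ y, (1 + ENNReal.ofReal (|y| ^ 2)) ∂(ρ.condKernel x) := by
          refine lintegral_mono fun y => ?_
          rw [← ENNReal.ofReal_one, ← ENNReal.ofReal_add zero_le_one (by positivity),
            ← ofReal_norm, Real.norm_eq_abs]
          exact ENNReal.ofReal_le_ofReal (by nlinarith [sq_nonneg (|y| - 1), abs_nonneg y])
      _ = 1 + ∫⁻ y, ENNReal.ofReal (|y| ^ 2) ∂(ρ.condKernel x) := by
          rw [lintegral_add_left measurable_const]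
          simp
      _ ≤ ENNReal.ofReal (1 + Q ^ 2) := by
          rw [ENNReal.ofReal_add zero_le_one (sq_nonneg Q), ENNReal.ofReal_one]
          gcongr
  have h0 := (enorm_integral_le_lintegral_enorm (μ := ρ.condKernel x) (fun y : ℝ => y)).trans h1
  rw [← ofReal_norm] at h0
  exact (ENNReal.ofReal_le_ofReal_iff (by positivity)).1 h0

/-- The regression function as an element of `L²(ρ_X)`
(it is square integrable under the moment condition, see `memLp_regFun`). -/
def regFunLp (ρ : Measure (H × ℝ)) [IsFiniteMeasure ρ] : Lp ℝ 2 ρ.fst :=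
  open Classical in
  if h : MemLp (regFun ρ) 2 ρ.fst then h.toLp _ else 0

/-- The target `f_H`: the orthogonal projection of `f_ρ` onto the closure of the range of `S`
in `L²(ρ_X)`. -/
def target (ρ : Measure (H × ℝ)) [IsFiniteMeasure ρ] : Lp ℝ 2 ρ.fst :=
  (inclusion ρ.fst).range.topologicalClosure.starProjection (regFunLp ρ)

/-! ### Assumptions -/

/-- `∫ (f_H(x) - f_ρ(x))² x ⊗ x dρ_X(x) ≼ B² T` in the Loewner order. -/
def ApproxCondition (ρ : Measure (H × ℝ)) [IsFiniteMeasure ρ] (B : ℝ) : Prop :=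
  ∫ x, (target ρ x - regFun ρ x) ^ 2 • InnerProductSpace.rankOne ℝ x x ∂ρ.fst ≤
    B ^ 2 • covOp ρ.fst

/-- Source condition `f_H = φ(L) g₀` with `‖g₀‖ ≤ R`. -/
def SourceCondition (ρ : Measure (H × ℝ)) [IsFiniteMeasure ρ] (φ : ℝ → ℝ) (R : ℝ) : Prop :=
  ∃ g₀ : Lp ℝ 2 ρ.fst, ‖g₀‖ ≤ R ∧ target ρ = specCalc (intOp ρ.fst) φ g₀

/-- Capacity condition `tr (T (T + l I)⁻¹) ≤ c l^(-γ)` for all `l > 0`. -/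
def CapacityCondition (μ : Measure H) (c γ : ℝ) : Prop :=
  ∀ l : ℝ, 0 < l → effDim (covOp μ) l ≤ ENNReal.ofReal (c * l ^ (-γ))

/-! ### Spectral algorithms -/

/-- Filter functions `G l : [0, κ²] → [0, ∞)`, `l ∈ Λ`, with qualification `τ` and
constants `E`, `F`. Values of `G l` outside `[0, κ²]` are irrelevant. -/
structure IsFilter (κ τ E F : ℝ) (Λ : Set ℝ) (G : ℝ → ℝ → ℝ) : Prop where
  pos_index : ∀ l ∈ Λ, 0 < l
  nonneg : ∀ l ∈ Λ, ∀ u ∈ Set.Icc 0 (κ ^ 2), 0 ≤ G l u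
  bound : ∀ α ∈ Set.Icc (0 : ℝ) 1, ∀ l ∈ Λ, ∀ u ∈ Set.Ioc 0 (κ ^ 2),
    |u ^ α * G l u| * l ^ (1 - α) ≤ E
  residual : ∀ α ∈ Set.Icc (0 : ℝ) τ, ∀ l ∈ Λ, ∀ u ∈ Set.Ioc 0 (κ ^ 2),
    |1 - G l u * u| * u ^ α * l ^ (-α) ≤ F

/-- Empirical covariance operator `T_x = n⁻¹ ∑ ⟪·, xᵢ⟫ xᵢ`. -/
def empCov {n : ℕ} (z : Fin n → H × ℝ) : H →L[ℝ] H :=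
  (n : ℝ)⁻¹ • ∑ i, InnerProductSpace.rankOne ℝ (z i).1 (z i).1

/-- `S_x* y = n⁻¹ ∑ yᵢ xᵢ`. -/
def empAdj {n : ℕ} (z : Fin n → H × ℝ) : H :=
  (n : ℝ)⁻¹ • ∑ i, (z i).2 • (z i).1

/-- The spectral algorithm `ω̂ = g(T_x) S_x* y` on the sample `z`. -/
def estimator (g : ℝ → ℝ) {n : ℕ} (z : Fin n → H × ℝ) : H :=
  specCalc (empCov z) g (empAdj z)

end Operators

end SpectralReg

end

open SpectralReg

universe u v

/-!
# Rates of spectral regularization algorithms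

Write `A` for the covariance operator, `B` for its empirical version, `L = S S†` and
`l = n ^ (-1 / max 1 (2ζ + γ))`. Everything follows from one tail bound, `exists_sample_error_le`:
the error is at most `C l ^ (ζ - a) ℓ ^ (1 - a) u ^ (2 - a)` outside an event of probability
`exp (-u)`, for every `u ≥ 1`, where the logarithmic factor `ℓ` is `1` if `2ζ + γ > 1`, and `C`
does not depend on the distribution. Summing over `u` gives the moments
(`lintegral_pow_le_of_tail`), Borel–Cantelli at `u = 1 + 2 log n` the almost sure rate
(`ae_eventually_le_of_tail`), and `u = log (6 / δ)` the bound in `H`.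

By the polar decomposition of `S`, the source condition says that the target is formally `S ω` with
`ω = c A ^ (ζ - 1/2) h`, `‖h‖ ≤ R` (`exists_source`). For `ζ < 1/2` this `ω` need not exist, so the
estimator is compared with the spectral cut-off `ω_l = 1_{A ≥ l} c A ^ (ζ - 1/2) h`, whose distance
to the target is at most `l ^ (ζ - a) R` in the norm of `L ^ (-a)` (`inDomain_rpow_neg`). The
difference `e` of the estimator and `ω_l` is a noise term `g(B) (S_x* y - B ω_l)` minus a residual
`(1 - B g(B)) ω_l`. It is estimated deterministically in `norm_calcL_error_le`, from three facts:

* the form comparison `A + l ≤ K (B + l)`, with `K = O(ℓ u)`;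
* for `ζ ≥ 1`, the bound `‖A - B‖ = O(√(u / n))`, which is needed to exchange the integer part of
  `A ^ (ζ - 1/2)` for a power of `B`; the fractional part is handled by the Heinz inequality;
* the bound `O(u l ^ ζ)` for the noise `S_x* y - B ω_l` in the norm dual to `A + l`.

The bounds for `a = 0` and `a = 1/2` are interpolated.

The first two facts are concentration inequalities for sums of independent rank-one operators in
which the effective dimension replaces the dimension (`measure_formDev_gt_le`). They come from
bounds for the trace moments of the centred empirical second moment matrix: an exchangeable pair
argument with a mean value inequality for traces bounds the moment of order `2q + 2` by a multiple
of the moment of order `2q` (`traceMoment_le`), and the finite-dimensional bound passes to `H`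
because it does not depend on the dimension. The third fact (`measure_noise_le`) is an exponential
tail bound for a sum of independent vectors, obtained from the growth of `cosh ‖·‖`
(`cosh_norm_add_le`); the mean of the noise is not zero but is controlled by the approximation error
of `ω_l`, and its second moments by the effective dimension.

The spectral calculus is developed for positive operators whose eigenspaces span a dense subspace
(`PosDiagonal`). This covers `A` and `B`, which are compact, and passes from `S† S` to `S S†`
(`PosDiagonal.comp_adjoint`).
-/

noncomputable section

namespace SpectralReg

/-! ### Diagonalizable positive operators and their spectral calculus -/

section Calculus

variable {V : Type*} [NormedAddCommGroup V] [InnerProductSpace ℝ V] [CompleteSpace V]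

/-- A positive operator whose eigenspaces span a dense subspace, so that every vector is the sum
of its projections on the eigenspaces. Compact positive operators have this property. -/
structure PosDiagonal (A : V →L[ℝ] V) : Prop where
  symm : ∀ v w, ⟪A v, w⟫ = ⟪v, A w⟫
  nonneg : ∀ v, 0 ≤ ⟪A v, v⟫
  hasSum : ∀ v, HasSum (fun σ => eigenProj A σ v) v

theorem mem_ker_sub_smul {A : V →L[ℝ] V} {σ : ℝ} {v : V} :
    v ∈ (A - σ • ContinuousLinearMap.id ℝ V).ker ↔ A v = σ • v := by
  simp [LinearMap.mem_ker, sub_eq_zero]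

theorem apply_eigenProj (A : V →L[ℝ] V) (σ : ℝ) (v : V) :
    A (eigenProj A σ v) = σ • eigenProj A σ v :=
  mem_ker_sub_smul.1 (Submodule.starProjection_apply_mem _ v)

theorem eigenProj_of_apply_eq {A : V →L[ℝ] V} {σ : ℝ} {v : V} (h : A v = σ • v) :
    eigenProj A σ v = v :=
  Submodule.starProjection_eq_self_iff.2 (mem_ker_sub_smul.2 h)

theorem eigenProj_idem (A : V →L[ℝ] V) (σ : ℝ) (v : V) :
    eigenProj A σ (eigenProj A σ v) = eigenProj A σ v :=
  eigenProj_of_apply_eq (apply_eigenProj A σ v)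

theorem inner_eigenProj_left (A : V →L[ℝ] V) (σ : ℝ) (v w : V) :
    ⟪eigenProj A σ v, w⟫ = ⟪v, eigenProj A σ w⟫ :=
  Submodule.inner_starProjection_left_eq_right _ v w

theorem inner_eq_zero_of_apply_eq {A : V →L[ℝ] V} (hA : ∀ v w, ⟪A v, w⟫ = ⟪v, A w⟫) {σ τ : ℝ}
    (hστ : σ ≠ τ) {v w : V} (hv : A v = σ • v) (hw : A w = τ • w) : ⟪v, w⟫ = 0 := by
  have h := hA v w
  rw [hv, hw, real_inner_smul_left, real_inner_smul_right] at h
  have h' : (σ - τ) * ⟪v, w⟫ = 0 := by linarith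
  exact (mul_eq_zero.1 h').resolve_left (sub_ne_zero.2 hστ)

/-- The eigenspaces of a symmetric operator, indexed by all real numbers, are orthogonal. -/
theorem orthogonalFamily_ker {A : V →L[ℝ] V} (hA : ∀ v w, ⟪A v, w⟫ = ⟪v, A w⟫) :
    OrthogonalFamily ℝ (fun σ : ℝ => (A - σ • ContinuousLinearMap.id ℝ V).ker)
      fun σ => (A - σ • ContinuousLinearMap.id ℝ V).ker.subtypeₗᵢ := by
  rintro σ τ hστ ⟨v, hv⟩ ⟨w, hw⟩
  exact inner_eq_zero_of_apply_eq hA hστ (mem_ker_sub_smul.1 hv) (mem_ker_sub_smul.1 hw)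

/-- A positive operator is diagonalizable if no nonzero vector is orthogonal to all its
eigenvectors. -/
theorem PosDiagonal.of_forall_orthogonal {A : V →L[ℝ] V} (hA : ∀ v w, ⟪A v, w⟫ = ⟪v, A w⟫)
    (hA0 : ∀ v, 0 ≤ ⟪A v, v⟫)
    (h : ∀ w, (∀ (σ : ℝ) (v : V), A v = σ • v → ⟪v, w⟫ = 0) → w = 0) : PosDiagonal A := by
  refine ⟨hA, hA0, fun v => ?_⟩
  have hO := orthogonalFamily_ker hA
  have hv : Summable fun σ => eigenProj A σ v := by
    have h1 := (hO.summable_iff_norm_sq_summable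
      fun σ => (A - σ • ContinuousLinearMap.id ℝ V).ker.orthogonalProjectionOnto v).2 ?_
    · exact h1
    refine summable_of_sum_le (c := ‖v‖ ^ 2) (fun _ => sq_nonneg _) fun s => ?_
    have h2 := hO.norm_sum
      (fun σ => (A - σ • ContinuousLinearMap.id ℝ V).ker.orthogonalProjectionOnto v) s
    rw [← h2]
    set y := ∑ σ ∈ s, (A - σ • ContinuousLinearMap.id ℝ V).ker.subtypeₗᵢ
      ((A - σ • ContinuousLinearMap.id ℝ V).ker.orthogonalProjectionOnto v) with hy
    have h3 : ⟪y, y⟫ = ⟪y, v⟫ := by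
      rw [real_inner_self_eq_norm_sq, h2, hy, sum_inner]
      refine Finset.sum_congr rfl fun σ _ => ?_
      change ‖eigenProj A σ v‖ ^ 2 = ⟪eigenProj A σ v, v⟫
      rw [← eigenProj_idem, inner_eigenProj_left, eigenProj_idem, real_inner_self_eq_norm_sq]
    rw [real_inner_self_eq_norm_sq] at h3
    have h4 := real_inner_le_norm y v
    rcases (norm_nonneg y).eq_or_lt with h0 | h0
    · rw [← h0, zero_pow two_ne_zero]; exact sq_nonneg _
    · have : ‖y‖ ≤ ‖v‖ := by nlinarith
      gcongr
  obtain ⟨s, hs⟩ := hv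
  have : v - s = 0 := by
    refine h _ fun σ w hw => ?_
    have h1 : HasSum (fun τ => ⟪w, eigenProj A τ v⟫) ⟪w, s⟫ :=
      hs.mapL (innerSL ℝ w)
    have h2 : HasSum (fun τ => ⟪w, eigenProj A τ v⟫) ⟪w, eigenProj A σ v⟫ :=
      hasSum_single σ fun τ hτ =>
        inner_eq_zero_of_apply_eq hA hτ.symm hw (apply_eigenProj A τ v)
    rw [inner_sub_right, h1.unique h2, ← inner_eigenProj_left, eigenProj_of_apply_eq hw, sub_self]
  rw [← sub_eq_zero.1 this] at hs
  exact hs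

/-- The spectral theorem for compact positive operators. -/
theorem PosDiagonal.of_isCompactOperator {A : V →L[ℝ] V} (hc : IsCompactOperator A)
    (hA : ∀ v w, ⟪A v, w⟫ = ⟪v, A w⟫) (hA0 : ∀ v, 0 ≤ ⟪A v, v⟫) : PosDiagonal A := by
  refine .of_forall_orthogonal hA hA0 fun w hw => ?_
  have h := ContinuousLinearMap.orthogonalComplement_iSup_eigenspaces_eq_bot hc
    (show A.IsSymmetric from fun v w => hA v w)
  have : w ∈ (⨆ μ, Module.End.eigenspace (A : Module.End ℝ V) μ)ᗮ := by
    rw [← Submodule.iInf_orthogonal, Submodule.mem_iInf]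
    intro μ
    rw [Submodule.mem_orthogonal]
    intro v hv
    exact hw μ v (Module.End.mem_eigenspace_iff.1 hv)
  rwa [h, Submodule.mem_bot] at this

namespace PosDiagonal

variable {A B : V →L[ℝ] V}

theorem inner_eigenProj_eigenProj (hA : PosDiagonal A) {σ τ : ℝ} (h : σ ≠ τ) (v w : V) :
    ⟪eigenProj A σ v, eigenProj A τ w⟫ = 0 :=
  inner_eq_zero_of_apply_eq hA.symm h (apply_eigenProj A σ v) (apply_eigenProj A τ w)

theorem eigenProj_eigenProj_of_ne (hA : PosDiagonal A) {σ τ : ℝ} (h : σ ≠ τ) (v : V) :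
    eigenProj A σ (eigenProj A τ v) = 0 := by
  rw [← inner_self_eq_zero (𝕜 := ℝ)]
  exact (inner_eigenProj_left A σ _ _).trans (by
    rw [eigenProj_idem, real_inner_comm]
    exact hA.inner_eigenProj_eigenProj h _ _)

theorem eigenProj_apply (hA : PosDiagonal A) (σ : ℝ) (v : V) :
    eigenProj A σ (A v) = σ • eigenProj A σ v := by
  refine ext_inner_right ℝ fun w => ?_
  rw [inner_eigenProj_left, hA.symm, apply_eigenProj, real_inner_smul_left, real_inner_smul_right,
    inner_eigenProj_left]

theorem hasSum_inner (hA : PosDiagonal A) (v w : V) :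
    HasSum (fun σ => ⟪eigenProj A σ v, eigenProj A σ w⟫) ⟪v, w⟫ := by
  have h : HasSum (fun σ => ⟪v, eigenProj A σ w⟫) ⟪v, w⟫ := (hA.hasSum w).mapL (innerSL ℝ v)
  convert! h using 2 with σ
  rw [inner_eigenProj_left, eigenProj_idem]

theorem hasSum_norm_sq (hA : PosDiagonal A) (v : V) :
    HasSum (fun σ => ‖eigenProj A σ v‖ ^ 2) (‖v‖ ^ 2) := by
  simpa only [real_inner_self_eq_norm_sq] using hA.hasSum_inner v v

/-- A vector is determined by its spectral components. -/
theorem ext (hA : PosDiagonal A) {v w : V} (h : ∀ σ, eigenProj A σ v = eigenProj A σ w) :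
    v = w := by
  refine (hA.hasSum v).unique ?_
  simpa only [h] using hA.hasSum w

theorem norm_le_norm (hA : PosDiagonal A) {v w : V}
    (h : ∀ σ, ‖eigenProj A σ v‖ ≤ ‖eigenProj A σ w‖) : ‖v‖ ≤ ‖w‖ := by
  refine le_of_sq_le_sq ?_ (norm_nonneg _)
  exact hasSum_le (fun σ => by have := h σ; gcongr) (hA.hasSum_norm_sq v) (hA.hasSum_norm_sq w)

/-- A series with one term in each eigenspace converges iff the squared norms are summable. -/
theorem summable_iff (hA : PosDiagonal A) {f : ℝ → V} (hf : ∀ σ, eigenProj A σ (f σ) = f σ) :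
    Summable f ↔ Summable fun σ => ‖f σ‖ ^ 2 :=
  (orthogonalFamily_ker hA.symm).summable_iff_norm_sq_summable fun σ =>
    ⟨f σ, mem_ker_sub_smul.2 (by rw [← hf σ, apply_eigenProj])⟩

theorem eigenProj_tsum (hA : PosDiagonal A) {f : ℝ → V} (hf : ∀ σ, eigenProj A σ (f σ) = f σ)
    (hs : Summable f) (τ : ℝ) : eigenProj A τ (∑' σ, f σ) = f τ := by
  rw [(eigenProj A τ).map_tsum hs, tsum_eq_single τ, hf]
  intro σ hσ
  rw [← hf σ, hA.eigenProj_eigenProj_of_ne hσ.symm]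

theorem inDomain_iff (hA : PosDiagonal A) {g : ℝ → ℝ} {v : V} :
    InDomain A g v ↔ Summable fun σ => g σ ^ 2 * ‖eigenProj A σ v‖ ^ 2 := by
  rw [InDomain, hA.summable_iff fun σ => by rw [map_smul, eigenProj_idem]]
  simp only [norm_smul, mul_pow, Real.norm_eq_abs, sq_abs]

theorem eigenProj_specCalc (hA : PosDiagonal A) {g : ℝ → ℝ} {v : V} (h : InDomain A g v)
    (τ : ℝ) : eigenProj A τ (specCalc A g v) = g τ • eigenProj A τ v :=
  hA.eigenProj_tsum (fun σ => by rw [map_smul, eigenProj_idem]) h τ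

theorem eigenvalue_nonneg (hA : PosDiagonal A) {σ : ℝ} (h : eigenProj A σ ≠ 0) : 0 ≤ σ := by
  obtain ⟨v, hv⟩ := ContinuousLinearMap.exists_ne_zero h
  have h1 := hA.nonneg (eigenProj A σ v)
  rw [apply_eigenProj, real_inner_smul_left, real_inner_self_eq_norm_sq] at h1
  exact nonneg_of_mul_nonneg_left h1 (by positivity)

theorem eigenvalue_mem_Icc (hA : PosDiagonal A) {b : ℝ} (hb : ∀ v, ‖A v‖ ≤ b * ‖v‖) {σ : ℝ}
    (h : eigenProj A σ ≠ 0) : σ ∈ Set.Icc 0 b := by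
  have h0 := hA.eigenvalue_nonneg h
  refine ⟨h0, ?_⟩
  obtain ⟨v, hv⟩ := ContinuousLinearMap.exists_ne_zero h
  have h1 := hb (eigenProj A σ v)
  rw [apply_eigenProj, norm_smul, Real.norm_of_nonneg h0] at h1
  exact le_of_mul_le_mul_right h1 (norm_pos_iff.2 hv)

theorem hasSum_inner_apply (hA : PosDiagonal A) (v : V) :
    HasSum (fun σ => σ * ‖eigenProj A σ v‖ ^ 2) ⟪A v, v⟫ := by
  convert! hA.hasSum_inner (A v) v using 2 with σ
  rw [hA.eigenProj_apply, real_inner_smul_left, real_inner_self_eq_norm_sq]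

end PosDiagonal

/-- `g` is bounded by `C` on the eigenvalues of `A`. -/
def SpecBound (A : V →L[ℝ] V) (g : ℝ → ℝ) (C : ℝ) : Prop :=
  ∀ σ, eigenProj A σ ≠ 0 → |g σ| ≤ C

/-- The operator `g(A)` as a continuous linear map, for `g` bounded on the eigenvalues of `A`;
junk otherwise. -/
def calcL (A : V →L[ℝ] V) (g : ℝ → ℝ) : V →L[ℝ] V :=
  open Classical in
  if h : (∀ v, InDomain A g v) ∧ ∃ C, ∀ v, ‖specCalc A g v‖ ≤ C * ‖v‖ then
    LinearMap.mkContinuous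
      { toFun := specCalc A g
        map_add' := fun v w => by
          simp only [specCalc, map_add, smul_add]
          exact (h.1 v).tsum_add (h.1 w)
        map_smul' := fun c v => by
          simp only [specCalc, map_smul, RingHom.id_apply, smul_comm _ c]
          exact (h.1 v).tsum_const_smul c }
      h.2.choose h.2.choose_spec
  else 0

namespace PosDiagonal

variable {A B : V →L[ℝ] V} {g f : ℝ → ℝ} {C : ℝ}

theorem norm_smul_eigenProj_le (hg : SpecBound A g C) (σ : ℝ) (v : V) :
    ‖g σ • eigenProj A σ v‖ ≤ ‖C • eigenProj A σ v‖ := by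
  by_cases h : eigenProj A σ = 0
  · simp [h]
  · rw [norm_smul, norm_smul]
    exact mul_le_mul_of_nonneg_right ((hg σ h).trans (le_abs_self C)) (norm_nonneg _)

theorem inDomain_of_bound (hA : PosDiagonal A) (hg : SpecBound A g C) (v : V) :
    InDomain A g v := by
  rw [hA.inDomain_iff]
  refine Summable.of_nonneg_of_le (fun _ => by positivity) (fun σ => ?_)
    ((hA.hasSum_norm_sq v).summable.mul_left (C ^ 2))
  have h := norm_smul_eigenProj_le hg σ v
  rw [norm_smul, norm_smul] at h
  have h' := pow_le_pow_left₀ (by positivity) h 2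
  simpa only [mul_pow, Real.norm_eq_abs, sq_abs] using h'

theorem calcL_apply (hA : PosDiagonal A) (hg : SpecBound A g C) (v : V) :
    calcL A g v = specCalc A g v := by
  have h : (∀ v, InDomain A g v) ∧ ∃ C, ∀ v, ‖specCalc A g v‖ ≤ C * ‖v‖ := by
    refine ⟨hA.inDomain_of_bound hg, |C|, fun v => ?_⟩
    have : ‖specCalc A g v‖ ≤ ‖C • v‖ := hA.norm_le_norm fun σ => by
      rw [hA.eigenProj_specCalc (hA.inDomain_of_bound hg v), map_smul]
      exact norm_smul_eigenProj_le hg σ v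
    rwa [norm_smul, Real.norm_eq_abs] at this
  rw [calcL, dif_pos h]
  rfl

theorem eigenProj_calcL (hA : PosDiagonal A) (hg : SpecBound A g C) (σ : ℝ) (v : V) :
    eigenProj A σ (calcL A g v) = g σ • eigenProj A σ v := by
  rw [hA.calcL_apply hg, hA.eigenProj_specCalc (hA.inDomain_of_bound hg v)]

theorem norm_calcL_le (hA : PosDiagonal A) (hg : SpecBound A g C) (hC : 0 ≤ C) (v : V) :
    ‖calcL A g v‖ ≤ C * ‖v‖ := by
  have : ‖calcL A g v‖ ≤ ‖C • v‖ := hA.norm_le_norm fun σ => by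
    rw [hA.eigenProj_calcL hg, map_smul]
    exact norm_smul_eigenProj_le hg σ v
  rwa [norm_smul, Real.norm_of_nonneg hC] at this

theorem inner_calcL (hA : PosDiagonal A) (hg : SpecBound A g C) (v w : V) :
    ⟪calcL A g v, w⟫ = ⟪v, calcL A g w⟫ := by
  refine (hA.hasSum_inner _ _).unique ?_
  convert! hA.hasSum_inner v (calcL A g w) using 2 with σ
  rw [hA.eigenProj_calcL hg, hA.eigenProj_calcL hg, real_inner_smul_left, real_inner_smul_right]

theorem calcL_calcL (hA : PosDiagonal A) (hf : SpecBound A f C) {C' : ℝ}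
    (hg : SpecBound A g C') (v : V) :
    calcL A f (calcL A g v) = calcL A (fun u => f u * g u) v := by
  have hfg : SpecBound A (fun u => f u * g u) (C * C') := fun σ h => by
    rw [abs_mul]
    exact mul_le_mul (hf σ h) (hg σ h) (abs_nonneg _) ((abs_nonneg _).trans (hf σ h))
  refine hA.ext fun σ => ?_
  rw [hA.eigenProj_calcL hf, hA.eigenProj_calcL hg, hA.eigenProj_calcL hfg, smul_smul]

theorem norm_sq_calcL (hA : PosDiagonal A) (hg : SpecBound A g C) (v : V) :
    HasSum (fun σ => g σ ^ 2 * ‖eigenProj A σ v‖ ^ 2) (‖calcL A g v‖ ^ 2) := by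
  convert! hA.hasSum_norm_sq (calcL A g v) using 2 with σ
  rw [hA.eigenProj_calcL hg, norm_smul, mul_pow, Real.norm_eq_abs, sq_abs]

/-- Interpolation: if the components of `w` are dominated by geometric means of those of `x` and
`y`, so is the norm, by Hölder's inequality. -/
theorem norm_le_interpolate (hA : PosDiagonal A) {x y w : V} {θ : ℝ} (h0 : 0 ≤ θ) (h1 : θ ≤ 1)
    (h : ∀ σ, ‖eigenProj A σ w‖ ≤
      ‖eigenProj A σ x‖ ^ (1 - θ) * ‖eigenProj A σ y‖ ^ θ) :
    ‖w‖ ≤ ‖x‖ ^ (1 - θ) * ‖y‖ ^ θ := by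
  rcases h0.eq_or_lt with rfl | h0
  · simp only [sub_zero, Real.rpow_one, Real.rpow_zero, mul_one] at h ⊢
    exact hA.norm_le_norm h
  rcases h1.eq_or_lt with rfl | h1
  · simp only [sub_self, Real.rpow_one, Real.rpow_zero, one_mul] at h ⊢
    exact hA.norm_le_norm h
  have h1' : 0 < 1 - θ := sub_pos.2 h1
  have hzero : (∀ σ, eigenProj A σ w = 0) → ‖w‖ = 0 := fun h' => by
    rw [hA.ext (v := w) (w := 0) fun σ => by rw [h', map_zero], norm_zero]
  rcases (norm_nonneg x).eq_or_lt with hx | hx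
  · rw [hzero fun σ => ?_]
    · positivity
    · have := h σ
      rw [norm_eq_zero.1 hx.symm, map_zero, norm_zero, Real.zero_rpow h1'.ne', zero_mul] at this
      exact norm_le_zero_iff.1 this
  rcases (norm_nonneg y).eq_or_lt with hy | hy
  · rw [hzero fun σ => ?_]
    · positivity
    · have := h σ
      rw [norm_eq_zero.1 hy.symm, map_zero, norm_zero, Real.zero_rpow h0.ne', mul_zero] at this
      exact norm_le_zero_iff.1 this
  set N := ‖x‖ ^ (1 - θ) * ‖y‖ ^ θ with hN
  have hNpos : 0 < N := by positivity
  have key : ∀ σ, ‖eigenProj A σ w‖ ^ 2 ≤ N ^ 2 * ((1 - θ) * (‖eigenProj A σ x‖ ^ 2 / ‖x‖ ^ 2) +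
      θ * (‖eigenProj A σ y‖ ^ 2 / ‖y‖ ^ 2)) := fun σ => by
    have hg := Real.geom_mean_le_arith_mean2_weighted h1'.le h0.le
      (p₁ := ‖eigenProj A σ x‖ ^ 2 / ‖x‖ ^ 2) (p₂ := ‖eigenProj A σ y‖ ^ 2 / ‖y‖ ^ 2)
      (by positivity) (by positivity) (by ring)
    have hw : ‖eigenProj A σ w‖ ^ 2 ≤
        (‖eigenProj A σ x‖ ^ (1 - θ) * ‖eigenProj A σ y‖ ^ θ) ^ 2 := by
      have := h σ
      gcongr
    refine (hw.trans (le_of_eq ?_)).trans (mul_le_mul_of_nonneg_left hg (sq_nonneg N))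
    rw [Real.div_rpow (by positivity) (by positivity),
      Real.div_rpow (by positivity) (by positivity),
      ← Real.rpow_natCast_mul (norm_nonneg _), ← Real.rpow_natCast_mul (norm_nonneg _),
      ← Real.rpow_natCast_mul (norm_nonneg _), ← Real.rpow_natCast_mul (norm_nonneg _), hN]
    have e : ∀ (z : V) (s : ℝ), ‖z‖ ^ (((2 : ℕ) : ℝ) * s) = (‖z‖ ^ s) ^ 2 := fun z s => by
      rw [mul_comm, Real.rpow_mul_natCast (norm_nonneg _)]
    simp only [e]
    have := (Real.rpow_pos_of_pos hx (1 - θ)).ne'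
    have := (Real.rpow_pos_of_pos hy θ).ne'
    field_simp
  refine le_of_sq_le_sq ?_ hNpos.le
  have hs := (((hA.hasSum_norm_sq x).div_const (‖x‖ ^ 2)).mul_left (1 - θ)).add
    (((hA.hasSum_norm_sq y).div_const (‖y‖ ^ 2)).mul_left θ)
  rw [div_self (by positivity), div_self (by positivity)] at hs
  have := hasSum_le key (hA.hasSum_norm_sq w) (hs.mul_left (N ^ 2))
  linarith

end PosDiagonal

end Calculus

/-! ### The Heinz inequality -/

section Heinz

variable {V : Type*} [NormedAddCommGroup V] [InnerProductSpace ℝ V] [CompleteSpace V]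

namespace PosDiagonal

variable {A B : V →L[ℝ] V} {g f : ℝ → ℝ}

theorem SpecBound.rpow {C : ℝ} (hf : SpecBound A f C) (hf0 : ∀ σ, eigenProj A σ ≠ 0 → 0 ≤ f σ)
    {θ : ℝ} (hθ : 0 ≤ θ) : SpecBound A (fun u => f u ^ θ) (C ^ θ) := fun σ hσ => by
  have h0 := hf0 σ hσ
  have h1 := hf σ hσ
  rw [abs_of_nonneg h0] at h1
  rw [abs_of_nonneg (Real.rpow_nonneg h0 θ)]
  exact Real.rpow_le_rpow h0 h1 hθ

/-- The parallel sum of `|f|²` and `t` is the minimum of `‖f(A) w‖² + t ‖v - w‖²` over `w`: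
lower bound by any competitor `w`. -/
theorem sum_parallel_le (hA : PosDiagonal A) {C : ℝ} (hf : SpecBound A f C) {t : ℝ} (ht : 0 < t)
    (v w : V) (s : Finset ℝ) :
    ∑ σ ∈ s, t * f σ ^ 2 / (t + f σ ^ 2) * ‖eigenProj A σ v‖ ^ 2 ≤
      ‖calcL A f w‖ ^ 2 + t * ‖v - w‖ ^ 2 := by
  have hs := (hA.norm_sq_calcL hf w).add ((hA.hasSum_norm_sq (v - w)).mul_left t)
  refine le_trans ?_ (sum_le_hasSum s (fun σ _ => by positivity) hs)
  refine Finset.sum_le_sum fun σ _ => ?_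
  have htri : ‖eigenProj A σ v‖ ≤ ‖eigenProj A σ w‖ + ‖eigenProj A σ (v - w)‖ := by
    rw [map_sub]
    exact norm_le_norm_add_norm_sub' _ _
  set x := ‖eigenProj A σ v‖
  set y := ‖eigenProj A σ w‖
  set z := ‖eigenProj A σ (v - w)‖
  have hx : x ^ 2 ≤ (y + z) ^ 2 := by
    have : 0 ≤ x := norm_nonneg _
    gcongr
  have hpos : 0 < t + f σ ^ 2 := by positivity
  rw [div_mul_eq_mul_div, div_le_iff₀ hpos]
  have h1 : t * f σ ^ 2 * x ^ 2 ≤ t * f σ ^ 2 * (y + z) ^ 2 := by gcongr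
  nlinarith [sq_nonneg (f σ ^ 2 * y - t * z)]

/-- The minimum in `sum_parallel_le` is attained, for a vector with finitely many nonzero
spectral components. -/
theorem exists_parallel_eq (hB : PosDiagonal B) {C : ℝ} (hg : SpecBound B g C) {t : ℝ} (ht : 0 < t)
    (v : V) (s : Finset ℝ) :
    ∃ w, ‖calcL B g w‖ ^ 2 + t * ‖(∑ σ ∈ s, eigenProj B σ v) - w‖ ^ 2 =
      ∑ σ ∈ s, t * g σ ^ 2 / (t + g σ ^ 2) * ‖eigenProj B σ v‖ ^ 2 := by
  classical
  have hproj : ∀ (c : ℝ → ℝ) τ, eigenProj B τ (∑ σ ∈ s, c σ • eigenProj B σ v) =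
      if τ ∈ s then c τ • eigenProj B τ v else 0 := fun c τ => by
    rw [map_sum, ← Finset.sum_ite_eq s τ fun σ => c σ • eigenProj B σ v]
    refine Finset.sum_congr rfl fun σ _ => ?_
    rw [map_smul]
    split_ifs with h
    · rw [h, eigenProj_idem]
    · rw [hB.eigenProj_eigenProj_of_ne h, smul_zero]
  refine ⟨∑ σ ∈ s, (t / (t + g σ ^ 2)) • eigenProj B σ v, ?_⟩
  have h1 : (∑ σ ∈ s, eigenProj B σ v) - ∑ σ ∈ s, (t / (t + g σ ^ 2)) • eigenProj B σ v =
      ∑ σ ∈ s, (1 - t / (t + g σ ^ 2)) • eigenProj B σ v := by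
    rw [← Finset.sum_sub_distrib]
    exact Finset.sum_congr rfl fun σ _ => by rw [sub_smul, one_smul]
  rw [h1]
  refine ((hB.norm_sq_calcL hg _).add ((hB.hasSum_norm_sq _).mul_left t)).unique ?_
  have h2 : HasSum (fun σ => if σ ∈ s then
      t * g σ ^ 2 / (t + g σ ^ 2) * ‖eigenProj B σ v‖ ^ 2 else 0)
      (∑ σ ∈ s, t * g σ ^ 2 / (t + g σ ^ 2) * ‖eigenProj B σ v‖ ^ 2) := by
    have := hasSum_sum_of_ne_finset_zero (L := SummationFilter.unconditional ℝ) (s := s)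
      (f := fun σ => if σ ∈ s then
        t * g σ ^ 2 / (t + g σ ^ 2) * ‖eigenProj B σ v‖ ^ 2 else 0) (fun σ hσ => if_neg hσ)
    rwa [Finset.sum_congr rfl fun σ hσ => if_pos hσ] at this
  convert! h2 using 2 with σ
  rw [hproj, hproj]
  split_ifs with h
  · rw [norm_smul, norm_smul, mul_pow, mul_pow, Real.norm_eq_abs, Real.norm_eq_abs, sq_abs, sq_abs]
    have : t + g σ ^ 2 ≠ 0 := by positivity
    field_simp
    ring
  · simp

/-- The **Heinz inequality**: a comparison of two diagonalizable operators is inherited by their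
fractional powers. The power `u ^ θ` is an average of the functions `t u / (t + u)`, for which the
comparison follows from their variational characterization as parallel sums. -/
theorem heinz (hA : PosDiagonal A) (hB : PosDiagonal B) {C C' : ℝ} (hf : SpecBound A f C)
    (hg : SpecBound B g C') (hf0 : ∀ σ, eigenProj A σ ≠ 0 → 0 ≤ f σ)
    (hg0 : ∀ σ, eigenProj B σ ≠ 0 → 0 ≤ g σ)
    (h : ∀ v, ‖calcL A f v‖ ≤ ‖calcL B g v‖) {θ : ℝ} (h0 : 0 ≤ θ) (h1 : θ ≤ 1) (v : V) :
    ‖calcL A (fun u => f u ^ θ) v‖ ≤ ‖calcL B (fun u => g u ^ θ) v‖ := by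
  have hfθ := SpecBound.rpow hf hf0 h0
  have hgθ := SpecBound.rpow hg hg0 h0
  rcases h0.eq_or_lt with rfl | h0
  · refine le_of_eq ?_
    simp only [Real.rpow_zero] at hfθ hgθ ⊢
    rw [hA.ext (v := calcL A (fun _ => 1) v) (w := v) fun σ => by
        rw [hA.eigenProj_calcL hfθ, one_smul],
      hB.ext (v := calcL B (fun _ => 1) v) (w := v) fun σ => by
        rw [hB.eigenProj_calcL hgθ, one_smul]]
  rcases h1.eq_or_lt with rfl | h1
  · simpa only [Real.rpow_one] using h v
  obtain ⟨μ, hμ⟩ := Real.exists_measure_rpow_eq_integral_rpowIntegrand₀₁ (p := θ) ⟨h0, h1⟩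
  have e : ∀ (A : V →L[ℝ] V) (f : ℝ → ℝ), (∀ σ, eigenProj A σ ≠ 0 → 0 ≤ f σ) → ∀ σ (v : V),
      (f σ ^ θ) ^ 2 * ‖eigenProj A σ v‖ ^ 2 =
        ∫ t in Set.Ioi 0, Real.rpowIntegrand₀₁ θ t (f σ ^ 2) * ‖eigenProj A σ v‖ ^ 2 ∂μ := by
    intro A f hf0 σ v
    rw [integral_mul_const, ← (hμ (f σ ^ 2) (Set.mem_Ici.2 (sq_nonneg _))).2]
    by_cases hσ : eigenProj A σ = 0
    · simp [hσ]
    · rw [← Real.rpow_mul_natCast (hf0 σ hσ), ← Real.rpow_natCast_mul (hf0 σ hσ), mul_comm θ]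
  have hint : ∀ (A : V →L[ℝ] V) (f : ℝ → ℝ) (v : V) σ, Integrable
      (fun t => Real.rpowIntegrand₀₁ θ t (f σ ^ 2) * ‖eigenProj A σ v‖ ^ 2)
      (μ.restrict (Set.Ioi 0)) := fun A f v σ =>
    (hμ (f σ ^ 2) (Set.mem_Ici.2 (sq_nonneg _))).1.mul_const _
  -- the comparison for vectors with finitely many components, by integration over `t`
  have hfin : ∀ s : Finset ℝ, ‖calcL A (fun u => f u ^ θ) (∑ σ ∈ s, eigenProj B σ v)‖ ^ 2 ≤
      ‖calcL B (fun u => g u ^ θ) v‖ ^ 2 := by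
    intro s
    refine hasSum_le_of_sum_le (hA.norm_sq_calcL hfθ _) fun s' => ?_
    refine le_trans ?_ (sum_le_hasSum s (fun σ _ => by positivity) (hB.norm_sq_calcL hgθ v))
    rw [Finset.sum_congr rfl fun σ _ => e A f hf0 σ _,
      Finset.sum_congr rfl fun σ _ => e B g hg0 σ _,
      ← integral_finsetSum _ fun σ _ => hint A f _ σ,
      ← integral_finsetSum _ fun σ _ => hint B g _ σ]
    refine setIntegral_mono_on (integrable_finsetSum _ fun σ _ => hint A f _ σ)
      (integrable_finsetSum _ fun σ _ => hint B g _ σ) measurableSet_Ioi fun t ht => ?_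
    have ht : 0 < t := ht
    obtain ⟨w, hw⟩ := hB.exists_parallel_eq hg ht v s
    have hle := hA.sum_parallel_le hf ht (∑ σ ∈ s, eigenProj B σ v) w s'
    have hAB : ‖calcL A f w‖ ^ 2 ≤ ‖calcL B g w‖ ^ 2 := by
      have := h w
      gcongr
    have hle' := (hle.trans (add_le_add_left hAB _)).trans hw.le
    have hr : ∀ x : ℝ, Real.rpowIntegrand₀₁ θ t (x ^ 2) =
        t ^ (θ - 2) * (t * x ^ 2 / (t + x ^ 2)) := fun x => by
      rw [Real.rpowIntegrand₀₁_eq_pow_div ⟨h0, h1⟩ ht.le (sq_nonneg _),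
        show θ - 1 = θ - 2 + 1 by ring, Real.rpow_add_one ht.ne']
      ring
    simp only [hr, mul_assoc (t ^ (θ - 2)), ← Finset.mul_sum]
    exact mul_le_mul_of_nonneg_left hle' (Real.rpow_nonneg ht.le _)
  refine le_of_sq_le_sq ?_ (norm_nonneg _)
  have hlim : Tendsto (fun s : Finset ℝ => ∑ σ ∈ s, eigenProj B σ v) atTop (𝓝 v) := hB.hasSum v
  exact le_of_tendsto (((calcL A fun u => f u ^ θ).continuous.norm.pow 2).tendsto v |>.comp hlim)
    (Eventually.of_forall hfin)

end PosDiagonal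

end Heinz

/-! ### Deterministic error analysis of spectral filters -/

section Deterministic

variable {V : Type*} [NormedAddCommGroup V] [InnerProductSpace ℝ V] [CompleteSpace V]

namespace PosDiagonal

variable {A B : V →L[ℝ] V} {b l : ℝ}

theorem specBound (hA : PosDiagonal A) (hb : ∀ v, ‖A v‖ ≤ b * ‖v‖) {f : ℝ → ℝ} {C : ℝ}
    (hf : ∀ u ∈ Set.Icc 0 b, |f u| ≤ C) : SpecBound A f C := fun _ hσ =>
  hf _ (hA.eigenvalue_mem_Icc hb hσ)

theorem abs_add_rpow_le {u p : ℝ} (hl : 0 < l) (hu : u ∈ Set.Icc 0 b) (hp : 0 ≤ p) :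
    |(u + l) ^ p| ≤ (b + l) ^ p := by
  have h0 := hu.1
  rw [abs_of_nonneg (by positivity)]
  exact Real.rpow_le_rpow (by positivity) (by linarith [hu.2]) hp

theorem abs_rpow_le {u p : ℝ} (hu : u ∈ Set.Icc 0 b) (hp : 0 ≤ p) : |u ^ p| ≤ b ^ p := by
  have h0 := hu.1
  rw [abs_of_nonneg (by positivity)]
  exact Real.rpow_le_rpow h0 hu.2 hp

theorem norm_sq_calcL_add_rpow (hA : PosDiagonal A) (hb : ∀ v, ‖A v‖ ≤ b * ‖v‖) (hl : 0 < l)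
    (v : V) :
    ‖calcL A (fun u => (u + l) ^ (1 / 2 : ℝ)) v‖ ^ 2 = ⟪A v, v⟫ + l * ‖v‖ ^ 2 := by
  refine (hA.norm_sq_calcL (hA.specBound hb fun u hu =>
    abs_add_rpow_le hl hu (by norm_num)) v).unique ?_
  convert! (hA.hasSum_inner_apply v).add ((hA.hasSum_norm_sq v).mul_left l) using 2 with σ
  by_cases hσ : eigenProj A σ = 0
  · simp [hσ]
  · have h0 := hA.eigenvalue_nonneg hσ
    rw [← Real.rpow_mul_natCast (by positivity)]
    norm_num
    ring

theorem norm_calcL_rpow_half_le (hA : PosDiagonal A) (hb : ∀ v, ‖A v‖ ≤ b * ‖v‖) (hl : 0 < l)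
    (v : V) :
    ‖calcL A (fun u => u ^ (1 / 2 : ℝ)) v‖ ≤ ‖calcL A (fun u => (u + l) ^ (1 / 2 : ℝ)) v‖ := by
  refine hA.norm_le_norm fun σ => ?_
  rw [hA.eigenProj_calcL (hA.specBound hb fun u hu => abs_rpow_le hu (by norm_num)),
    hA.eigenProj_calcL (hA.specBound hb fun u hu => abs_add_rpow_le hl hu (by norm_num)),
    norm_smul, norm_smul]
  by_cases hσ : eigenProj A σ = 0
  · simp [hσ]
  have h0 := hA.eigenvalue_nonneg hσ
  rw [Real.norm_of_nonneg (by positivity), Real.norm_of_nonneg (by positivity)]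
  gcongr
  linarith

/-- A comparison of regularized quadratic forms, in terms of square roots. -/
theorem norm_calcL_le_of_form_le (hA : PosDiagonal A) (hB : PosDiagonal B)
    (hAb : ∀ v, ‖A v‖ ≤ b * ‖v‖) (hBb : ∀ v, ‖B v‖ ≤ b * ‖v‖) (hl : 0 < l) {K : ℝ} (hK0 : 0 ≤ K)
    (hK : ∀ v, ⟪A v, v⟫ + l * ‖v‖ ^ 2 ≤ K * (⟪B v, v⟫ + l * ‖v‖ ^ 2)) (v : V) :
    ‖calcL A (fun u => (u + l) ^ (1 / 2 : ℝ)) v‖ ≤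
      √K * ‖calcL B (fun u => (u + l) ^ (1 / 2 : ℝ)) v‖ := by
  refine le_of_sq_le_sq ?_ (by positivity)
  rw [mul_pow, Real.sq_sqrt hK0, hA.norm_sq_calcL_add_rpow hAb hl,
    hB.norm_sq_calcL_add_rpow hBb hl]
  exact hK v

end PosDiagonal

theorem norm_le_of_inner_le {w : V} {C : ℝ} (hC : 0 ≤ C) (h : ∀ v, ⟪w, v⟫ ≤ C * ‖v‖) :
    ‖w‖ ≤ C := by
  have h1 := h w
  rw [real_inner_self_eq_norm_sq, sq] at h1
  rcases (norm_nonneg w).eq_or_lt with h0 | h0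
  · rwa [← h0]
  · exact le_of_mul_le_mul_right h1 h0

/-- The filter function with the irrelevant value at `0` replaced by `0`. -/
def zeroAtZero (g : ℝ → ℝ) (u : ℝ) : ℝ := if u = 0 then 0 else g u

/-- The two defining inequalities of a filter, at a fixed regularization level `l`. -/
structure FilterBound (b τ E F l : ℝ) (g : ℝ → ℝ) : Prop where
  bound : ∀ α ∈ Set.Icc (0 : ℝ) 1, ∀ u ∈ Set.Ioc 0 b, |u ^ α * g u| * l ^ (1 - α) ≤ E
  residual : ∀ α ∈ Set.Icc (0 : ℝ) τ, ∀ u ∈ Set.Ioc 0 b, |1 - g u * u| * u ^ α * l ^ (-α) ≤ F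

namespace FilterBound

variable {b τ E F l : ℝ} {g : ℝ → ℝ}

theorem rpow_mul_le (hg : FilterBound b τ E F l g) (hl : 0 < l) (hE : 0 ≤ E) {q : ℝ} (hq : 0 ≤ q)
    (hq1 : q ≤ 1) {u : ℝ} (hu : u ∈ Set.Icc 0 b) :
    |(u + l) ^ q * zeroAtZero g u| ≤ 2 * E * l ^ (q - 1) := by
  unfold zeroAtZero
  split_ifs with h0
  · rw [mul_zero, abs_zero]; positivity
  have hu0 : 0 < u := hu.1.lt_of_ne' h0
  have h1 := hg.bound q ⟨hq, hq1⟩ u ⟨hu0, hu.2⟩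
  have h2 := hg.bound 0 ⟨le_rfl, zero_le_one⟩ u ⟨hu0, hu.2⟩
  rw [Real.rpow_zero, one_mul, sub_zero, Real.rpow_one] at h2
  have hlq : l ^ (q - 1) * l ^ (1 - q) = 1 := by
    rw [← Real.rpow_add hl, sub_add_sub_cancel', sub_self, Real.rpow_zero]
  have hlq' : l ^ q = l ^ (q - 1) * l := by
    rw [← Real.rpow_add_one hl.ne', sub_add_cancel]
  have hp : 0 < l ^ (q - 1) := Real.rpow_pos_of_pos hl _
  have hadd := Real.rpow_add_le_add_rpow hu0.le hl.le hq hq1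
  rw [abs_mul, abs_of_nonneg (by positivity)]
  rw [abs_mul, abs_of_nonneg (by positivity : 0 ≤ u ^ q)] at h1
  calc (u + l) ^ q * |g u| ≤ (u ^ q + l ^ q) * |g u| := by gcongr
    _ = l ^ (q - 1) * (u ^ q * |g u| * l ^ (1 - q)) + l ^ (q - 1) * (|g u| * l) := by
        rw [hlq']
        linear_combination (-(u ^ q * |g u|)) * hlq
    _ ≤ l ^ (q - 1) * E + l ^ (q - 1) * E := by gcongr
    _ = 2 * E * l ^ (q - 1) := by ring

theorem residual_mul_le (hg : FilterBound b τ E F l g) (hl : 0 < l) {α : ℝ} (hα : 0 ≤ α)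
    (hατ : α ≤ τ) {u : ℝ} (hu : u ∈ Set.Icc 0 b) :
    |(u + l) ^ α * (1 - zeroAtZero g u * u)| ≤ 2 ^ (τ + 1) * max F 1 * l ^ α := by
  have h2 : (2 : ℝ) ^ α ≤ 2 ^ τ := Real.rpow_le_rpow_of_exponent_le one_le_two hατ
  have h21 : (2 : ℝ) ^ (τ + 1) = 2 ^ τ * 2 := Real.rpow_add_one two_ne_zero _
  have hF : F ≤ max F 1 := le_max_left _ _
  have hF1 : 1 ≤ max F 1 := le_max_right _ _
  have hlα : 0 < l ^ α := Real.rpow_pos_of_pos hl _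
  unfold zeroAtZero
  split_ifs with h0
  · subst h0
    rw [zero_add, mul_zero, sub_zero, mul_one, abs_of_nonneg hlα.le, h21]
    have : (1 : ℝ) ≤ 2 ^ τ := Real.one_le_rpow one_le_two (hα.trans hατ)
    have h3 : 1 ≤ 2 ^ τ * 2 * max F 1 := by nlinarith
    nlinarith
  have hu0 : 0 < u := hu.1.lt_of_ne' h0
  have h1 := hg.residual α ⟨hα, hατ⟩ u ⟨hu0, hu.2⟩
  have h3 := hg.residual 0 ⟨le_rfl, hα.trans hατ⟩ u ⟨hu0, hu.2⟩
  rw [Real.rpow_zero, neg_zero, Real.rpow_zero, mul_one, mul_one] at h3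
  have hinv : l ^ α * l ^ (-α) = 1 := by
    rw [← Real.rpow_add hl, add_neg_cancel, Real.rpow_zero]
  set r := |1 - g u * u|
  have hsum : (u + l) ^ α ≤ 2 ^ α * (u ^ α + l ^ α) := by
    have hm : u + l ≤ 2 * max u l := by
      linarith [le_max_left u l, le_max_right u l]
    calc (u + l) ^ α ≤ (2 * max u l) ^ α := Real.rpow_le_rpow (by positivity) hm hα
      _ = 2 ^ α * (max u l) ^ α := Real.mul_rpow (by norm_num) (by positivity)
      _ ≤ _ := by
        gcongr
        rcases max_cases u l with h | h <;> rw [h.1] <;>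
          linarith [Real.rpow_nonneg hu0.le α, hlα.le]
  rw [abs_mul, abs_of_nonneg (by positivity)]
  calc (u + l) ^ α * r ≤ 2 ^ τ * (u ^ α + l ^ α) * r := by
        have := hsum.trans (mul_le_mul_of_nonneg_right h2 (by positivity))
        gcongr
    _ = 2 ^ τ * (l ^ α * (r * u ^ α * l ^ (-α)) + l ^ α * r) := by
        linear_combination (-(2 ^ τ * r * u ^ α)) * hinv
    _ ≤ 2 ^ τ * (l ^ α * max F 1 + l ^ α * max F 1) := by
        have := h1.trans hF
        have := h3.trans hF
        gcongr
    _ = _ := by rw [h21]; ring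

end FilterBound

namespace PosDiagonal

variable {A B : V →L[ℝ] V} {b τ E F l : ℝ} {g : ℝ → ℝ}

/-- Contribution of the noise `z` to the error, measured in the norm of `(B + l) ^ p`. -/
theorem norm_filter_noise_le (hA : PosDiagonal A) (hB : PosDiagonal B)
    (hAb : ∀ v, ‖A v‖ ≤ b * ‖v‖) (hBb : ∀ v, ‖B v‖ ≤ b * ‖v‖) (hl : 0 < l)
    (hg : FilterBound b τ E F l g) (hE : 0 ≤ E) {K η : ℝ} (hK0 : 0 ≤ K) (hη : 0 ≤ η)
    (hK : ∀ v, ⟪A v, v⟫ + l * ‖v‖ ^ 2 ≤ K * (⟪B v, v⟫ + l * ‖v‖ ^ 2)) {z : V}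
    (hz : ∀ v, ⟪z, v⟫ ≤ η * √(⟪A v, v⟫ + l * ‖v‖ ^ 2)) {p : ℝ} (hp : 0 ≤ p) (hp2 : p ≤ 1 / 2) :
    ‖calcL B (fun u => (u + l) ^ p * zeroAtZero g u) z‖ ≤
      2 * E * (√K * η) * l ^ (p - 1 / 2) := by
  have hf : SpecBound B (fun u => (u + l) ^ p * zeroAtZero g u) (2 * E * l ^ (p - 1)) :=
    hB.specBound hBb fun u hu => hg.rpow_mul_le hl hE hp (by linarith) hu
  have hf' : SpecBound B (fun u => (u + l) ^ (1 / 2 : ℝ) * ((u + l) ^ p * zeroAtZero g u))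
      (2 * E * l ^ (p - 1 / 2)) := hB.specBound hBb fun u hu => by
    have h0 := hu.1
    rw [← mul_assoc, ← Real.rpow_add (by positivity)]
    convert hg.rpow_mul_le hl hE (q := 1 / 2 + p) (by linarith) (by linarith) hu using 3
    ring
  have hs : SpecBound B (fun u => (u + l) ^ (1 / 2 : ℝ)) _ :=
    hB.specBound hBb fun u hu => abs_add_rpow_le hl hu (by norm_num)
  refine norm_le_of_inner_le (by positivity) fun v => ?_
  rw [hB.inner_calcL hf]
  refine (hz _).trans ?_
  rw [← hA.norm_sq_calcL_add_rpow hAb hl, Real.sqrt_sq (norm_nonneg _)]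
  have h1 := hA.norm_calcL_le_of_form_le hB hAb hBb hl hK0 hK
    (calcL B (fun u => (u + l) ^ p * zeroAtZero g u) v)
  rw [hB.calcL_calcL hs hf] at h1
  have h2 := hB.norm_calcL_le hf' (by positivity) v
  calc _ ≤ η * (√K * (2 * E * l ^ (p - 1 / 2) * ‖v‖)) := by
        gcongr
        exact h1.trans (by gcongr)
    _ = _ := by ring

/-- Replacing `A ^ k` by `B ^ k` behind a function of `B`: by telescoping, the cost is `k` times the
distance `D` of the operators. -/
theorem norm_calcL_pow_apply_le (hB : PosDiagonal B) (hb1 : 1 ≤ b)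
    (hAb : ∀ v, ‖A v‖ ≤ b * ‖v‖) (hBb : ∀ v, ‖B v‖ ≤ b * ‖v‖) {D : ℝ} (hD0 : 0 ≤ D)
    (hD : ∀ v, ‖A v - B v‖ ≤ D * ‖v‖) (k : ℕ) {W : ℝ → ℝ} {C : ℝ} (hC : 0 ≤ C)
    (hW : ∀ u ∈ Set.Icc 0 b, |W u| ≤ C) (x : V) :
    ‖calcL B W ((A ^ k) x)‖ ≤ ‖calcL B (fun u => W u * u ^ k) x‖ + k * C * b ^ k * D * ‖x‖ := by
  induction k generalizing W C with
  | zero => simp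
  | succ k ih =>
    have hWu : ∀ u ∈ Set.Icc 0 b, |W u * u| ≤ C * b := fun u hu => by
      rw [abs_mul, abs_of_nonneg hu.1]
      exact mul_le_mul (hW u hu) hu.2 hu.1 hC
    have h1 := ih (by positivity) hWu
    have hpow : ‖(A ^ k) x‖ ≤ b ^ k * ‖x‖ := by
      clear ih h1
      induction k with
      | zero => simp
      | succ k ih =>
        rw [pow_succ', mul_apply_eq_comp]
        refine (hAb _).trans ?_
        calc b * ‖(A ^ k) x‖ ≤ b * (b ^ k * ‖x‖) := by gcongr
          _ = _ := by ring
    have hsplit : calcL B W ((A ^ (k + 1)) x) =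
        calcL B (fun u => W u * u) ((A ^ k) x) + calcL B W (A ((A ^ k) x) - B ((A ^ k) x)) := by
      have : calcL B (fun u => W u * u) ((A ^ k) x) = calcL B W (B ((A ^ k) x)) :=
        hB.ext fun σ => by
          rw [hB.eigenProj_calcL (hB.specBound hBb hWu), hB.eigenProj_calcL (hB.specBound hBb hW),
            hB.eigenProj_apply, smul_smul]
      rw [this, ← map_add, add_sub_cancel, pow_succ', mul_apply_eq_comp]
    rw [hsplit]
    have h2 := hB.norm_calcL_le (hB.specBound hBb hW) hC (A ((A ^ k) x) - B ((A ^ k) x))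
    have h3 : ‖calcL B W (A ((A ^ k) x) - B ((A ^ k) x))‖ ≤ C * b ^ (k + 1) * D * ‖x‖ :=
      calc _ ≤ C * (D * (b ^ k * ‖x‖)) := h2.trans (by
              gcongr
              exact (hD _).trans (by gcongr))
        _ = C * b ^ k * D * ‖x‖ := by ring
        _ ≤ C * b ^ (k + 1) * D * ‖x‖ := by
              have := pow_le_pow_right₀ hb1 k.le_succ
              gcongr
    refine (norm_add_le _ _).trans ((add_le_add h1 h3).trans (le_of_eq ?_))
    simp only [mul_assoc, pow_succ' _ k]
    push_cast
    ring

/-- The residual `1 - u g(u)` of a filter of `B`, applied to the smooth vector `A ^ (k + θ) h`. The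
integer power is exchanged for `B ^ k` at a cost proportional to the distance `D` of the operators;
the fractional power is moved to `B` by duality and the comparison `hH`. -/
theorem norm_residual_rpow_le (hA : PosDiagonal A) (hB : PosDiagonal B) (hb1 : 1 ≤ b)
    (hAb : ∀ v, ‖A v‖ ≤ b * ‖v‖) (hBb : ∀ v, ‖B v‖ ≤ b * ‖v‖) (hl : 0 < l)
    (hg : FilterBound b τ E F l g) {D : ℝ} (hD0 : 0 ≤ D)
    (hD : ∀ v, ‖A v - B v‖ ≤ D * ‖v‖) {c p θ : ℝ} {k : ℕ} (hc : 0 ≤ c) (hp : 0 ≤ p) (hθ : 0 ≤ θ)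
    (hθ1 : θ ≤ 1) (hτ : p + (k + θ) ≤ τ)
    (hH : ∀ v, ‖calcL A (fun u => u ^ θ) v‖ ≤ c * ‖calcL B (fun u => (u + l) ^ θ) v‖) (h : V) :
    ‖calcL B (fun u => (u + l) ^ p * (1 - zeroAtZero g u * u))
        (calcL A (fun u => u ^ (k + θ : ℝ)) h)‖ ≤
      2 ^ (τ + 1) * max F 1 * (c * l ^ (p + (k + θ)) + k * b ^ (k + 1) * l ^ p * D) * ‖h‖ := by
  have hk : (0 : ℝ) ≤ k := k.cast_nonneg
  have hM : 0 ≤ 2 ^ (τ + 1) * max F 1 := by positivity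
  have hb0 : 0 < b := by linarith
  have hθA : SpecBound A (fun u => u ^ θ) (b ^ θ) :=
    hA.specBound hAb fun u hu => abs_rpow_le hu hθ
  have hsA : SpecBound A (fun u => u ^ (k + θ : ℝ)) (b ^ (k + θ : ℝ)) :=
    hA.specBound hAb fun u hu => abs_rpow_le hu (by positivity)
  have hW : ∀ u ∈ Set.Icc 0 b, |(u + l) ^ p * (1 - zeroAtZero g u * u)| ≤
      2 ^ (τ + 1) * max F 1 * l ^ p := fun u hu =>
    hg.residual_mul_le hl hp (by linarith) hu
  have hpow : ∀ (j : ℕ) (v : V) σ, eigenProj A σ ((A ^ j) v) = σ ^ j • eigenProj A σ v := by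
    intro j v σ
    induction j with
    | zero => simp
    | succ j ih =>
      rw [pow_succ', mul_apply_eq_comp, hA.eigenProj_apply, ih, smul_smul, pow_succ']
  have hx : calcL A (fun u => u ^ (k + θ : ℝ)) h = (A ^ k) (calcL A (fun u => u ^ θ) h) := by
    refine hA.ext fun σ => ?_
    rw [hA.eigenProj_calcL hsA, hpow, hA.eigenProj_calcL hθA, smul_smul]
    by_cases hσ : eigenProj A σ = 0
    · simp [hσ]
    · rw [Real.rpow_add_of_nonneg (hA.eigenvalue_nonneg hσ) hk hθ, Real.rpow_natCast]
  have hxn : ‖calcL A (fun u => u ^ θ) h‖ ≤ b * ‖h‖ := by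
    refine (hA.norm_calcL_le hθA (by positivity) h).trans ?_
    gcongr
    exact (Real.rpow_le_rpow_of_exponent_le hb1 hθ1).trans_eq (Real.rpow_one b)
  rw [hx]
  refine (hB.norm_calcL_pow_apply_le hb1 hAb hBb hD0 hD k (by positivity) hW _).trans ?_
  have hWk : SpecBound B (fun u => (u + l) ^ p * (1 - zeroAtZero g u * u) * u ^ k)
      (2 ^ (τ + 1) * max F 1 * l ^ p * b ^ k) := hB.specBound hBb fun u hu => by
    rw [abs_mul, abs_of_nonneg (pow_nonneg hu.1 k)]
    exact mul_le_mul (hW u hu) (pow_le_pow_left₀ hu.1 hu.2 k) (pow_nonneg hu.1 k) (by positivity)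
  have hWkθ : SpecBound B (fun u => (u + l) ^ θ *
      ((u + l) ^ p * (1 - zeroAtZero g u * u) * u ^ k))
      (2 ^ (τ + 1) * max F 1 * l ^ (p + (k + θ))) := hB.specBound hBb fun u hu => by
    have h0 := hu.1
    refine le_trans ?_ (hg.residual_mul_le hl (α := p + (k + θ)) (by positivity) hτ hu)
    have hul : 0 < u + l := by positivity
    rw [Real.rpow_add hul, Real.rpow_add hul, Real.rpow_natCast]
    simp only [abs_mul]
    rw [abs_of_nonneg (pow_nonneg h0 k), abs_of_nonneg (pow_nonneg hul.le k)]
    calc _ = |(u + l) ^ p| * u ^ k * |(u + l) ^ θ| * |1 - zeroAtZero g u * u| := by ring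
      _ ≤ |(u + l) ^ p| * (u + l) ^ k * |(u + l) ^ θ| * |1 - zeroAtZero g u * u| := by
          gcongr
          linarith
      _ = _ := by ring
  have hθB : SpecBound B (fun u => (u + l) ^ θ) ((b + l) ^ θ) :=
    hB.specBound hBb fun u hu => abs_add_rpow_le hl hu hθ
  -- the leading term, by duality and the comparison of fractional powers
  have hmain : ‖calcL B (fun u => (u + l) ^ p * (1 - zeroAtZero g u * u) * u ^ k)
      (calcL A (fun u => u ^ θ) h)‖ ≤
      2 ^ (τ + 1) * max F 1 * (c * l ^ (p + (k + θ))) * ‖h‖ := by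
    refine norm_le_of_inner_le (by positivity) fun v => ?_
    rw [hB.inner_calcL hWk, hA.inner_calcL hθA]
    refine (real_inner_le_norm _ _).trans ?_
    have h1 := hH (calcL B (fun u => (u + l) ^ p * (1 - zeroAtZero g u * u) * u ^ k) v)
    rw [hB.calcL_calcL hθB hWk] at h1
    have h2 := hB.norm_calcL_le hWkθ (by positivity) v
    calc _ ≤ ‖h‖ * (c * (2 ^ (τ + 1) * max F 1 * l ^ (p + (k + θ)) * ‖v‖)) := by
          gcongr
          exact h1.trans (by gcongr)
      _ = _ := by ring
  calc _ ≤ 2 ^ (τ + 1) * max F 1 * (c * l ^ (p + (k + θ))) * ‖h‖ +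
        k * (2 ^ (τ + 1) * max F 1 * l ^ p) * b ^ k * D * (b * ‖h‖) := by gcongr
    _ = _ := by ring

end PosDiagonal

end Deterministic

/-! ### The deterministic error bound for a source element -/

section DeterministicError

variable {V : Type*} [NormedAddCommGroup V] [InnerProductSpace ℝ V] [CompleteSpace V]

/-- The hard spectral cutoff at level `l` of the function `c u ^ s`. -/
def cutPow (c s l u : ℝ) : ℝ := if l ≤ u then c * u ^ s else 0

theorem abs_cutPow_le_of_nonneg {c s l u b : ℝ} (hc : 0 ≤ c) (hc1 : c ≤ 1) (hs : 0 ≤ s)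
    (hu : u ∈ Set.Icc 0 b) : |cutPow c s l u| ≤ b ^ s := by
  have h0 := hu.1
  have hb : 0 ≤ b := h0.trans hu.2
  have h1 := Real.rpow_le_rpow h0 hu.2 hs
  unfold cutPow
  split_ifs
  · rw [abs_of_nonneg (by positivity)]
    calc c * u ^ s ≤ 1 * b ^ s := by gcongr
      _ = _ := one_mul _
  · rw [abs_zero]; positivity

theorem abs_cutPow_le_of_nonpos {c s l u : ℝ} (hc : 0 ≤ c) (hc1 : c ≤ 1) (hs : s ≤ 0)
    (hl : 0 < l) : |cutPow c s l u| ≤ l ^ s := by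
  unfold cutPow
  split_ifs with h
  · have hu : 0 < u := hl.trans_le h
    rw [abs_of_nonneg (by positivity)]
    calc c * u ^ s ≤ 1 * l ^ s :=
          mul_le_mul hc1 (Real.rpow_le_rpow_of_nonpos hl h hs) (by positivity) zero_le_one
      _ = _ := one_mul _
  · rw [abs_zero]; positivity

namespace PosDiagonal

variable {A B : V →L[ℝ] V} {b τ E F l : ℝ} {g : ℝ → ℝ}

/-- The residual of a filter of `B` on a truncated source element of `A`. The exponent `ζ - 1/2` is
split into its integer part, where `A` is exchanged for `B`, and its fractional part, where the
Heinz inequality applies. For `ζ < 1` there is no integer part and the comparison `hK` of forms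
suffices, so that `D` is only needed for `ζ ≥ 1`. -/
theorem norm_residual_source_le (hA : PosDiagonal A) (hB : PosDiagonal B) (hb1 : 1 ≤ b)
    (hAb : ∀ v, ‖A v‖ ≤ b * ‖v‖) (hBb : ∀ v, ‖B v‖ ≤ b * ‖v‖) (hl : 0 < l)
    (hg : FilterBound b τ E F l g) {K w D C ζ : ℝ} (hK1 : 1 ≤ K) (hw : 1 ≤ w)
    (hK : ∀ v, ⟪A v, v⟫ + l * ‖v‖ ^ 2 ≤ K * (⟪B v, v⟫ + l * ‖v‖ ^ 2))
    (hC : 0 ≤ C) (hD0 : 0 ≤ D)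
    (hD : 1 ≤ ζ → (∀ v, ‖A v - B v‖ ≤ D * ‖v‖) ∧ D ≤ C * w * l ∧ D ≤ C * w * l ^ (ζ - 1 / 2))
    (hζτ : ζ ≤ τ) (hτ : 1 ≤ τ) {c : ℝ} (hc : 0 ≤ c) (hc1 : c ≤ 1) (h : V)
    {p : ℝ} (hp : 0 ≤ p) (hp2 : p ≤ 1 / 2) :
    ‖calcL B (fun u => (u + l) ^ p * (1 - zeroAtZero g u * u))
        (calcL A (cutPow c (ζ - 1 / 2) l) h)‖ ≤
      2 ^ (τ + 1) * max F 1 * ((1 + C) * (1 + ⌊ζ - 1 / 2⌋₊ * b ^ (⌊ζ - 1 / 2⌋₊ + 1))) *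
        (√K * w) * l ^ (p + (ζ - 1 / 2)) * ‖h‖ := by
  set M := 2 ^ (τ + 1) * max F 1 with hM
  have hM0 : 0 ≤ M := by positivity
  have hb0 : 0 < b := by linarith
  set k := ⌊ζ - 1 / 2⌋₊ with hk
  have hk0 : (0 : ℝ) ≤ k := k.cast_nonneg
  have hsK : 1 ≤ √K := Real.one_le_sqrt.2 hK1
  have hK0 : 0 ≤ K := by linarith
  have hw0 : 0 ≤ w := by linarith
  have hone : 1 ≤ (1 + C) * (1 + k * b ^ (k + 1)) := by
    have : 0 ≤ (k : ℝ) * b ^ (k + 1) := by positivity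
    nlinarith
  have honeK : 1 ≤ √K * w := by nlinarith
  rcases le_or_gt ζ (1 / 2) with hζ2 | hζ2
  · have h1 : SpecBound A (cutPow c (ζ - 1 / 2) l) (l ^ (ζ - 1 / 2)) := fun σ _ =>
      abs_cutPow_le_of_nonpos hc hc1 (by linarith) hl
    have h2 := hA.norm_calcL_le h1 (by positivity) h
    have h3 := hB.norm_calcL_le (hB.specBound hBb fun u hu =>
      hg.residual_mul_le hl hp (by linarith) hu) (by positivity)
      (calcL A (cutPow c (ζ - 1 / 2) l) h)
    calc _ ≤ M * l ^ p * (l ^ (ζ - 1 / 2) * ‖h‖) := h3.trans (by gcongr)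
      _ = M * 1 * 1 * l ^ (p + (ζ - 1 / 2)) * ‖h‖ := by rw [Real.rpow_add hl]; ring
      _ ≤ _ := by gcongr
  have hs : 0 ≤ ζ - 1 / 2 := by linarith
  set θ := ζ - 1 / 2 - k with hθ
  have hθ0 : 0 ≤ θ := sub_nonneg.2 (Nat.floor_le hs)
  have hθ1 : θ ≤ 1 := by
    have := Nat.lt_floor_add_one (ζ - 1 / 2)
    rw [← hk] at this
    linarith
  have hsum : (k : ℝ) + θ = ζ - 1 / 2 := by rw [hθ]; ring
  have hcut0 : ∀ u, cutPow c 0 l u = if l ≤ u then c else 0 := fun u => by simp [cutPow]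
  have hcut : SpecBound A (cutPow c 0 l) 1 := hA.specBound hAb fun u hu => by
    simpa using abs_cutPow_le_of_nonneg (l := l) hc hc1 le_rfl hu
  have hω : calcL A (cutPow c (ζ - 1 / 2) l) h =
      calcL A (fun u => u ^ (k + θ : ℝ)) (calcL A (cutPow c 0 l) h) := by
    refine hA.ext fun σ => ?_
    rw [hA.eigenProj_calcL (hA.specBound hAb fun u hu => abs_cutPow_le_of_nonneg hc hc1 hs hu),
      hA.eigenProj_calcL (hA.specBound hAb fun u hu => abs_rpow_le hu (by positivity)),
      hA.eigenProj_calcL hcut, smul_smul, hsum, hcut0, cutPow]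
    split_ifs <;> simp [mul_comm]
  have hh : ‖calcL A (cutPow c 0 l) h‖ ≤ ‖h‖ := by
    simpa using hA.norm_calcL_le hcut zero_le_one h
  -- the bound, once the fractional powers of `A` and `B + l` have been compared
  have hfin : ∀ {D' : ℝ}, 0 ≤ D' → (∀ v, ‖A v - B v‖ ≤ D' * ‖v‖) →
      k * D' ≤ k * (C * w * l ^ (ζ - 1 / 2)) → ∀ {c' : ℝ}, 0 ≤ c' → c' ≤ (1 + C) * (√K * w) →
      (∀ v, ‖calcL A (fun u => u ^ θ) v‖ ≤ c' * ‖calcL B (fun u => (u + l) ^ θ) v‖) →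
      ‖calcL B (fun u => (u + l) ^ p * (1 - zeroAtZero g u * u))
        (calcL A (cutPow c (ζ - 1 / 2) l) h)‖ ≤ M * ((1 + C) * (1 + k * b ^ (k + 1))) *
        (√K * w) * l ^ (p + (ζ - 1 / 2)) * ‖h‖ := by
    intro D' hD'0 hD' hkD c' hc'0 hc' hH
    have h1 := hA.norm_residual_rpow_le hB hb1 hAb hBb hl hg hD'0 hD' (k := k) hc'0 hp hθ0 hθ1
      (by rw [hsum]; linarith) hH (calcL A (cutPow c 0 l) h)
    rw [← hω, hsum] at h1
    refine h1.trans ?_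
    have hkb : 0 ≤ (k : ℝ) * b ^ (k + 1) := by positivity
    have hCw : C * w ≤ (1 + C) * (√K * w) := by nlinarith
    have h2 : k * b ^ (k + 1) * l ^ p * D' ≤
        k * b ^ (k + 1) * ((1 + C) * (√K * w)) * l ^ (p + (ζ - 1 / 2)) := by
      calc _ = b ^ (k + 1) * l ^ p * (k * D') := by ring
        _ ≤ b ^ (k + 1) * l ^ p * (k * (C * w * l ^ (ζ - 1 / 2))) := by gcongr
        _ = k * b ^ (k + 1) * (C * w) * l ^ (p + (ζ - 1 / 2)) := by rw [Real.rpow_add hl]; ring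
        _ ≤ _ := by gcongr
    calc _ ≤ M * ((1 + C) * (√K * w) * l ^ (p + (ζ - 1 / 2)) +
          k * b ^ (k + 1) * ((1 + C) * (√K * w)) * l ^ (p + (ζ - 1 / 2))) * ‖h‖ := by gcongr
      _ = _ := by ring
  have hθA := hA.specBound hAb (f := fun u => u ^ θ) fun u hu => abs_rpow_le hu hθ0
  have hθB := hB.specBound hBb (f := fun u => (u + l) ^ θ) fun u hu => abs_add_rpow_le hl hu hθ0
  rcases lt_or_ge ζ 1 with hζ1 | hζ1
  · -- here `k = 0` and the comparison of quadratic forms suffices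
    have hk' : k = 0 := Nat.floor_eq_zero.2 (by linarith)
    have hθ2 : 2 * θ ≤ 1 := by rw [hθ, hk']; push_cast; linarith
    refine hfin (D' := 2 * b) (by positivity) (fun v => ?_) (by simp [hk']) (c' := √K)
      (by positivity) (by nlinarith [mul_nonneg hC (by linarith : (0 : ℝ) ≤ √K * w)]) fun v => ?_
    · exact (norm_sub_le _ _).trans (by linarith [hAb v, hBb v])
    have hA2 := hA.specBound hAb (f := fun u => u ^ (1 / 2 : ℝ)) fun u hu =>
      abs_rpow_le hu (by norm_num)
    have hB1 := hB.specBound hBb (f := fun u => (u + l) ^ (1 / 2 : ℝ)) fun u hu =>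
      abs_add_rpow_le hl hu (by norm_num)
    have hB2 : SpecBound B (fun u => √K * (u + l) ^ (1 / 2 : ℝ)) (√K * (b + l) ^ (1 / 2 : ℝ)) :=
      hB.specBound hBb fun u hu => by
        rw [abs_mul, abs_of_nonneg (Real.sqrt_nonneg K)]
        exact mul_le_mul_of_nonneg_left (abs_add_rpow_le hl hu (by norm_num)) (Real.sqrt_nonneg K)
    have hB2' : ∀ v, calcL B (fun u => √K * (u + l) ^ (1 / 2 : ℝ)) v =
        √K • calcL B (fun u => (u + l) ^ (1 / 2 : ℝ)) v := fun v => hB.ext fun σ => by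
      rw [hB.eigenProj_calcL hB2, map_smul, hB.eigenProj_calcL hB1, smul_smul]
    have hz := hA.heinz hB hA2 hB2
      (fun σ hσ => Real.rpow_nonneg (hA.eigenvalue_nonneg hσ) _)
      (fun σ hσ => mul_nonneg (Real.sqrt_nonneg K)
        (Real.rpow_nonneg (by linarith [hB.eigenvalue_nonneg hσ]) _))
      (fun v => by
        rw [hB2', norm_smul, Real.norm_of_nonneg (Real.sqrt_nonneg K)]
        exact (hA.norm_calcL_rpow_half_le hAb hl v).trans
          (hA.norm_calcL_le_of_form_le hB hAb hBb hl hK0 hK v))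
      (θ := 2 * θ) (by positivity) hθ2 v
    have hA3 := SpecBound.rpow hA2
      (fun σ hσ => Real.rpow_nonneg (hA.eigenvalue_nonneg hσ) _) (θ := 2 * θ) (by positivity)
    have hB3 := SpecBound.rpow hB2
      (fun σ hσ => mul_nonneg (Real.sqrt_nonneg K)
        (Real.rpow_nonneg (by linarith [hB.eigenvalue_nonneg hσ]) _)) (θ := 2 * θ) (by positivity)
    have e1 : calcL A (fun u => (u ^ (1 / 2 : ℝ)) ^ (2 * θ)) v = calcL A (fun u => u ^ θ) v :=
      hA.ext fun σ => by
        rw [hA.eigenProj_calcL hA3, hA.eigenProj_calcL hθA]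
        by_cases hσ : eigenProj A σ = 0
        · simp [hσ]
        · rw [← Real.rpow_mul (hA.eigenvalue_nonneg hσ)]
          congr 2
          ring
    have e2 : calcL B (fun u => (√K * (u + l) ^ (1 / 2 : ℝ)) ^ (2 * θ)) v =
        √K ^ (2 * θ) • calcL B (fun u => (u + l) ^ θ) v := hB.ext fun σ => by
      rw [hB.eigenProj_calcL hB3, map_smul, hB.eigenProj_calcL hθB, smul_smul]
      by_cases hσ : eigenProj B σ = 0
      · simp [hσ]
      · have := hB.eigenvalue_nonneg hσ
        rw [Real.mul_rpow (Real.sqrt_nonneg K) (by positivity), ← Real.rpow_mul (by positivity)]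
        congr 3
        ring
    rw [e1, e2, norm_smul, Real.norm_of_nonneg (by positivity)] at hz
    refine hz.trans ?_
    gcongr
    exact (Real.rpow_le_rpow_of_exponent_le hsK hθ2).trans_eq (Real.rpow_one _)
  · -- here `A` is compared with `B + l` itself
    obtain ⟨hD1, hD2, hD3⟩ := hD hζ1
    have hcw : 1 ≤ (1 + C) * w := by nlinarith
    have hcw0 : 0 ≤ (1 + C) * w := by linarith
    refine hfin hD0 hD1 (by gcongr) (c' := (1 + C) * w) hcw0 ?_ fun v => ?_
    · rw [show (1 + C) * (√K * w) = √K * ((1 + C) * w) by ring]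
      exact le_mul_of_one_le_left hcw0 hsK
    have hA2 := hA.specBound hAb (f := fun u => u) (C := b) fun u hu => by
      rw [abs_of_nonneg hu.1]; exact hu.2
    have hB1 : SpecBound B (fun u => u + l) (b + l) := hB.specBound hBb fun u hu => by
      rw [abs_of_nonneg (by linarith [hu.1])]; linarith [hu.2]
    have hB2 : SpecBound B (fun u => (1 + C) * w * (u + l)) ((1 + C) * w * (b + l)) :=
      hB.specBound hBb fun u hu => by
        rw [abs_mul, abs_of_nonneg hcw0, abs_of_nonneg (by linarith [hu.1])]
        gcongr
        exact hu.2
    have hB2' : ∀ v, calcL B (fun u => (1 + C) * w * (u + l)) v =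
        ((1 + C) * w) • (B v + l • v) := fun v => hB.ext fun σ => by
      rw [hB.eigenProj_calcL hB2, map_smul, map_add, hB.eigenProj_apply, map_smul, ← add_smul,
        smul_smul]
    have hA2' : ∀ v, calcL A (fun u => u) v = A v := fun v => hA.ext fun σ => by
      rw [hA.eigenProj_calcL hA2, hA.eigenProj_apply]
    have hcomp : ∀ v, ‖calcL A (fun u => u) v‖ ≤ ‖calcL B (fun u => (1 + C) * w * (u + l)) v‖ := by
      intro v
      rw [hB2', hA2', norm_smul, Real.norm_of_nonneg hcw0]
      have h1 : ‖B v‖ ≤ ‖B v + l • v‖ := hB.norm_le_norm fun σ => by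
        rw [map_add, hB.eigenProj_apply, map_smul, ← add_smul, norm_smul, norm_smul]
        by_cases hσ : eigenProj B σ = 0
        · simp [hσ]
        · have := hB.eigenvalue_nonneg hσ
          rw [Real.norm_of_nonneg this, Real.norm_of_nonneg (by linarith)]
          gcongr
          linarith
      have h2 : ‖l • v‖ ≤ ‖B v + l • v‖ := hB.norm_le_norm fun σ => by
        rw [map_add, hB.eigenProj_apply, map_smul, ← add_smul, norm_smul, norm_smul]
        by_cases hσ : eigenProj B σ = 0
        · simp [hσ]
        · have := hB.eigenvalue_nonneg hσ
          rw [Real.norm_of_nonneg hl.le, Real.norm_of_nonneg (by linarith)]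
          gcongr
          linarith
      rw [norm_smul, Real.norm_of_nonneg hl.le] at h2
      calc ‖A v‖ = ‖B v + (A v - B v)‖ := by rw [add_sub_cancel]
        _ ≤ ‖B v‖ + D * ‖v‖ := (norm_add_le _ _).trans (by gcongr; exact hD1 v)
        _ ≤ ‖B v‖ + C * w * l * ‖v‖ := by gcongr
        _ = ‖B v‖ + C * w * (l * ‖v‖) := by ring
        _ ≤ ‖B v + l • v‖ + C * w * ‖B v + l • v‖ := by gcongr
        _ = (1 + C * w) * ‖B v + l • v‖ := by ring
        _ ≤ (1 + C) * w * ‖B v + l • v‖ := by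
            gcongr
            linarith
    have hpos : ∀ σ, eigenProj B σ ≠ 0 → 0 ≤ (1 + C) * w * (σ + l) := fun σ hσ =>
      mul_nonneg hcw0 (by linarith [hB.eigenvalue_nonneg hσ])
    have hz := hA.heinz hB hA2 hB2 (fun σ hσ => hA.eigenvalue_nonneg hσ) hpos hcomp hθ0 hθ1 v
    have hB3 := SpecBound.rpow hB2 hpos hθ0
    have e2 : calcL B (fun u => ((1 + C) * w * (u + l)) ^ θ) v =
        ((1 + C) * w) ^ θ • calcL B (fun u => (u + l) ^ θ) v := hB.ext fun σ => by
      rw [hB.eigenProj_calcL hB3, map_smul, hB.eigenProj_calcL hθB, smul_smul]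
      by_cases hσ : eigenProj B σ = 0
      · simp [hσ]
      · have := hB.eigenvalue_nonneg hσ
        rw [Real.mul_rpow hcw0 (by positivity)]
    rw [e2, norm_smul, Real.norm_of_nonneg (by positivity)] at hz
    refine hz.trans ?_
    gcongr
    exact (Real.rpow_le_rpow_of_exponent_le hcw hθ1).trans_eq (Real.rpow_one _)

/-- Deterministic error bound for `g(B) y` as an approximation of the truncated source element `ω`:
`η` measures the noise `y - B ω` and `K` compares `A + l` with `B + l`. -/
theorem norm_calcL_error_le (hA : PosDiagonal A) (hB : PosDiagonal B) (hb1 : 1 ≤ b)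
    (hAb : ∀ v, ‖A v‖ ≤ b * ‖v‖) (hBb : ∀ v, ‖B v‖ ≤ b * ‖v‖) (hl : 0 < l)
    (hg : FilterBound b τ E F l g) (hE : 0 ≤ E) {K w D C ζ : ℝ} (hK1 : 1 ≤ K) (hw : 1 ≤ w)
    (hK : ∀ v, ⟪A v, v⟫ + l * ‖v‖ ^ 2 ≤ K * (⟪B v, v⟫ + l * ‖v‖ ^ 2))
    (hC : 0 ≤ C) (hD0 : 0 ≤ D)
    (hD : 1 ≤ ζ → (∀ v, ‖A v - B v‖ ≤ D * ‖v‖) ∧ D ≤ C * w * l ∧ D ≤ C * w * l ^ (ζ - 1 / 2))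
    (hζτ : ζ ≤ τ) (hτ : 1 ≤ τ) {c : ℝ} (hc : 0 ≤ c) (hc1 : c ≤ 1) {h y ω : V}
    (hω : ω = calcL A (cutPow c (ζ - 1 / 2) l) h) {η Cη : ℝ} (hη : 0 ≤ η)
    (hηC : η ≤ Cη * w * l ^ ζ)
    (hz : ∀ v, ⟪y - B ω, v⟫ ≤ η * √(⟪A v, v⟫ + l * ‖v‖ ^ 2))
    {a : ℝ} (ha : 0 ≤ a) (ha2 : a ≤ 1 / 2) :
    ‖calcL A (fun u => u ^ (1 / 2 - a)) (calcL B (zeroAtZero g) y - ω)‖ ≤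
      (2 * E * Cη + 2 ^ (τ + 1) * max F 1 *
        ((1 + C) * (1 + ⌊ζ - 1 / 2⌋₊ * b ^ (⌊ζ - 1 / 2⌋₊ + 1))) * ‖h‖) *
        (w * K ^ (1 - a) * l ^ (ζ - a)) := by
  have hK0 : 0 ≤ K := by linarith
  have hw0 : 0 ≤ w := by linarith
  set M := 2 ^ (τ + 1) * max F 1 * ((1 + C) * (1 + ⌊ζ - 1 / 2⌋₊ * b ^ (⌊ζ - 1 / 2⌋₊ + 1))) with hM
  set e := calcL B (zeroAtZero g) y - ω with he
  have hlζ : 0 < l ^ ζ := Real.rpow_pos_of_pos hl _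
  have hCη : 0 ≤ Cη * w * l ^ ζ := hη.trans hηC
  have hb0 : 0 < b := by linarith
  have hM0 : 0 ≤ M := by positivity
  set X := √K * w * l ^ ζ * (2 * E * Cη + M * ‖h‖) with hX
  have hX0 : 0 ≤ X := by
    rw [hX, show √K * w * l ^ ζ * (2 * E * Cη + M * ‖h‖) =
      √K * (2 * E * (Cη * w * l ^ ζ)) + √K * w * l ^ ζ * (M * ‖h‖) by ring]
    positivity
  have hgB : SpecBound B (zeroAtZero g) (2 * E * l ^ ((0 : ℝ) - 1)) :=
    hB.specBound hBb fun u hu => by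
      simpa using hg.rpow_mul_le hl hE le_rfl zero_le_one hu
  -- the error `e` in the scale of `B + l`: `e = g(B) (y - B ω) - (1 - B g(B)) ω`
  have hmain : ∀ p : ℝ, 0 ≤ p → p ≤ 1 / 2 →
      ‖calcL B (fun u => (u + l) ^ p) e‖ ≤ X * l ^ (p - 1 / 2) := by
    intro p hp hp2
    have hpB : SpecBound B (fun u => (u + l) ^ p) ((b + l) ^ p) :=
      hB.specBound hBb fun u hu => abs_add_rpow_le hl hu hp
    have hpg := hB.specBound hBb (f := fun u => (u + l) ^ p * zeroAtZero g u) fun u hu =>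
      hg.rpow_mul_le hl hE hp (by linarith) hu
    have hpr := hB.specBound hBb (f := fun u => (u + l) ^ p * (1 - zeroAtZero g u * u))
      fun u hu => hg.residual_mul_le hl hp (by linarith) hu
    have hsplit : calcL B (fun u => (u + l) ^ p) e =
        calcL B (fun u => (u + l) ^ p * zeroAtZero g u) (y - B ω) -
          calcL B (fun u => (u + l) ^ p * (1 - zeroAtZero g u * u)) ω := hB.ext fun σ => by
      rw [he, hB.eigenProj_calcL hpB, map_sub, map_sub, hB.eigenProj_calcL hgB,
        hB.eigenProj_calcL hpg, hB.eigenProj_calcL hpr, map_sub, hB.eigenProj_apply]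
      module
    have h1 := hA.norm_filter_noise_le hB hAb hBb hl hg hE hK0 hη hK hz hp hp2
    have h2 := hA.norm_residual_source_le hB hb1 hAb hBb hl hg hK1 hw hK hC hD0 hD hζτ hτ hc hc1
      h hp hp2
    rw [← hω] at h2
    rw [hsplit]
    refine (norm_sub_le _ _).trans ((add_le_add h1 h2).trans ?_)
    have h3 : 2 * E * (√K * η) * l ^ (p - 1 / 2) ≤
        2 * E * (√K * (Cη * w * l ^ ζ)) * l ^ (p - 1 / 2) := by gcongr
    refine (add_le_add_left h3 _).trans (le_of_eq ?_)
    rw [hX, show p + (ζ - 1 / 2) = ζ + (p - 1 / 2) by ring, Real.rpow_add hl]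
    ring
  have h0 := hmain 0 le_rfl (by norm_num)
  have h12 := hmain (1 / 2) (by norm_num) le_rfl
  rw [sub_self, Real.rpow_zero, mul_one] at h12
  simp only [Real.rpow_zero] at h0
  have hone : calcL B (fun _ => (1 : ℝ)) e = e := hB.ext fun σ => by
    rw [hB.eigenProj_calcL (C := 1) (fun _ _ => by simp), one_smul]
  rw [hone, zero_sub] at h0
  have hA12 : ‖calcL A (fun u => u ^ (1 / 2 : ℝ)) e‖ ≤ √K * X :=
    (hA.norm_calcL_rpow_half_le hAb hl e).trans
      ((hA.norm_calcL_le_of_form_le hB hAb hBb hl hK0 hK e).trans (by gcongr))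
  -- interpolation between the bounds for `a = 0` and `a = 1 / 2`
  have hint := hA.norm_le_interpolate (w := calcL A (fun u => u ^ (1 / 2 - a)) e)
    (x := calcL A (fun u => u ^ (1 / 2 : ℝ)) e) (y := e) (θ := 2 * a) (by positivity)
    (by linarith) fun σ => by
      rw [hA.eigenProj_calcL (hA.specBound hAb fun u hu => abs_rpow_le hu (by linarith)),
        hA.eigenProj_calcL (hA.specBound hAb fun u hu => abs_rpow_le hu (by norm_num)),
        norm_smul, norm_smul]
      by_cases hσ : eigenProj A σ = 0
      · simp only [hσ, zero_apply, norm_zero, mul_zero]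
        positivity
      have hσ0 := hA.eigenvalue_nonneg hσ
      rw [Real.norm_of_nonneg (by positivity), Real.norm_of_nonneg (by positivity),
        Real.mul_rpow (by positivity) (norm_nonneg _), ← Real.rpow_mul hσ0, mul_assoc,
        ← Real.rpow_add_of_nonneg (norm_nonneg _) (by linarith) (by positivity),
        sub_add_cancel, Real.rpow_one, show 1 / 2 * (1 - 2 * a) = 1 / 2 - a by ring]
  refine hint.trans ?_
  calc _ ≤ (√K * X) ^ (1 - 2 * a) * (X * l ^ (-(1 / 2) : ℝ)) ^ (2 * a) := by
        gcongr
        linarith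
    _ = √K ^ (1 - 2 * a) * X * l ^ (-a) := by
        rw [Real.mul_rpow (by positivity) hX0, Real.mul_rpow hX0 (by positivity),
          ← Real.rpow_mul hl.le, show -(1 / 2) * (2 * a) = -a by ring]
        have : X ^ (1 - 2 * a) * X ^ (2 * a) = X := by
          rw [← Real.rpow_add_of_nonneg hX0 (by linarith) (by positivity), sub_add_cancel,
            Real.rpow_one]
        linear_combination (√K ^ (1 - 2 * a) * l ^ (-a)) * this
    _ = _ := by
        have hsK : 0 < √K := Real.sqrt_pos.2 (by linarith)
        have e1 : √K ^ (1 - 2 * a) * √K = K ^ (1 - a) := by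
          rw [← Real.rpow_add_one hsK.ne', Real.sqrt_eq_rpow, ← Real.rpow_mul hK0]
          congr 1
          ring
        have e2 : l ^ (ζ - a) = l ^ ζ * l ^ (-a) := by rw [← Real.rpow_add hl, sub_eq_add_neg]
        rw [hX, e2, ← e1]
        ring

end PosDiagonal

end DeterministicError

/-! ### Moments of sums of independent rank-one matrices -/

section MatrixMoments

open Matrix

variable {m : Type*} [Fintype m] [DecidableEq m]

theorem exists_orthogonal_diagonalization {X : Matrix m m ℝ} (hX : X.IsHermitian) :
    ∃ (U : Matrix m m ℝ) (e : m → ℝ), Uᵀ * U = 1 ∧ U * Uᵀ = 1 ∧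
      ∀ k, X ^ k = U * diagonal (fun a => e a ^ k) * Uᵀ := by
  set U : Matrix m m ℝ := hX.eigenvectorUnitary.1 with hU
  have h1 : Uᵀ * U = 1 := by
    have := Unitary.coe_star_mul_self hX.eigenvectorUnitary
    simpa [star_eq_conjTranspose] using this
  have h2 : U * Uᵀ = 1 := by
    have := Unitary.coe_mul_star_self hX.eigenvectorUnitary
    simpa [star_eq_conjTranspose] using this
  refine ⟨U, hX.eigenvalues, h1, h2, fun k => ?_⟩
  have hs : X = U * diagonal hX.eigenvalues * Uᵀ := by
    have := hX.spectral_theorem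
    rw [Unitary.conjStarAlgAut_apply] at this
    simpa [star_eq_conjTranspose, Function.comp_def] using this
  induction k with
  | zero => simp [h2]
  | succ k ih =>
    rw [pow_succ, ih]
    nth_rewrite 2 [hs]
    calc U * diagonal (fun a => hX.eigenvalues a ^ k) * Uᵀ * (U * diagonal hX.eigenvalues * Uᵀ)
        = U * diagonal (fun a => hX.eigenvalues a ^ k) * (Uᵀ * U) *
            diagonal hX.eigenvalues * Uᵀ := by simp only [Matrix.mul_assoc]
      _ = _ := by
        rw [h1, Matrix.mul_one, Matrix.mul_assoc U, diagonal_mul_diagonal]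
        simp only [pow_succ]

/-- Traces of products of powers of two symmetric matrices are moments of a common positive
weight on pairs of eigenvalues. -/
theorem exists_trace_pow_mul_pow {X Y : Matrix m m ℝ} (hX : X.IsHermitian) (hY : Y.IsHermitian) :
    ∃ (x y : m → ℝ) (c : m → m → ℝ), (∀ a b, 0 ≤ c a b) ∧
      ∀ i j : ℕ, (X ^ i * Y ^ j).trace = ∑ a, ∑ b, x a ^ i * y b ^ j * c a b := by
  obtain ⟨U, x, -, -, hx⟩ := exists_orthogonal_diagonalization hX
  obtain ⟨W, y, -, -, hy⟩ := exists_orthogonal_diagonalization hY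
  refine ⟨x, y, fun a b => (Uᵀ * W) a b ^ 2, fun _ _ => sq_nonneg _, fun i j => ?_⟩
  have h1 : (X ^ i * Y ^ j).trace =
      (diagonal (fun a => x a ^ i) * (Uᵀ * W) * diagonal (fun b => y b ^ j) * (Uᵀ * W)ᵀ).trace := by
    rw [hx, hy, transpose_mul, transpose_transpose]
    simp only [Matrix.mul_assoc]
    rw [trace_mul_comm U]
    simp only [Matrix.mul_assoc]
  rw [h1, trace]
  refine Finset.sum_congr rfl fun a _ => ?_
  rw [diag_apply, Matrix.mul_apply]
  refine Finset.sum_congr rfl fun b _ => ?_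
  rw [mul_diagonal, diagonal_mul, transpose_apply]
  ring

theorem pow_mul_pow_add_le {i j : ℕ} (h : Even (i + j)) (x y : ℝ) :
    x ^ i * y ^ j + x ^ j * y ^ i ≤ x ^ (i + j) + y ^ (i + j) := by
  have key : 0 ≤ (x ^ i - y ^ i) * (x ^ j - y ^ j) := by
    rcases Nat.even_or_odd i with hi | hi
    · have hj : Even j := (Nat.even_add.1 h).1 hi
      rw [← hi.pow_abs x, ← hi.pow_abs y, ← hj.pow_abs x, ← hj.pow_abs y]
      rcases le_total |x| |y| with hxy | hxy
      · exact mul_nonneg_of_nonpos_of_nonpos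
          (sub_nonpos.2 (pow_le_pow_left₀ (abs_nonneg _) hxy _))
          (sub_nonpos.2 (pow_le_pow_left₀ (abs_nonneg _) hxy _))
      · exact mul_nonneg (sub_nonneg.2 (pow_le_pow_left₀ (abs_nonneg _) hxy _))
          (sub_nonneg.2 (pow_le_pow_left₀ (abs_nonneg _) hxy _))
    · have hj : Odd j := Nat.not_even_iff_odd.1 fun hj =>
        Nat.not_even_iff_odd.2 hi ((Nat.even_add.1 h).2 hj)
      rcases le_total x y with hxy | hxy
      · exact mul_nonneg_of_nonpos_of_nonpos (sub_nonpos.2 (hi.strictMono_pow.monotone hxy))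
          (sub_nonpos.2 (hj.strictMono_pow.monotone hxy))
      · exact mul_nonneg (sub_nonneg.2 (hi.strictMono_pow.monotone hxy))
          (sub_nonneg.2 (hj.strictMono_pow.monotone hxy))
  rw [pow_add, pow_add]
  linarith

/-- The scalar mean value inequality for odd powers, with the endpoints in place of an intermediate
point. -/
theorem sub_mul_pow_sub_pow_le (q : ℕ) (x y : ℝ) :
    (x - y) * (x ^ (2 * q + 1) - y ^ (2 * q + 1)) ≤
      (2 * q + 1) / 2 * ((x - y) ^ 2 * (x ^ (2 * q) + y ^ (2 * q))) := by
  have hg := Commute.geom_sum₂_mul (Commute.all x y) (2 * q + 1)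
  have h2 : 2 * ∑ i ∈ Finset.range (2 * q + 1), x ^ i * y ^ (2 * q + 1 - 1 - i) ≤
      (2 * q + 1) * (x ^ (2 * q) + y ^ (2 * q)) := by
    have hr := Finset.sum_range_reflect (fun i => x ^ i * y ^ (2 * q + 1 - 1 - i)) (2 * q + 1)
    rw [two_mul]
    nth_rewrite 1 [← hr]
    rw [← Finset.sum_add_distrib]
    refine (Finset.sum_le_card_nsmul _ _ (x ^ (2 * q) + y ^ (2 * q)) fun i hi => ?_).trans_eq ?_
    · have hi' : i ≤ 2 * q := by have := Finset.mem_range.1 hi; omega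
      have e1 : 2 * q + 1 - 1 - i = 2 * q - i := by omega
      have e2 : 2 * q - (2 * q - i) = i := by omega
      have e3 : 2 * q - i + i = 2 * q := by omega
      rw [e1, show 2 * q + 1 - 1 - (2 * q - i) = i by omega]
      have := pow_mul_pow_add_le (i := 2 * q - i) (j := i) (by rw [e3]; exact even_two_mul q) x y
      rwa [e3] at this
    · simp only [Finset.card_range, nsmul_eq_mul]
      push_cast
      ring
  rw [← hg]
  nlinarith [mul_le_mul_of_nonneg_left h2 (sq_nonneg (x - y))]

/-- A mean value inequality for the trace of odd powers. The matrices need not commute: both sides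
are integrals of scalar expressions against the positive weight of `exists_trace_pow_mul_pow`. -/
theorem trace_sub_mul_pow_sub_pow_le {X Y : Matrix m m ℝ} (hX : X.IsHermitian) (hY : Y.IsHermitian)
    (q : ℕ) :
    ((X - Y) * (X ^ (2 * q + 1) - Y ^ (2 * q + 1))).trace ≤
      (2 * q + 1) / 2 * ((X - Y) * (X - Y) * (X ^ (2 * q) + Y ^ (2 * q))).trace := by
  obtain ⟨x, y, c, hc, h⟩ := exists_trace_pow_mul_pow hX hY
  have hL : ((X - Y) * (X ^ (2 * q + 1) - Y ^ (2 * q + 1))).trace =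
      ∑ a, ∑ b, (x a - y b) * (x a ^ (2 * q + 1) - y b ^ (2 * q + 1)) * c a b := by
    have e : ((X - Y) * (X ^ (2 * q + 1) - Y ^ (2 * q + 1))).trace =
        (X ^ (2 * q + 2) * Y ^ 0).trace - (X ^ 1 * Y ^ (2 * q + 1)).trace -
          (X ^ (2 * q + 1) * Y ^ 1).trace + (X ^ 0 * Y ^ (2 * q + 2)).trace := by
      rw [sub_mul, mul_sub, mul_sub, trace_sub, trace_sub, trace_sub,
        trace_mul_comm Y (X ^ (2 * q + 1)), ← pow_succ', ← pow_succ']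
      simp only [pow_zero, mul_one, one_mul, pow_one]
      ring
    rw [e, h, h, h, h]
    simp only [← Finset.sum_sub_distrib, ← Finset.sum_add_distrib]
    exact Finset.sum_congr rfl fun a _ => Finset.sum_congr rfl fun b _ => by ring
  have hR : ((X - Y) * (X - Y) * (X ^ (2 * q) + Y ^ (2 * q))).trace =
      ∑ a, ∑ b, (x a - y b) ^ 2 * (x a ^ (2 * q) + y b ^ (2 * q)) * c a b := by
    have e : ((X - Y) * (X - Y) * (X ^ (2 * q) + Y ^ (2 * q))).trace =
        (X ^ (2 * q + 2) * Y ^ 0).trace - 2 * (X ^ (2 * q + 1) * Y ^ 1).trace +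
          (X ^ (2 * q) * Y ^ 2).trace + (X ^ 2 * Y ^ (2 * q)).trace -
          2 * (X ^ 1 * Y ^ (2 * q + 1)).trace + (X ^ 0 * Y ^ (2 * q + 2)).trace := by
      have e1 : (X * Y * X ^ (2 * q)).trace = (X ^ (2 * q + 1) * Y ^ 1).trace := by
        rw [Matrix.mul_assoc, trace_mul_comm, Matrix.mul_assoc, ← pow_succ, trace_mul_comm, pow_one]
      have e2 : (Y * X * X ^ (2 * q)).trace = (X ^ (2 * q + 1) * Y ^ 1).trace := by
        rw [Matrix.mul_assoc, trace_mul_comm, ← pow_succ', pow_one]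
      have e3 : (Y * Y * X ^ (2 * q)).trace = (X ^ (2 * q) * Y ^ 2).trace := by
        rw [trace_mul_comm, sq]
      have e4 : (X * Y * Y ^ (2 * q)).trace = (X ^ 1 * Y ^ (2 * q + 1)).trace := by
        rw [Matrix.mul_assoc, ← pow_succ', pow_one]
      have e5 : (Y * X * Y ^ (2 * q)).trace = (X ^ 1 * Y ^ (2 * q + 1)).trace := by
        rw [Matrix.mul_assoc, trace_mul_comm, Matrix.mul_assoc, ← pow_succ, pow_one]
      have e6 : (X * X * X ^ (2 * q)).trace = (X ^ (2 * q + 2) * Y ^ 0).trace := by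
        rw [pow_zero, mul_one, ← sq, ← pow_add, add_comm]
      have e7 : (Y * Y * Y ^ (2 * q)).trace = (X ^ 0 * Y ^ (2 * q + 2)).trace := by
        rw [pow_zero, one_mul, ← sq, ← pow_add, add_comm]
      have e8 : (X * X * Y ^ (2 * q)).trace = (X ^ 2 * Y ^ (2 * q)).trace := by rw [sq]
      simp only [sub_mul, mul_sub, mul_add, trace_sub, trace_add]
      rw [e1, e2, e3, e4, e5, e6, e7, e8]
      ring
    rw [e, h, h, h, h, h, h]
    simp only [Finset.mul_sum, ← Finset.sum_sub_distrib, ← Finset.sum_add_distrib]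
    exact Finset.sum_congr rfl fun a _ => Finset.sum_congr rfl fun b _ => by ring
  rw [hL, hR, Finset.mul_sum]
  refine Finset.sum_le_sum fun a _ => ?_
  rw [Finset.mul_sum]
  refine Finset.sum_le_sum fun b _ => ?_
  have := mul_le_mul_of_nonneg_right (sub_mul_pow_sub_pow_le q (x a) (y b)) (hc a b)
  linarith

theorem trace_vecMulVec_mul (x : m → ℝ) (M : Matrix m m ℝ) :
    (vecMulVec x x * M).trace = x ⬝ᵥ M *ᵥ x := by
  rw [trace_mul_comm, mul_vecMulVec, trace_vecMulVec, dotProduct_comm]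

theorem isHermitian_vecMulVec (x : m → ℝ) : (vecMulVec x x).IsHermitian := by
  ext i j
  simp [vecMulVec_apply, mul_comm]

theorem trace_mul_pow_eq_sum {X S : Matrix m m ℝ} (hX : X.IsHermitian) (q : ℕ) :
    (S * X ^ (2 * q)).trace = ∑ j, (X ^ q) j ⬝ᵥ S *ᵥ (X ^ q) j := by
  have h : (X ^ q)ᵀ = X ^ q := by simpa using (hX.pow q).eq
  rw [two_mul, pow_add, ← Matrix.mul_assoc, trace_mul_comm, ← Matrix.mul_assoc, trace]
  refine Finset.sum_congr rfl fun j _ => ?_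
  have : (X ^ q * S * X ^ q) j j = (X ^ q * S * (X ^ q)ᵀ) j j := by rw [h]
  rw [diag_apply, this, Matrix.mul_assoc, Matrix.mul_apply, dotProduct]
  refine Finset.sum_congr rfl fun i _ => ?_
  rw [Matrix.mul_apply, mulVec, dotProduct]
  simp [transpose_apply]

theorem trace_mul_pow_nonneg {X S : Matrix m m ℝ} (hX : X.IsHermitian)
    (hS : ∀ v, 0 ≤ v ⬝ᵥ S *ᵥ v) (q : ℕ) : 0 ≤ (S * X ^ (2 * q)).trace := by
  rw [trace_mul_pow_eq_sum hX]
  exact Finset.sum_nonneg fun j _ => hS _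

/-- The square of a difference of two rank-one matrices, tested against an even power. -/
theorem trace_sq_sub_le {X : Matrix m m ℝ} (hX : X.IsHermitian) (q : ℕ) {x y : m → ℝ} {r : ℝ}
    (hx : x ⬝ᵥ x ≤ r) (hy : y ⬝ᵥ y ≤ r) :
    ((vecMulVec x x - vecMulVec y y) * (vecMulVec x x - vecMulVec y y) * X ^ (2 * q)).trace ≤
      2 * r * ((vecMulVec x x + vecMulVec y y) * X ^ (2 * q)).trace := by
  have hsq : ∀ z : m → ℝ, ∀ v : m → ℝ,
      v ⬝ᵥ (vecMulVec z z) *ᵥ v = (z ⬝ᵥ v) ^ 2 := fun z v => by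
    rw [vecMulVec_mulVec]
    simp [dotProduct_comm v z, sq]
  have key : 0 ≤ (((2 * r) • (vecMulVec x x + vecMulVec y y) -
      (vecMulVec x x - vecMulVec y y) * (vecMulVec x x - vecMulVec y y)) * X ^ (2 * q)).trace := by
    refine trace_mul_pow_nonneg hX (fun v => ?_) q
    have h1 : v ⬝ᵥ ((vecMulVec x x - vecMulVec y y) * (vecMulVec x x - vecMulVec y y)) *ᵥ v =
        (x ⬝ᵥ v) ^ 2 * (x ⬝ᵥ x) - 2 * (x ⬝ᵥ v) * (y ⬝ᵥ v) * (x ⬝ᵥ y) +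
          (y ⬝ᵥ v) ^ 2 * (y ⬝ᵥ y) := by
      simp only [sub_mul, mul_sub, vecMulVec_mul_vecMulVec, sub_mulVec, smul_mulVec,
        vecMulVec_mulVec, dotProduct_sub, dotProduct_smul, vecMulVec_smul]
      simp [dotProduct_comm v x, dotProduct_comm v y, dotProduct_comm y x]
      ring
    rw [sub_mulVec, dotProduct_sub, smul_mulVec, dotProduct_smul, add_mulVec, dotProduct_add, hsq,
      hsq, h1, smul_eq_mul]
    -- `2 s t ⟨x, y⟩ ≥ - s² ⟨x, x⟩ - t² ⟨y, y⟩` because `‖s x + t y‖² ≥ 0`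
    have h3 : 0 ≤ ((x ⬝ᵥ v) • x + (y ⬝ᵥ v) • y) ⬝ᵥ ((x ⬝ᵥ v) • x + (y ⬝ᵥ v) • y) := by
      exact Finset.sum_nonneg fun i _ => mul_self_nonneg _
    simp only [add_dotProduct, dotProduct_add, smul_dotProduct, dotProduct_smul, smul_eq_mul,
      dotProduct_comm y x] at h3
    nlinarith [mul_le_mul_of_nonneg_left hx (sq_nonneg (x ⬝ᵥ v)),
      mul_le_mul_of_nonneg_left hy (sq_nonneg (y ⬝ᵥ v))]
  rw [sub_mul, trace_sub, smul_mul, trace_smul, smul_eq_mul] at key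
  linarith

end MatrixMoments

/-! ### Exchangeable pairs of random matrices -/

section RandomMatrix

open Matrix

variable {m : Type*} [Fintype m] [DecidableEq m]

theorem integrable_of_continuous_of_ae_mem {X : Type*} [TopologicalSpace X] [MeasurableSpace X]
    [OpensMeasurableSpace X] [T2Space X] {μ : Measure X} [IsFiniteMeasure μ] {K : Set X}
    (hK : IsCompact K) (h : ∀ᵐ x ∂μ, x ∈ K) {f : X → ℝ} (hf : Continuous f) : Integrable f μ := by
  rw [← Measure.restrict_eq_self_of_ae_mem h]
  exact hf.continuousOn.integrableOn_compact hK

/-- The second moment matrix of a distribution on vectors. -/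
def momentMatrix (ν : Measure (m → ℝ)) : Matrix m m ℝ := fun i j => ∫ x, x i * x j ∂ν

/-- The Euclidean ball of squared radius `r`, in the space of functions. -/
def ballSet (m : Type*) [Fintype m] (r : ℝ) : Set (m → ℝ) := {x | x ⬝ᵥ x ≤ r}

theorem isCompact_ballSet (r : ℝ) : IsCompact (ballSet m r) := by
  refine Metric.isCompact_of_isClosed_isBounded ?_ ?_
  · exact isClosed_le (by unfold dotProduct; fun_prop) continuous_const
  · refine (Metric.isBounded_closedBall (x := (0 : m → ℝ)) (r := √r)).subset fun x hx => ?_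
    rw [mem_closedBall_zero_iff, pi_norm_le_iff_of_nonneg (Real.sqrt_nonneg r)]
    intro i
    refine Real.abs_le_sqrt ?_
    have : x i * x i ≤ x ⬝ᵥ x :=
      Finset.single_le_sum (f := fun i => x i * x i) (fun i _ => mul_self_nonneg _)
        (Finset.mem_univ i)
    rw [sq]
    exact this.trans hx

theorem isHermitian_momentMatrix (ν : Measure (m → ℝ)) : (momentMatrix ν).IsHermitian := by
  ext i j
  simp [momentMatrix, mul_comm]

theorem continuous_vecMulVec_self : Continuous fun x : m → ℝ => vecMulVec x x := by
  refine continuous_matrix fun i j => ?_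
  simp only [vecMulVec_apply]
  fun_prop

variable {ν : Measure (m → ℝ)} [IsProbabilityMeasure ν] {r : ℝ}

theorem integral_dotProduct_mulVec (hν : ∀ᵐ x ∂ν, x ∈ ballSet m r) (M : Matrix m m ℝ) :
    ∫ x, (vecMulVec x x * M).trace ∂ν = (momentMatrix ν * M).trace := by
  have hi : ∀ i j, Integrable (fun x : m → ℝ => x i * x j * M j i) ν := fun i j =>
    integrable_of_continuous_of_ae_mem (isCompact_ballSet r) hν (by fun_prop)
  simp only [trace, diag_apply, Matrix.mul_apply, vecMulVec_apply, momentMatrix]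
  rw [integral_finsetSum _ fun i _ => integrable_finsetSum _ fun j _ => hi i j]
  refine Finset.sum_congr rfl fun i _ => ?_
  rw [integral_finsetSum _ fun j _ => hi i j]
  exact Finset.sum_congr rfl fun j _ => integral_mul_const _ _

/-- One step of the exchangeable pair argument. Symmetrizing over an independent copy `y` of `x`
turns the left-hand side into half the integral of `tr ((x xᵀ - y yᵀ) (X ^ (2q+1) - Y ^ (2q+1)))`,
where `X` and `Y` are the two values of the matrix; the mean value inequality applies to it because
`X - Y = c (x xᵀ - y yᵀ)`. -/
theorem integral_trace_exchange_le (hν : ∀ᵐ x ∂ν, x ∈ ballSet m r) {R : Matrix m m ℝ}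
    (hR : R.IsHermitian) {c : ℝ} (hc : 0 < c) (q : ℕ) :
    ∫ x, ((vecMulVec x x - momentMatrix ν) * (R + c • vecMulVec x x) ^ (2 * q + 1)).trace ∂ν ≤
      (2 * q + 1) * (c * r) *
        ∫ x, ((vecMulVec x x + momentMatrix ν) * (R + c • vecMulVec x x) ^ (2 * q)).trace ∂ν := by
  set S := momentMatrix ν with hS
  set f : (m → ℝ) → Matrix m m ℝ := fun x => R + c • vecMulVec x x with hf
  have hfc : Continuous f := continuous_const.add (continuous_vecMulVec_self.const_smul c)
  have hfH : ∀ x, (f x).IsHermitian := fun x => hR.add ((isHermitian_vecMulVec x).smul (by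
    exact IsSelfAdjoint.all c))
  have hK := isCompact_ballSet (m := m) r
  have hν2 : ∀ᵐ z ∂(ν.prod ν), z ∈ ballSet m r ×ˢ ballSet m r := by
    filter_upwards [Measure.quasiMeasurePreserving_fst.ae hν,
      Measure.quasiMeasurePreserving_snd.ae hν] with z h1 h2 using ⟨h1, h2⟩
  have hint : ∀ {g : (m → ℝ) × (m → ℝ) → ℝ}, Continuous g → Integrable g (ν.prod ν) := fun hg =>
    integrable_of_continuous_of_ae_mem (hK.prod hK) hν2 hg
  have hint1 : ∀ {g : (m → ℝ) → ℝ}, Continuous g → Integrable g ν := fun hg =>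
    integrable_of_continuous_of_ae_mem hK hν hg
  have hv := continuous_vecMulVec_self (m := m)
  have htr : ∀ {X : Type _} [TopologicalSpace X] {g : X → Matrix m m ℝ}, Continuous g →
      Continuous fun x => (g x).trace := fun hg => hg.matrix_trace
  have cf1 := hfc.comp (continuous_fst (X := m → ℝ) (Y := m → ℝ))
  have cf2 := hfc.comp (continuous_snd (X := m → ℝ) (Y := m → ℝ))
  have cv1 := hv.comp (continuous_fst (X := m → ℝ) (Y := m → ℝ))
  have cv2 := hv.comp (continuous_snd (X := m → ℝ) (Y := m → ℝ))
  simp only [Function.comp_def] at cf1 cf2 cv1 cv2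
  -- integrals over pairs with a power depending on one of the two points
  have hpair : ∀ (k : ℕ) (s : ℝ),
      ∫ z : (m → ℝ) × (m → ℝ), ((vecMulVec z.1 z.1 + s • vecMulVec z.2 z.2) * f z.1 ^ k).trace
        ∂(ν.prod ν) = ∫ x, ((vecMulVec x x + s • S) * f x ^ k).trace ∂ν := by
    intro k s
    have hc1 : Continuous fun z : (m → ℝ) × (m → ℝ) =>
        ((vecMulVec z.1 z.1 + s • vecMulVec z.2 z.2) * f z.1 ^ k).trace :=
      htr ((cv1.add (cv2.const_smul s)).mul (cf1.pow k))
    rw [integral_prod _ (hint hc1)]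
    refine integral_congr_ae (Eventually.of_forall fun x => ?_)
    dsimp only
    simp only [add_mul, trace_add, smul_mul, trace_smul]
    have hc2 : Continuous fun y : m → ℝ => s • (vecMulVec y y * f x ^ k).trace :=
      (htr (hv.mul continuous_const)).const_smul s
    rw [integral_add (integrable_const _) (hint1 hc2), integral_smul,
      integral_dotProduct_mulVec hν]
    simp [hS]
  have hswap : ∀ {g : (m → ℝ) × (m → ℝ) → ℝ}, ∫ z, g z.swap ∂(ν.prod ν) = ∫ z, g z ∂(ν.prod ν) :=
    fun {g} => integral_prod_swap g
  set n := 2 * q + 1 with hn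
  have hL : ∫ z : (m → ℝ) × (m → ℝ), ((vecMulVec z.1 z.1 - vecMulVec z.2 z.2) *
      (f z.1 ^ n - f z.2 ^ n)).trace ∂(ν.prod ν) =
      2 * ∫ x, ((vecMulVec x x - S) * f x ^ n).trace ∂ν := by
    have h1 := hpair n (-1)
    have h2 := hswap (g := fun z : (m → ℝ) × (m → ℝ) =>
      ((vecMulVec z.1 z.1 + (-1 : ℝ) • vecMulVec z.2 z.2) * f z.1 ^ n).trace)
    simp only [Prod.fst_swap, Prod.snd_swap, neg_one_smul, ← sub_eq_add_neg] at h1 h2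
    have hc1 : Continuous fun z : (m → ℝ) × (m → ℝ) =>
        ((vecMulVec z.1 z.1 - vecMulVec z.2 z.2) * f z.1 ^ n).trace :=
      htr ((cv1.sub cv2).mul (cf1.pow _))
    have hc2 : Continuous fun z : (m → ℝ) × (m → ℝ) =>
        ((vecMulVec z.2 z.2 - vecMulVec z.1 z.1) * f z.2 ^ n).trace :=
      htr ((cv2.sub cv1).mul (cf2.pow _))
    have h3 := integral_add (hint hc1) (hint hc2)
    rw [h2, h1] at h3
    rw [two_mul (∫ x, _ ∂ν), ← h3]
    refine integral_congr_ae (Eventually.of_forall fun z => ?_)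
    dsimp only
    rw [← trace_add]
    congr 1
    noncomm_ring
  have hRt : ∫ z : (m → ℝ) × (m → ℝ), ((vecMulVec z.1 z.1 + vecMulVec z.2 z.2) *
      (f z.1 ^ (2 * q) + f z.2 ^ (2 * q))).trace ∂(ν.prod ν) =
      2 * ∫ x, ((vecMulVec x x + S) * f x ^ (2 * q)).trace ∂ν := by
    have h1 := hpair (2 * q) 1
    have h2 := hswap (g := fun z : (m → ℝ) × (m → ℝ) =>
      ((vecMulVec z.1 z.1 + (1 : ℝ) • vecMulVec z.2 z.2) * f z.1 ^ (2 * q)).trace)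
    simp only [Prod.fst_swap, Prod.snd_swap, one_smul] at h1 h2
    have hc1 : Continuous fun z : (m → ℝ) × (m → ℝ) =>
        ((vecMulVec z.1 z.1 + vecMulVec z.2 z.2) * f z.1 ^ (2 * q)).trace :=
      htr ((cv1.add cv2).mul (cf1.pow _))
    have hc2 : Continuous fun z : (m → ℝ) × (m → ℝ) =>
        ((vecMulVec z.2 z.2 + vecMulVec z.1 z.1) * f z.2 ^ (2 * q)).trace :=
      htr ((cv2.add cv1).mul (cf2.pow _))
    have h3 := integral_add (hint hc1) (hint hc2)
    rw [h2, h1] at h3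
    rw [two_mul (∫ x, _ ∂ν), ← h3]
    refine integral_congr_ae (Eventually.of_forall fun z => ?_)
    dsimp only
    rw [← trace_add]
    congr 1
    noncomm_ring
  have hpt : ∀ z ∈ ballSet m r ×ˢ ballSet m r, ((vecMulVec z.1 z.1 - vecMulVec z.2 z.2) *
      (f z.1 ^ n - f z.2 ^ n)).trace ≤ (2 * q + 1) * (c * r) *
        ((vecMulVec z.1 z.1 + vecMulVec z.2 z.2) *
          (f z.1 ^ (2 * q) + f z.2 ^ (2 * q))).trace := by
    rintro ⟨x, y⟩ ⟨hx, hy⟩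
    dsimp only at hx hy ⊢
    have hfd : f x - f y = c • (vecMulVec x x - vecMulVec y y) := by
      simp only [hf, smul_sub]; abel
    have h1 := trace_sub_mul_pow_sub_pow_le (hfH x) (hfH y) q
    rw [hfd, smul_mul, trace_smul, smul_mul_smul_comm, smul_mul, trace_smul, smul_eq_mul,
      smul_eq_mul] at h1
    have h2 := trace_sq_sub_le (hfH x) q hx hy
    have h3 := trace_sq_sub_le (hfH y) q hx hy
    rw [mul_add, trace_add] at h1
    rw [mul_add, trace_add]
    have h4 : c * ((vecMulVec x x - vecMulVec y y) * (f x ^ n - f y ^ n)).trace ≤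
        c * ((2 * q + 1) * (c * r) * (((vecMulVec x x + vecMulVec y y) * f x ^ (2 * q)).trace +
          ((vecMulVec x x + vecMulVec y y) * f y ^ (2 * q)).trace)) := by
      refine h1.trans ?_
      calc _ ≤ (2 * q + 1) / 2 * (c * c *
            (2 * r * ((vecMulVec x x + vecMulVec y y) * f x ^ (2 * q)).trace +
              2 * r * ((vecMulVec x x + vecMulVec y y) * f y ^ (2 * q)).trace)) := by gcongr
        _ = _ := by ring
    exact le_of_mul_le_mul_left h4 hc
  have hc1 : Continuous fun z : (m → ℝ) × (m → ℝ) =>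
      ((vecMulVec z.1 z.1 - vecMulVec z.2 z.2) * (f z.1 ^ n - f z.2 ^ n)).trace :=
    htr ((cv1.sub cv2).mul ((cf1.pow n).sub (cf2.pow n)))
  have hc2 : Continuous fun z : (m → ℝ) × (m → ℝ) =>
      ((vecMulVec z.1 z.1 + vecMulVec z.2 z.2) * (f z.1 ^ (2 * q) + f z.2 ^ (2 * q))).trace :=
    htr ((cv1.add cv2).mul ((cf1.pow (2 * q)).add (cf2.pow (2 * q))))
  have hmono := integral_mono_ae (hint hc1) ((hint hc2).const_mul ((2 * q + 1) * (c * r)))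
    (hν2.mono fun z hz => hpt z hz)
  rw [hL, integral_const_mul, hRt] at hmono
  linarith

/-- The centred empirical second moment matrix. -/
def empDev (ν : Measure (m → ℝ)) {n : ℕ} (x : Fin n → m → ℝ) : Matrix m m ℝ :=
  (n : ℝ)⁻¹ • ∑ i, vecMulVec (x i) (x i) - momentMatrix ν

theorem isHermitian_empDev {n : ℕ} (x : Fin n → m → ℝ) : (empDev ν x).IsHermitian := by
  have h : (∑ i, vecMulVec (x i) (x i)).IsHermitian := by
    refine Finset.sum_induction _ Matrix.IsHermitian (fun _ _ => IsHermitian.add)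
      isHermitian_zero fun i _ => isHermitian_vecMulVec _
  exact (h.smul (IsSelfAdjoint.all _)).sub (isHermitian_momentMatrix ν)

theorem continuous_empDev {n : ℕ} : Continuous fun x : Fin n → m → ℝ => empDev ν x := by
  have h : Continuous fun x : Fin n → m → ℝ => ∑ i, vecMulVec (x i) (x i) :=
    continuous_finsetSum _ fun i _ => continuous_vecMulVec_self.comp (continuous_apply i)
  exact (h.const_smul (n : ℝ)⁻¹).sub continuous_const

theorem ae_pi_mem_ballSet (hν : ∀ᵐ x ∂ν, x ∈ ballSet m r) (n : ℕ) :
    ∀ᵐ x ∂(Measure.pi fun _ : Fin n => ν), x ∈ Set.univ.pi fun _ : Fin n => ballSet m r := by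
  have : ∀ i : Fin n, ∀ᵐ x ∂(Measure.pi fun _ : Fin n => ν), x i ∈ ballSet m r := fun i =>
    (Measure.quasiMeasurePreserving_eval (fun _ : Fin n => ν) i).ae hν
  filter_upwards [ae_all_iff.2 this] with x hx i _ using hx i

theorem integrable_pi_of_continuous (hν : ∀ᵐ x ∂ν, x ∈ ballSet m r) {n : ℕ}
    {g : (Fin n → m → ℝ) → ℝ} (hg : Continuous g) :
    Integrable g (Measure.pi fun _ : Fin n => ν) :=
  integrable_of_continuous_of_ae_mem (isCompact_univ_pi fun _ => isCompact_ballSet r)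
    (ae_pi_mem_ballSet hν n) hg

/-- The exchange inequality for one coordinate of the sample. -/
theorem integral_pi_exchange_le (hν : ∀ᵐ x ∂ν, x ∈ ballSet m r) {n : ℕ} (i : Fin n) (q : ℕ) :
    ∫ x : Fin n → m → ℝ, ((vecMulVec (x i) (x i) - momentMatrix ν) *
        empDev ν x ^ (2 * q + 1)).trace ∂(Measure.pi fun _ => ν) ≤
      (2 * q + 1) * (r / n) * ∫ x : Fin n → m → ℝ, ((vecMulVec (x i) (x i) + momentMatrix ν) *
        empDev ν x ^ (2 * q)).trace ∂(Measure.pi fun _ => ν) := by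
  obtain ⟨N, rfl⟩ : ∃ N, n = N + 1 := ⟨n - 1, by have := i.2; omega⟩
  have hmp := (measurePreserving_piFinSuccAbove (fun _ : Fin (N + 1) => ν) i).symm
  set c : ℝ := ((N + 1 : ℕ) : ℝ)⁻¹ with hc
  have hc0 : 0 < c := by positivity
  have hcr : r / ((N + 1 : ℕ) : ℝ) = c * r := by rw [hc, div_eq_inv_mul]
  set R : (Fin N → m → ℝ) → Matrix m m ℝ := fun y =>
    c • ∑ j, vecMulVec (y j) (y j) - momentMatrix ν with hR
  have hRH : ∀ y, (R y).IsHermitian := fun y => by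
    have h : (∑ i, vecMulVec (y i) (y i)).IsHermitian :=
      Finset.sum_induction _ Matrix.IsHermitian (fun _ _ => IsHermitian.add)
        isHermitian_zero fun i _ => isHermitian_vecMulVec _
    exact (h.smul (IsSelfAdjoint.all _)).sub (isHermitian_momentMatrix ν)
  have hRc : Continuous R := by
    have h : Continuous fun y : Fin N → m → ℝ => ∑ j, vecMulVec (y j) (y j) :=
      continuous_finsetSum _ fun i _ => continuous_vecMulVec_self.comp (continuous_apply i)
    exact (h.const_smul c).sub continuous_const
  have hemp : ∀ z : (m → ℝ) × (Fin N → m → ℝ),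
      empDev ν (i.insertNth z.1 z.2 : Fin (N + 1) → m → ℝ) = R z.2 + c • vecMulVec z.1 z.1 := by
    intro z
    rw [empDev, Fin.sum_univ_succAbove _ i]
    simp only [Fin.insertNth_apply_same, Fin.insertNth_apply_succAbove, smul_add, hR]
    abel
  have hint : ∀ {g : (m → ℝ) × (Fin N → m → ℝ) → ℝ}, Continuous g →
      Integrable g (ν.prod (Measure.pi fun _ : Fin N => ν)) := fun hg => by
    refine integrable_of_continuous_of_ae_mem ((isCompact_ballSet r).prod
      (isCompact_univ_pi fun _ => isCompact_ballSet r)) ?_ hg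
    filter_upwards [Measure.quasiMeasurePreserving_fst.ae hν,
      Measure.quasiMeasurePreserving_snd.ae (ae_pi_mem_ballSet hν N)] with z h1 h2 using ⟨h1, h2⟩
  have hcv : Continuous fun z : (m → ℝ) × (Fin N → m → ℝ) => vecMulVec z.1 z.1 :=
    continuous_vecMulVec_self.comp continuous_fst
  have hcR : Continuous fun z : (m → ℝ) × (Fin N → m → ℝ) => R z.2 + c • vecMulVec z.1 z.1 :=
    (hRc.comp continuous_snd).add (hcv.const_smul c)
  have hc1 : Continuous fun z : (m → ℝ) × (Fin N → m → ℝ) =>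
      ((vecMulVec z.1 z.1 - momentMatrix ν) *
        (R z.2 + c • vecMulVec z.1 z.1) ^ (2 * q + 1)).trace :=
    ((hcv.sub continuous_const).mul (hcR.pow _)).matrix_trace
  have hc2 : Continuous fun z : (m → ℝ) × (Fin N → m → ℝ) =>
      ((vecMulVec z.1 z.1 + momentMatrix ν) * (R z.2 + c • vecMulVec z.1 z.1) ^ (2 * q)).trace :=
    ((hcv.add continuous_const).mul (hcR.pow _)).matrix_trace
  have hI1 := hint hc1
  have hI2 := hint hc2
  have e : ∀ z : (m → ℝ) × (Fin N → m → ℝ),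
      (MeasurableEquiv.piFinSuccAbove (fun _ : Fin (N + 1) => m → ℝ) i).symm z =
        (i.insertNth z.1 z.2 : Fin (N + 1) → m → ℝ) := fun z => rfl
  rw [← hmp.integral_comp', ← hmp.integral_comp', hcr]
  simp only [e, hemp, Fin.insertNth_apply_same]
  rw [integral_prod_symm _ hI1, integral_prod_symm _ hI2, ← integral_const_mul]
  exact integral_mono hI1.integral_prod_right (hI2.integral_prod_right.const_mul _) fun y =>
    integral_trace_exchange_le hν (hRH y) hc0 q

end RandomMatrix

/-! ### Concentration of random matrices -/

section RandomMatrixTail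

open Matrix

variable {m : Type*} [Fintype m] [DecidableEq m] {ν : Measure (m → ℝ)} [IsProbabilityMeasure ν]
  {r : ℝ}

/-- The expectation of `tr X ^ k` for the centred empirical second moment matrix `X`. -/
def traceMoment (ν : Measure (m → ℝ)) (n k : ℕ) : ℝ :=
  ∫ x : Fin n → m → ℝ, (empDev ν x ^ k).trace ∂(Measure.pi fun _ => ν)

/-- The exchange inequality, averaged over the sample. -/
theorem traceMoment_succ_le (hν : ∀ᵐ x ∂ν, x ∈ ballSet m r) {n : ℕ} (hn : n ≠ 0) (q : ℕ) :
    traceMoment ν n (2 * q + 2) ≤ (2 * q + 1) * (r / n) *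
      ∫ x : Fin n → m → ℝ, ((empDev ν x + (2 : ℝ) • momentMatrix ν) * empDev ν x ^ (2 * q)).trace
        ∂(Measure.pi fun _ => ν) := by
  set S := momentMatrix ν
  have hn0 : (n : ℝ) ≠ 0 := Nat.cast_ne_zero.2 hn
  have hX := continuous_empDev (ν := ν) (n := n)
  have hvi : ∀ i : Fin n, Continuous fun x : Fin n → m → ℝ => vecMulVec (x i) (x i) := fun i =>
    continuous_vecMulVec_self.comp (continuous_apply i)
  have hI : ∀ (s : ℝ) (k : ℕ) (i : Fin n), Integrable (fun x : Fin n → m → ℝ =>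
      ((vecMulVec (x i) (x i) + s • S) * empDev ν x ^ k).trace) (Measure.pi fun _ => ν) :=
    fun s k i => by
      have hc : Continuous fun x : Fin n → m → ℝ =>
          ((vecMulVec (x i) (x i) + s • S) * empDev ν x ^ k).trace :=
        (((hvi i).add continuous_const).mul (hX.pow k)).matrix_trace
      exact integrable_pi_of_continuous hν hc
  have havg : ∀ (s : ℝ) (k : ℕ), ∫ x : Fin n → m → ℝ,
      ((empDev ν x + (1 + s) • S) * empDev ν x ^ k).trace ∂(Measure.pi fun _ => ν) =
      (n : ℝ)⁻¹ * ∑ i, ∫ x : Fin n → m → ℝ,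
        ((vecMulVec (x i) (x i) + s • S) * empDev ν x ^ k).trace ∂(Measure.pi fun _ => ν) := by
    intro s k
    rw [← integral_finsetSum _ fun i _ => hI s k i, ← integral_const_mul]
    refine integral_congr_ae (Eventually.of_forall fun x => ?_)
    dsimp only
    rw [← trace_sum, ← Finset.sum_mul, ← smul_eq_mul (n : ℝ)⁻¹, ← trace_smul, ← smul_mul]
    congr 2
    rw [Finset.sum_add_distrib, smul_add, Finset.sum_const, Finset.card_univ, Fintype.card_fin,
      ← Nat.cast_smul_eq_nsmul ℝ, smul_smul, inv_mul_cancel₀ hn0, one_smul, add_smul, one_smul,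
      ← add_assoc]
    congr 1
    rw [empDev, sub_add_cancel]
  have h1 := havg (-1) (2 * q + 1)
  have h2 := havg 1 (2 * q)
  rw [show (1 : ℝ) + 1 = 2 by norm_num] at h2
  rw [add_neg_cancel, zero_smul] at h1
  simp only [add_zero, ← pow_succ', neg_one_smul, ← sub_eq_add_neg] at h1
  rw [traceMoment, h1, h2, mul_left_comm]
  simp only [one_smul]
  refine mul_le_mul_of_nonneg_left ?_ (by positivity)
  rw [Finset.mul_sum]
  exact Finset.sum_le_sum fun i _ => integral_pi_exchange_le hν i q

theorem trace_pow_two_mul_nonneg {X : Matrix m m ℝ} (hX : X.IsHermitian) (q : ℕ) :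
    0 ≤ (X ^ (2 * q)).trace := by
  have := trace_mul_pow_nonneg hX (S := 1) (fun v => by
    rw [one_mulVec]; exact Finset.sum_nonneg fun i _ => mul_self_nonneg _) q
  rwa [one_mul] at this

/-- Even trace moments by induction. One moment is bounded by half of itself and a multiple of the
preceding even one; only the first step involves the trace of the second moment matrix, which is why
the bound depends on the dimension only through `N`. -/
theorem traceMoment_le (hν : ∀ᵐ x ∂ν, x ∈ ballSet m r) (hr : 0 ≤ r) {n : ℕ} (hn : n ≠ 0) {N : ℝ}
    (hN : (momentMatrix ν).trace ≤ N) (h1 : ∀ v, v ⬝ᵥ momentMatrix ν *ᵥ v ≤ v ⬝ᵥ v) {p : ℕ}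
    (hp : 1 ≤ p) (hpr : (2 * p - 1) * (r / n) ≤ 1) :
    traceMoment ν n (2 * p) ≤ N * (10 * p * (r / n)) ^ p := by
  have hn0 : (0 : ℝ) < n := Nat.cast_pos.2 (Nat.pos_of_ne_zero hn)
  set s := r / n with hs
  have hs0 : 0 ≤ s := by positivity
  set S := momentMatrix ν with hS
  have hX := continuous_empDev (ν := ν) (n := n)
  have hI : ∀ (k : ℕ), Integrable (fun x : Fin n → m → ℝ => (empDev ν x ^ k).trace)
      (Measure.pi fun _ => ν) := fun k => by
    have hc : Continuous fun x : Fin n → m → ℝ => (empDev ν x ^ k).trace :=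
      (hX.pow k).matrix_trace
    exact integrable_pi_of_continuous hν hc
  have hIS : ∀ (k : ℕ), Integrable (fun x : Fin n → m → ℝ =>
      ((empDev ν x + (2 : ℝ) • S) * empDev ν x ^ k).trace) (Measure.pi fun _ => ν) := fun k => by
    have hc : Continuous fun x : Fin n → m → ℝ =>
        ((empDev ν x + (2 : ℝ) • S) * empDev ν x ^ k).trace :=
      ((hX.add continuous_const).mul (hX.pow k)).matrix_trace
    exact integrable_pi_of_continuous hν hc
  have hSnn : 0 ≤ S.trace := Finset.sum_nonneg fun i _ =>
    integral_nonneg fun x => mul_self_nonneg _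
  have hN0 : 0 ≤ N := hSnn.trans hN
  -- the first step, where the trace of the second moment matrix enters
  have hfirst : traceMoment ν n 2 ≤ s * (2 * N) := by
    have h := traceMoment_succ_le hν hn 0
    have hmean : ∫ x : Fin n → m → ℝ, (empDev ν x + (2 : ℝ) • S).trace ∂(Measure.pi fun _ => ν) =
        2 * S.trace := by
      have hvi : ∀ i : Fin n, ∫ x : Fin n → m → ℝ, (vecMulVec (x i) (x i)).trace
          ∂(Measure.pi fun _ => ν) = S.trace := fun i => by
        have h4 := integral_dotProduct_mulVec hν 1
        simp only [mul_one] at h4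
        rw [hS, ← h4]
        exact integral_comp_eval (μ := fun _ : Fin n => ν) (i := i)
          (continuous_vecMulVec_self.matrix_trace).aestronglyMeasurable
      have hIi : ∀ i : Fin n, Integrable (fun x : Fin n → m → ℝ => (vecMulVec (x i) (x i)).trace)
          (Measure.pi fun _ => ν) := fun i => by
        have hc : Continuous fun x : Fin n → m → ℝ => (vecMulVec (x i) (x i)).trace :=
          (continuous_vecMulVec_self.comp (continuous_apply i)).matrix_trace
        exact integrable_pi_of_continuous hν hc
      simp only [empDev, trace_add, trace_sub, trace_smul, trace_sum, smul_eq_mul]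
      have hsum : Integrable (fun x : Fin n → m → ℝ =>
          (n : ℝ)⁻¹ * ∑ i, (vecMulVec (x i) (x i)).trace) (Measure.pi fun _ => ν) :=
        (integrable_finsetSum _ fun i _ => hIi i).const_mul _
      have hsub : Integrable (fun x : Fin n → m → ℝ =>
          (n : ℝ)⁻¹ * ∑ i, (vecMulVec (x i) (x i)).trace - (momentMatrix ν).trace)
          (Measure.pi fun _ => ν) := hsum.sub (integrable_const _)
      rw [integral_add hsub (integrable_const _), integral_sub hsum (integrable_const _),
        integral_const_mul, integral_finsetSum _ fun i _ => hIi i, Finset.sum_congr rfl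
        fun i _ => hvi i]
      simp only [Finset.sum_const, Finset.card_univ, Fintype.card_fin, nsmul_eq_mul,
        integral_const, smul_eq_mul, probReal_univ, one_mul]
      rw [← mul_assoc, inv_mul_cancel₀ hn0.ne', one_mul, hS]
      ring
    simp only [mul_zero, pow_zero, mul_one] at h
    rw [hmean] at h
    refine h.trans ?_
    push_cast
    rw [mul_zero, zero_add, one_mul, ← hs]
    gcongr
  have hstep : ∀ q : ℕ, 1 ≤ q → (2 * q + 1) * s ≤ 1 →
      traceMoment ν n (2 * q + 2) ≤ 10 * (q + 1) * s * traceMoment ν n (2 * q) := by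
    intro q hq hqs
    have h := traceMoment_succ_le hν hn q
    have hle : ∫ x : Fin n → m → ℝ, ((empDev ν x + (2 : ℝ) • S) * empDev ν x ^ (2 * q)).trace
        ∂(Measure.pi fun _ => ν) ≤
        1 / 2 * traceMoment ν n (2 * q + 2) + 5 / 2 * traceMoment ν n (2 * q) := by
      rw [traceMoment, traceMoment, ← integral_const_mul, ← integral_const_mul,
        ← integral_add ((hI _).const_mul _) ((hI _).const_mul _)]
      refine integral_mono (hIS _) (((hI _).const_mul _).add ((hI _).const_mul _)) fun x => ?_
      have hH := isHermitian_empDev (ν := ν) x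
      set X := empDev ν x
      have e1 : (S * X ^ (2 * q)).trace ≤ (X ^ (2 * q)).trace := by
        have := trace_mul_pow_nonneg hH (S := 1 - S) (fun v => by
          rw [sub_mulVec, one_mulVec, dotProduct_sub]; linarith [h1 v]) q
        rw [sub_mul, one_mul, trace_sub] at this
        linarith
      have e2 : 0 ≤ ((X - 1) * (X - 1) * X ^ (2 * q)).trace := by
        refine trace_mul_pow_nonneg hH (fun v => ?_) q
        have : (X - 1)ᵀ = X - 1 := by
          have := hH.eq
          rw [conjTranspose_eq_transpose_of_trivial] at this
          rw [transpose_sub, this, transpose_one]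
        rw [← mulVec_mulVec, dotProduct_mulVec, ← mulVec_transpose, this]
        exact Finset.sum_nonneg fun i _ => mul_self_nonneg _
      have e3 : ((X - 1) * (X - 1) * X ^ (2 * q)).trace =
          (X ^ (2 * q + 2)).trace - 2 * (X * X ^ (2 * q)).trace + (X ^ (2 * q)).trace := by
        have : (X - 1) * (X - 1) * X ^ (2 * q) =
            X ^ (2 * q + 2) - (2 : ℝ) • (X * X ^ (2 * q)) + X ^ (2 * q) := by
          rw [add_comm (2 * q) 2, pow_add X 2, sq, two_smul]
          noncomm_ring
        rw [this, trace_add, trace_sub, trace_smul, smul_eq_mul]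
      have e4 : ((X + (2 : ℝ) • S) * X ^ (2 * q)).trace =
          (X * X ^ (2 * q)).trace + 2 * (S * X ^ (2 * q)).trace := by
        rw [add_mul, trace_add, smul_mul, trace_smul, smul_eq_mul]
      dsimp only
      rw [e4]
      linarith
    have hm0 : 0 ≤ traceMoment ν n (2 * q) :=
      integral_nonneg fun x => trace_pow_two_mul_nonneg (isHermitian_empDev x) q
    have hm2 : 0 ≤ traceMoment ν n (2 * q + 2) :=
      integral_nonneg fun x => trace_pow_two_mul_nonneg (isHermitian_empDev x) (q + 1)
    have hq0 : (0 : ℝ) ≤ q := q.cast_nonneg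
    have h3 : traceMoment ν n (2 * q + 2) ≤ (2 * q + 1) * s *
        (1 / 2 * traceMoment ν n (2 * q + 2) + 5 / 2 * traceMoment ν n (2 * q)) :=
      h.trans (by gcongr)
    have h4 : (2 * q + 1) * s * (1 / 2 * traceMoment ν n (2 * q + 2)) ≤
        1 * (1 / 2 * traceMoment ν n (2 * q + 2)) := by gcongr
    have h5 : 0 ≤ s * traceMoment ν n (2 * q) := by positivity
    nlinarith
  have hall : ∀ j : ℕ, 1 ≤ j → j ≤ p → traceMoment ν n (2 * j) ≤ N * (10 * p * s) ^ j := by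
    intro j hj
    induction j, hj using Nat.le_induction with
    | base =>
      intro h1p
      have : (1 : ℝ) ≤ p := by exact_mod_cast h1p
      rw [pow_one, mul_one]
      refine hfirst.trans ?_
      have : 0 ≤ s * N := by positivity
      nlinarith
    | succ j hj ih =>
      intro hjp
      have hjp' : (j : ℝ) + 1 ≤ p := by exact_mod_cast hjp
      refine (hstep j hj ?_).trans ?_
      · refine le_trans ?_ hpr
        gcongr
        linarith
      · have := ih (by omega)
        calc _ ≤ 10 * (j + 1) * s * (N * (10 * p * s) ^ j) := by gcongr
          _ ≤ 10 * p * s * (N * (10 * p * s) ^ j) := by gcongr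
          _ = _ := by rw [pow_succ]; ring
  exact hall p hp le_rfl

/-- If the quadratic form of a symmetric matrix exceeds `ε` somewhere on the unit sphere, then its
even powers have large trace. -/
theorem pow_le_trace_of_lt {X : Matrix m m ℝ} (hX : X.IsHermitian) {ε : ℝ} (hε : 0 ≤ ε)
    {w : m → ℝ} (hw : ε * (w ⬝ᵥ w) < |w ⬝ᵥ X *ᵥ w|) (p : ℕ) :
    ε ^ (2 * p) ≤ (X ^ (2 * p)).trace := by
  obtain ⟨U, e, h1, h2, he⟩ := exists_orthogonal_diagonalization hX
  have htr : (X ^ (2 * p)).trace = ∑ a, e a ^ (2 * p) := by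
    rw [he, trace_mul_comm, ← Matrix.mul_assoc, h1, one_mul, trace_diagonal]
  have hnn : ∀ a, 0 ≤ e a ^ (2 * p) := fun a => (even_two_mul p).pow_nonneg _
  by_contra hlt
  push Not at hlt
  rw [htr] at hlt
  have hea : ∀ a, |e a| ≤ ε := fun a => by
    by_contra h
    push Not at h
    have h3 : ε ^ (2 * p) ≤ e a ^ (2 * p) := by
      rw [← (even_two_mul p).pow_abs (e a)]
      exact pow_le_pow_left₀ hε h.le _
    exact absurd (h3.trans (Finset.single_le_sum (fun a _ => hnn a) (Finset.mem_univ a)))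
      (not_le.2 hlt)
  have hX1 : w ⬝ᵥ X *ᵥ w = ∑ a, e a * (Uᵀ *ᵥ w) a ^ 2 := by
    have := he 1
    simp only [pow_one] at this
    rw [this, Matrix.mul_assoc, ← mulVec_mulVec, dotProduct_mulVec, ← mulVec_transpose,
      ← mulVec_mulVec, dotProduct]
    refine Finset.sum_congr rfl fun a _ => ?_
    rw [mulVec_diagonal]
    ring
  have hw1 : w ⬝ᵥ w = ∑ a, (Uᵀ *ᵥ w) a ^ 2 := by
    have : w ⬝ᵥ w = w ⬝ᵥ (U * Uᵀ) *ᵥ w := by rw [h2, one_mulVec]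
    rw [this, ← mulVec_mulVec, dotProduct_mulVec, ← mulVec_transpose, dotProduct]
    exact Finset.sum_congr rfl fun a _ => (sq _).symm
  rw [hX1, hw1, Finset.mul_sum] at hw
  refine absurd ((Finset.abs_sum_le_sum_abs _ _).trans (Finset.sum_le_sum fun a _ => ?_))
    (not_le.2 hw)
  rw [abs_mul, abs_of_nonneg (a := _ ^ 2) (sq_nonneg _)]
  exact mul_le_mul_of_nonneg_right (hea a) (sq_nonneg _)

/-- Concentration of the empirical second moment matrix, with a bound `N` for the trace of the
second moment matrix in the role of the dimension. -/
theorem measure_empDev_gt_le (hν : ∀ᵐ x ∂ν, x ∈ ballSet m r) (hr : 0 ≤ r) {n : ℕ} (hn : n ≠ 0)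
    {N : ℝ} (hN : (momentMatrix ν).trace ≤ N) (h1 : ∀ v, v ⬝ᵥ momentMatrix ν *ᵥ v ≤ v ⬝ᵥ v) {p : ℕ}
    (hp : 1 ≤ p) (hpr : (2 * p - 1) * (r / n) ≤ 1) {ε : ℝ} (hε : 0 < ε) :
    (Measure.pi fun _ : Fin n => ν)
        {x | ∃ w, ε * (w ⬝ᵥ w) < |w ⬝ᵥ empDev ν x *ᵥ w|} ≤
      ENNReal.ofReal (N * (10 * p * (r / n) / ε ^ 2) ^ p) := by
  have hm := traceMoment_le hν hr hn hN h1 hp hpr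
  have hX := continuous_empDev (ν := ν) (n := n)
  have hI : Integrable (fun x : Fin n → m → ℝ => (empDev ν x ^ (2 * p)).trace)
      (Measure.pi fun _ => ν) := by
    have hc : Continuous fun x : Fin n → m → ℝ => (empDev ν x ^ (2 * p)).trace :=
      (hX.pow _).matrix_trace
    exact integrable_pi_of_continuous hν hc
  have hmk := mul_meas_ge_le_integral_of_nonneg
    (Eventually.of_forall fun x => trace_pow_two_mul_nonneg (isHermitian_empDev (ν := ν) x) p) hI
    (ε ^ (2 * p))
  have hεp : 0 < ε ^ (2 * p) := by positivity
  have hle := hmk.trans hm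
  refine (measure_mono (t := {x | ε ^ (2 * p) ≤ (empDev ν x ^ (2 * p)).trace}) ?_).trans ?_
  · rintro x ⟨w, hw⟩
    exact pow_le_trace_of_lt (isHermitian_empDev x) hε.le hw p
  · rw [← ENNReal.ofReal_toReal (measure_ne_top (Measure.pi fun _ : Fin n => ν) _)]
    refine ENNReal.ofReal_le_ofReal ?_
    rw [div_pow, ← pow_mul, ← mul_div_assoc, le_div_iff₀ hεp, mul_comm]
    exact hle

end RandomMatrixTail

/-! ### The operators S†S and SS† -/

section Adjoint

variable {H V : Type*} [NormedAddCommGroup H] [InnerProductSpace ℝ H] [CompleteSpace H]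
  [NormedAddCommGroup V] [InnerProductSpace ℝ V] [CompleteSpace V] {S : H →L[ℝ] V}

open ContinuousLinearMap (adjoint)

theorem inner_adjoint_comp_self (S : H →L[ℝ] V) (v w : H) :
    ⟪((adjoint S).comp S) v, w⟫ = ⟪S v, S w⟫ := by
  rw [ContinuousLinearMap.comp_apply, ContinuousLinearMap.adjoint_inner_left]

theorem inner_self_comp_adjoint (S : H →L[ℝ] V) (v w : V) :
    ⟪(S.comp (adjoint S)) v, w⟫ = ⟪adjoint S v, adjoint S w⟫ := by
  rw [ContinuousLinearMap.comp_apply, ContinuousLinearMap.adjoint_inner_right]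

theorem norm_apply_eigenProj (S : H →L[ℝ] V) (σ : ℝ) (v : H) :
    ‖S (eigenProj ((adjoint S).comp S) σ v)‖ ^ 2 =
      σ * ‖eigenProj ((adjoint S).comp S) σ v‖ ^ 2 := by
  rw [← real_inner_self_eq_norm_sq, ← inner_adjoint_comp_self, apply_eigenProj, inner_smul_left,
    real_inner_self_eq_norm_sq]
  rfl

theorem norm_adjoint_eigenProj (S : H →L[ℝ] V) (σ : ℝ) (v : V) :
    ‖adjoint S (eigenProj (S.comp (adjoint S)) σ v)‖ ^ 2 =
      σ * ‖eigenProj (S.comp (adjoint S)) σ v‖ ^ 2 := by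
  rw [← real_inner_self_eq_norm_sq, ← inner_self_comp_adjoint, apply_eigenProj, inner_smul_left,
    real_inner_self_eq_norm_sq]
  rfl

/-- If `S† S` is diagonalizable, then so is `S S†`: its eigenvectors are the images under `S` of
the eigenvectors of `S† S`, together with `ker S†`. -/
theorem PosDiagonal.comp_adjoint (hA : PosDiagonal ((adjoint S).comp S)) :
    PosDiagonal (S.comp (adjoint S)) := by
  refine .of_forall_orthogonal (fun v w => ?_) (fun v => ?_) (fun w hw => ?_)
  · rw [inner_self_comp_adjoint, real_inner_comm, ← inner_self_comp_adjoint, real_inner_comm]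
  · rw [inner_self_comp_adjoint]
    exact real_inner_self_nonneg
  · have h0 : adjoint S w = 0 := by
      refine hA.ext fun σ => ?_
      rw [map_zero]
      set p := eigenProj ((adjoint S).comp S) σ (adjoint S w) with hp
      have h1 := hw σ (S p) (by
        have := apply_eigenProj ((adjoint S).comp S) σ (adjoint S w)
        rw [ContinuousLinearMap.comp_apply] at this ⊢
        rw [hp, this, map_smul])
      rw [← ContinuousLinearMap.adjoint_inner_right, hp, ← eigenProj_idem, inner_eigenProj_left,
        real_inner_self_eq_norm_sq] at h1
      exact norm_eq_zero.1 (pow_eq_zero_iff two_ne_zero |>.1 h1)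
    have h1 := hw 0 w (by rw [ContinuousLinearMap.comp_apply, h0, map_zero, zero_smul])
    exact inner_self_eq_zero.1 h1

/-- `S` intertwines the spectral projections of `S† S` and `S S†`. -/
theorem eigenProj_comp_adjoint_apply (hA : PosDiagonal ((adjoint S).comp S)) (σ : ℝ) (v : H) :
    eigenProj (S.comp (adjoint S)) σ (S v) = S (eigenProj ((adjoint S).comp S) σ v) := by
  have hL := hA.comp_adjoint
  have hS : ∀ τ, (S.comp (adjoint S)) (S (eigenProj ((adjoint S).comp S) τ v)) =
      τ • S (eigenProj ((adjoint S).comp S) τ v) := fun τ => by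
    have := apply_eigenProj ((adjoint S).comp S) τ v
    rw [ContinuousLinearMap.comp_apply] at this ⊢
    rw [this, map_smul]
  have h1 := ((hA.hasSum v).mapL S).mapL (eigenProj (S.comp (adjoint S)) σ)
  refine h1.unique ?_
  have h2 : eigenProj (S.comp (adjoint S)) σ (S (eigenProj ((adjoint S).comp S) σ v)) =
      S (eigenProj ((adjoint S).comp S) σ v) := eigenProj_of_apply_eq (hS σ)
  have h3 := hasSum_single (f := fun τ => eigenProj (S.comp (adjoint S)) σ
    (S (eigenProj ((adjoint S).comp S) τ v))) σ fun τ hτ => by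
      rw [← eigenProj_of_apply_eq (hS τ), hL.eigenProj_eigenProj_of_ne hτ.symm]
  rwa [h2] at h3

/-- The polar decomposition of `S` transports an element of the target to the source: the spectral
components of `h` and `g` correspond to each other under `S = U (S† S) ^ (1 / 2)`. -/
theorem exists_polar (hA : PosDiagonal ((adjoint S).comp S)) (g : V) :
    ∃ h : H, ‖h‖ ≤ ‖g‖ ∧ eigenProj ((adjoint S).comp S) 0 h = 0 ∧
      ∀ σ, S (eigenProj ((adjoint S).comp S) σ h) =
        σ ^ (1 / 2 : ℝ) • eigenProj (S.comp (adjoint S)) σ g := by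
  have hL := hA.comp_adjoint
  set f : ℝ → H := fun σ =>
    σ ^ (-(1 / 2) : ℝ) • adjoint S (eigenProj (S.comp (adjoint S)) σ g) with hf
  have hf1 : ∀ σ, eigenProj ((adjoint S).comp S) σ (f σ) = f σ := fun σ => by
    refine eigenProj_of_apply_eq ?_
    have := apply_eigenProj (S.comp (adjoint S)) σ g
    rw [ContinuousLinearMap.comp_apply] at this ⊢
    rw [hf]
    dsimp only
    rw [map_smul, map_smul, this, map_smul, smul_comm]
  have hσ : ∀ σ, eigenProj (S.comp (adjoint S)) σ g = 0 ∨ 0 ≤ σ := fun σ => by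
    by_cases h : eigenProj (S.comp (adjoint S)) σ = 0
    · exact Or.inl (by rw [h, zero_apply])
    · exact Or.inr (hL.eigenvalue_nonneg h)
  have hnorm : ∀ σ, ‖f σ‖ ≤ ‖eigenProj (S.comp (adjoint S)) σ g‖ := fun σ => by
    rcases hσ σ with h | h
    · simp [hf, h]
    rcases h.eq_or_lt with rfl | h
    · simp [hf, Real.zero_rpow]
    refine (sq_le_sq₀ (norm_nonneg _) (norm_nonneg _)).1 ?_
    rw [hf]
    dsimp only
    rw [norm_smul, mul_pow, norm_adjoint_eigenProj, Real.norm_eq_abs, sq_abs, ← Real.rpow_natCast,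
      ← Real.rpow_mul h.le, ← mul_assoc]
    norm_num
    rw [Real.rpow_neg_one, inv_mul_cancel₀ h.ne', one_mul]
  have hs : Summable f := (hA.summable_iff hf1).2 <| by
    refine .of_nonneg_of_le (fun σ => sq_nonneg _) (fun σ => ?_) (hL.hasSum_norm_sq g).summable
    exact pow_le_pow_left₀ (norm_nonneg _) (hnorm σ) 2
  have hproj := hA.eigenProj_tsum hf1 hs
  refine ⟨∑' σ, f σ, ?_, ?_, fun σ => ?_⟩
  · refine (sq_le_sq₀ (norm_nonneg _) (norm_nonneg _)).1 ?_
    have h1 := hA.hasSum_norm_sq (∑' σ, f σ)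
    refine hasSum_le (fun σ => ?_) h1 (hL.hasSum_norm_sq g)
    rw [hproj]
    exact pow_le_pow_left₀ (norm_nonneg _) (hnorm σ) 2
  · rw [hproj]
    simp [hf, Real.zero_rpow]
  · rw [hproj]
    have h2 := apply_eigenProj (S.comp (adjoint S)) σ g
    rw [ContinuousLinearMap.comp_apply] at h2
    simp only [hf, map_smul]
    rw [h2, smul_smul]
    rcases hσ σ with h | h
    · simp [h]
    rcases h.eq_or_lt with rfl | h
    · simp [Real.zero_rpow]
    · congr 1
      nth_rw 2 [← Real.rpow_one σ]
      rw [← Real.rpow_add h]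
      norm_num

end Adjoint

/-! ### The effective dimension -/

section EffectiveDimension

variable {V : Type*} [NormedAddCommGroup V] [InnerProductSpace ℝ V] [CompleteSpace V]
  {A : V →L[ℝ] V} {b l : ℝ}

namespace PosDiagonal

theorem specBound_add_rpow_neg (hA : PosDiagonal A) (hl : 0 < l) {p : ℝ} (hp : 0 ≤ p) :
    SpecBound A (fun u => (u + l) ^ (-p)) (l ^ (-p)) := fun σ hσ => by
  have h0 := hA.eigenvalue_nonneg hσ
  rw [abs_of_nonneg (by positivity)]
  exact Real.rpow_le_rpow_of_nonpos hl (by linarith) (by linarith)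

theorem specBound_div_add (hA : PosDiagonal A) (hl : 0 < l) :
    SpecBound A (fun u => u / (u + l)) 1 := fun σ hσ => by
  have h0 := hA.eigenvalue_nonneg hσ
  rw [abs_of_nonneg (by positivity), div_le_one (by positivity)]
  linarith

theorem specBound_inv_add (hA : PosDiagonal A) (hl : 0 < l) :
    SpecBound A (fun u => (u + l)⁻¹) l⁻¹ := fun σ hσ => by
  have h0 := hA.eigenvalue_nonneg hσ
  rw [abs_of_nonneg (by positivity)]
  exact inv_anti₀ hl (by linarith)

theorem mul_inverse_eq (hA : PosDiagonal A) (hl : 0 < l) :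
    A * Ring.inverse (A + l • 1) = calcL A fun u => u / (u + l) := by
  have hi := hA.specBound_inv_add hl
  have hd := hA.specBound_div_add hl
  have hmul : ∀ σ v, ((σ + l) * (σ + l)⁻¹) • eigenProj A σ v = eigenProj A σ v := fun σ v => by
    by_cases h0 : eigenProj A σ = 0
    · rw [h0, zero_apply, smul_zero]
    · have := hA.eigenvalue_nonneg h0
      rw [mul_inv_cancel₀ (by positivity), one_smul]
  have h1 : (A + l • 1) * calcL A (fun u => (u + l)⁻¹) = 1 := by
    ext v
    refine hA.ext fun σ => ?_
    rw [mul_apply_eq_comp]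
    simp only [add_apply, smul_apply,
      one_apply_eq_self, map_add, map_smul]
    rw [hA.eigenProj_apply, hA.eigenProj_calcL hi, ← add_smul, smul_smul, hmul]
  have h2 : calcL A (fun u => (u + l)⁻¹) * (A + l • 1) = 1 := by
    ext v
    refine hA.ext fun σ => ?_
    rw [mul_apply_eq_comp, hA.eigenProj_calcL hi]
    simp only [add_apply, smul_apply,
      one_apply_eq_self, map_add, map_smul]
    rw [hA.eigenProj_apply, ← add_smul, smul_smul, mul_comm, hmul]
  have h3 : Ring.inverse (A + l • 1) = calcL A (fun u => (u + l)⁻¹) :=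
    Ring.inverse_unit (⟨A + l • 1, calcL A (fun u => (u + l)⁻¹), h1, h2⟩ : (V →L[ℝ] V)ˣ)
  rw [h3]
  ext v
  refine hA.ext fun σ => ?_
  rw [mul_apply_eq_comp, hA.eigenProj_apply, hA.eigenProj_calcL hi,
    hA.eigenProj_calcL hd, smul_smul, div_eq_mul_inv]

theorem inner_calcL_div_nonneg (hA : PosDiagonal A) (hl : 0 < l) (v : V) :
    0 ≤ ⟪v, calcL A (fun u => u / (u + l)) v⟫ := by
  refine (hA.hasSum_inner v _).nonneg fun σ => ?_
  rw [hA.eigenProj_calcL (hA.specBound_div_add hl), inner_smul_right]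
  by_cases h0 : eigenProj A σ = 0
  · simp [h0]
  · have := hA.eigenvalue_nonneg h0
    have h1 : 0 ≤ ⟪eigenProj A σ v, eigenProj A σ v⟫ := real_inner_self_nonneg
    positivity

theorem inner_calcL_div_le (hA : PosDiagonal A) (hl : 0 < l) (v : V) :
    ⟪v, calcL A (fun u => u / (u + l)) v⟫ ≤ ‖v‖ ^ 2 := by
  have h := hA.norm_calcL_le (hA.specBound_div_add hl) zero_le_one v
  calc _ ≤ ‖v‖ * ‖calcL A (fun u => u / (u + l)) v‖ := real_inner_le_norm _ _
    _ ≤ ‖v‖ * (1 * ‖v‖) := by gcongr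
    _ = _ := by ring

/-- The quadratic form of `A (A + l)⁻¹` is that of `A` composed with `(A + l) ^ (-1/2)`. -/
theorem inner_apply_calcL_rpow_neg_half (hA : PosDiagonal A) (hl : 0 < l) (v w : V) :
    ⟪A (calcL A (fun u => (u + l) ^ (-(1 / 2) : ℝ)) v),
      calcL A (fun u => (u + l) ^ (-(1 / 2) : ℝ)) w⟫ = ⟪v, calcL A (fun u => u / (u + l)) w⟫ := by
  have hp := hA.specBound_add_rpow_neg hl (p := 1 / 2) (by norm_num)
  refine (hA.hasSum_inner _ _).unique ?_
  refine (hA.hasSum_inner _ _).congr_fun fun σ => ?_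
  rw [hA.eigenProj_apply, hA.eigenProj_calcL hp, hA.eigenProj_calcL hp,
    hA.eigenProj_calcL (hA.specBound_div_add hl)]
  simp only [inner_smul_left, inner_smul_right, conj_trivial]
  by_cases h0 : eigenProj A σ = 0
  · simp [h0]
  · have h1 := hA.eigenvalue_nonneg h0
    have h2 : (σ + l) ^ (-(1 / 2) : ℝ) * (σ + l) ^ (-(1 / 2) : ℝ) = (σ + l)⁻¹ := by
      rw [← Real.rpow_add (by positivity), ← Real.rpow_neg_one]
      norm_num
    rw [show σ / (σ + l) = σ * ((σ + l) ^ (-(1 / 2) : ℝ) * (σ + l) ^ (-(1 / 2) : ℝ)) by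
      rw [h2, div_eq_mul_inv]]
    ring

/-- Partial traces of `A (A + l)⁻¹` are bounded by the effective dimension. -/
theorem sum_inner_calcL_div_le (hA : PosDiagonal A) (hl : 0 < l) {N : ℝ} (hN : 0 ≤ N)
    (h : effDim A l ≤ ENNReal.ofReal N) {ι : Type*} [Fintype ι] {e : ι → V}
    (he : Orthonormal ℝ e) :
    ∑ i, ⟪e i, calcL A (fun u => u / (u + l)) (e i)⟫ ≤ N := by
  classical
  have hinj : Function.Injective e := he.linearIndependent.injective
  set s : Finset V := Finset.univ.image e with hs
  have hos : Orthonormal ℝ (fun x : s => (x : V)) := by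
    have : (s : Set V) = Set.range e := by simp [hs]
    have h2 := he.toSubtypeRange
    rw [← this] at h2
    exact h2
  have h1 : ∑ x ∈ s, ENNReal.ofReal ⟪x, (A * Ring.inverse (A + l • 1)) x⟫ ≤ effDim A l :=
    le_iSup₂_of_le (f := fun (s : Finset V) (_ : Orthonormal ℝ (fun e : s => (e : V))) =>
      ∑ e ∈ s, ENNReal.ofReal ⟪e, (A * Ring.inverse (A + l • 1)) e⟫) s hos le_rfl
  rw [hs, Finset.sum_image fun x _ y _ hxy => hinj hxy, hA.mul_inverse_eq hl,
    ← ENNReal.ofReal_sum_of_nonneg fun i _ => hA.inner_calcL_div_nonneg hl _] at h1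
  exact (ENNReal.ofReal_le_ofReal_iff hN).1 (h1.trans h)

end PosDiagonal

end EffectiveDimension

/-! ### The covariance operator -/

section Covariance

variable {H : Type*} [NormedAddCommGroup H] [InnerProductSpace ℝ H] [CompleteSpace H]
  [TopologicalSpace.SeparableSpace H] [MeasurableSpace H] [BorelSpace H]
  {μ : Measure H} {κ : ℝ}

theorem secondCountableTopology_of_separable : SecondCountableTopology H :=
  UniformSpace.secondCountable_of_separable H

theorem inner_inclusion (h : MemLp (fun x : H => x) 2 μ) (w : H) (f : Lp ℝ 2 μ) :
    ⟪inclusion μ w, f⟫ = ∫ x, ⟪w, x⟫ * f x ∂μ := by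
  rw [L2.inner_def]
  refine integral_congr_ae ?_
  filter_upwards [inclusion_apply h w] with x hx
  rw [hx, real_inner_eq_re_inner]
  simp [mul_comm]

theorem inner_covOp (h : MemLp (fun x : H => x) 2 μ) (v w : H) :
    ⟪covOp μ v, w⟫ = ∫ x, ⟪v, x⟫ * ⟪w, x⟫ ∂μ := by
  rw [covOp, inner_adjoint_comp_self, inner_inclusion h]
  refine integral_congr_ae ?_
  filter_upwards [inclusion_apply h w] with x hx
  rw [hx]

theorem integrable_inner_mul_inner (h : MemLp (fun x : H => x) 2 μ) (v w : H) :
    Integrable (fun x => ⟪v, x⟫ * ⟪w, x⟫) μ :=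
  (h.const_inner v).integrable_mul (h.const_inner w)

theorem continuous_rankOne_self :
    Continuous fun x : H => (InnerProductSpace.rankOne ℝ x x : H →L[ℝ] H) :=
  (InnerProductSpace.rankOne ℝ (E := H) (F := H)).continuous.clm_apply continuous_id

theorem isCompactOperator_rankOne (x : H) :
    IsCompactOperator (InnerProductSpace.rankOne ℝ x x : H →L[ℝ] H) :=
  ((isCompactOperator_id (E := ℝ)).clm_comp
    (ContinuousLinearMap.toSpanSingleton ℝ x)).comp_clm (innerSL ℝ x)

theorem norm_rankOne_self (x : H) : ‖(InnerProductSpace.rankOne ℝ x x : H →L[ℝ] H)‖ = ‖x‖ ^ 2 := by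
  rw [InnerProductSpace.norm_rankOne, sq]

theorem integrable_smul_rankOne [IsFiniteMeasure μ] (hb : ∀ᵐ x ∂μ, ‖x‖ ≤ κ) {w : H → ℝ}
    (hw : Integrable w μ) :
    Integrable (fun x => w x • (InnerProductSpace.rankOne ℝ x x : H →L[ℝ] H)) μ := by
  have := secondCountableTopology_of_separable (H := H)
  have : SecondCountableTopologyEither H (H →L[ℝ] H) := secondCountableTopologyEither_of_left _ _
  refine (hw.norm.mul_const (κ ^ 2)).mono'
    (hw.aestronglyMeasurable.smul continuous_rankOne_self.aestronglyMeasurable) ?_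
  filter_upwards [hb] with x hx
  rw [norm_smul, norm_rankOne_self]
  gcongr

/-- The quadratic form of a weighted covariance operator. -/
theorem inner_integral_smul_rankOne [IsFiniteMeasure μ] (hb : ∀ᵐ x ∂μ, ‖x‖ ≤ κ) {w : H → ℝ}
    (hw : Integrable w μ) (u v : H) :
    ⟪(∫ x, w x • (InnerProductSpace.rankOne ℝ x x : H →L[ℝ] H) ∂μ) u, v⟫ =
      ∫ x, w x * (⟪u, x⟫ * ⟪v, x⟫) ∂μ := by
  have hi := integrable_smul_rankOne hb hw
  rw [ContinuousLinearMap.integral_apply hi, real_inner_comm,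
    ← integral_inner (hi.apply_continuousLinearMap u)]
  refine integral_congr_ae (Eventually.of_forall fun x => ?_)
  simp only [smul_apply, InnerProductSpace.rankOne_apply, inner_smul_right, real_inner_comm x u]

theorem covOp_eq_integral [IsFiniteMeasure μ] (hκ : 0 ≤ κ) (hK : BoundedKernel μ κ) :
    covOp μ = ∫ x, (InnerProductSpace.rankOne ℝ x x : H →L[ℝ] H) ∂μ := by
  refine ContinuousLinearMap.ext fun u => ext_inner_right ℝ fun v => ?_
  have := inner_integral_smul_rankOne (hK.norm_le hκ) (integrable_const (1 : ℝ)) u v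
  simp only [one_smul, one_mul] at this
  rw [this, inner_covOp (hK.memLp hκ)]

/-- The covariance operator is an integral of rank-one operators, hence compact. -/
theorem isCompactOperator_covOp [IsProbabilityMeasure μ] (hκ : 0 ≤ κ) (hK : BoundedKernel μ κ) :
    IsCompactOperator (covOp μ) := by
  rw [covOp_eq_integral hκ hK]
  have hi := integrable_smul_rankOne (hK.norm_le hκ) (integrable_const (1 : ℝ))
  simp only [one_smul] at hi
  exact (compactOperator (RingHom.id ℝ) H H).convex.integral_mem
    isClosed_setOfPred_isCompactOperator
    (Eventually.of_forall isCompactOperator_rankOne) hi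

theorem posDiagonal_covOp [IsProbabilityMeasure μ] (hκ : 0 ≤ κ) (hK : BoundedKernel μ κ) :
    PosDiagonal (covOp μ) :=
  .of_isCompactOperator (isCompactOperator_covOp hκ hK)
    (fun v w => by
      rw [covOp, inner_adjoint_comp_self, real_inner_comm, ← inner_adjoint_comp_self,
        real_inner_comm])
    (fun v => by rw [covOp, inner_adjoint_comp_self]; exact real_inner_self_nonneg)

theorem posDiagonal_intOp [IsProbabilityMeasure μ] (hκ : 0 ≤ κ) (hK : BoundedKernel μ κ) :
    PosDiagonal (intOp μ) :=
  PosDiagonal.comp_adjoint (posDiagonal_covOp hκ hK)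

theorem norm_sq_inclusion_le [IsProbabilityMeasure μ] (hκ : 0 ≤ κ) (hK : BoundedKernel μ κ)
    (w : H) : ‖inclusion μ w‖ ^ 2 ≤ κ ^ 2 * ‖w‖ ^ 2 := by
  rw [← real_inner_self_eq_norm_sq, ← inner_adjoint_comp_self, ← covOp, inner_covOp (hK.memLp hκ)]
  calc ∫ x, ⟪w, x⟫ * ⟪w, x⟫ ∂μ ≤ ∫ _, κ ^ 2 * ‖w‖ ^ 2 ∂μ := by
        refine integral_mono_ae (integrable_inner_mul_inner (hK.memLp hκ) w w)
          (integrable_const _) ?_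
        filter_upwards [hK.norm_le hκ] with x hx
        calc ⟪w, x⟫ * ⟪w, x⟫ = |⟪w, x⟫| ^ 2 := by rw [sq_abs, sq]
          _ ≤ (‖w‖ * κ) ^ 2 := by
            refine pow_le_pow_left₀ (abs_nonneg _) ((abs_real_inner_le_norm _ _).trans ?_) 2
            gcongr
          _ = _ := by ring
    _ = _ := by simp

theorem norm_inclusion_le [IsProbabilityMeasure μ] (hκ : 0 ≤ κ) (hK : BoundedKernel μ κ)
    (w : H) : ‖inclusion μ w‖ ≤ κ * ‖w‖ := by
  refine (sq_le_sq₀ (norm_nonneg _) (by positivity)).1 ?_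
  rw [mul_pow]
  exact norm_sq_inclusion_le hκ hK w

theorem norm_adjoint_inclusion_le [IsProbabilityMeasure μ] (hκ : 0 ≤ κ) (hK : BoundedKernel μ κ)
    (f : Lp ℝ 2 μ) : ‖ContinuousLinearMap.adjoint (inclusion μ) f‖ ≤ κ * ‖f‖ := by
  have h1 : ‖inclusion μ‖ ≤ κ :=
    ContinuousLinearMap.opNorm_le_bound _ hκ (norm_inclusion_le hκ hK)
  refine (ContinuousLinearMap.le_opNorm _ _).trans ?_
  rw [LinearIsometryEquiv.norm_map]
  gcongr

theorem norm_covOp_apply_le [IsProbabilityMeasure μ] (hκ : 0 ≤ κ) (hK : BoundedKernel μ κ)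
    (w : H) : ‖covOp μ w‖ ≤ κ ^ 2 * ‖w‖ := by
  rw [covOp, ContinuousLinearMap.comp_apply]
  calc _ ≤ κ * ‖inclusion μ w‖ := norm_adjoint_inclusion_le hκ hK _
    _ ≤ κ * (κ * ‖w‖) := by gcongr; exact norm_inclusion_le hκ hK w
    _ = _ := by ring

theorem norm_intOp_apply_le [IsProbabilityMeasure μ] (hκ : 0 ≤ κ) (hK : BoundedKernel μ κ)
    (f : Lp ℝ 2 μ) : ‖intOp μ f‖ ≤ κ ^ 2 * ‖f‖ := by
  rw [intOp, ContinuousLinearMap.comp_apply]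
  calc _ ≤ κ * ‖ContinuousLinearMap.adjoint (inclusion μ) f‖ := norm_inclusion_le hκ hK _
    _ ≤ κ * (κ * ‖f‖) := by gcongr; exact norm_adjoint_inclusion_le hκ hK f
    _ = _ := by ring

end Covariance

/-! ### The empirical covariance operator and the estimator -/

section EmpiricalCovariance

variable {H : Type*} [NormedAddCommGroup H] [InnerProductSpace ℝ H] [CompleteSpace H]
  [TopologicalSpace.SeparableSpace H] [MeasurableSpace H] [BorelSpace H]
  {n : ℕ} {z : Fin n → H × ℝ} {κ : ℝ}

theorem empCov_apply (z : Fin n → H × ℝ) (v : H) :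
    empCov z v = (n : ℝ)⁻¹ • ∑ i, ⟪(z i).1, v⟫ • (z i).1 := by
  simp only [empCov, smul_apply, _root_.sum_apply, InnerProductSpace.rankOne_apply]

theorem inner_empCov (z : Fin n → H × ℝ) (v w : H) :
    ⟪empCov z v, w⟫ = (n : ℝ)⁻¹ * ∑ i, ⟪v, (z i).1⟫ * ⟪w, (z i).1⟫ := by
  rw [empCov_apply, real_inner_comm, inner_smul_right, inner_sum]
  simp only [inner_smul_right, real_inner_comm v]

theorem inner_empAdj (z : Fin n → H × ℝ) (w : H) :
    ⟪empAdj z, w⟫ = (n : ℝ)⁻¹ * ∑ i, (z i).2 * ⟪w, (z i).1⟫ := by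
  rw [empAdj, real_inner_comm, inner_smul_right, inner_sum]
  simp only [inner_smul_right]

theorem posDiagonal_empCov (z : Fin n → H × ℝ) : PosDiagonal (empCov z) := by
  refine .of_isCompactOperator ?_ (fun v w => ?_) (fun v => ?_)
  · have : empCov z ∈ compactOperator (RingHom.id ℝ) H H :=
      Submodule.smul_mem _ _ (Submodule.sum_mem _ fun i _ => isCompactOperator_rankOne _)
    exact this
  · rw [inner_empCov, real_inner_comm, inner_empCov]
    simp only [mul_comm]
  · rw [inner_empCov]
    exact mul_nonneg (by positivity) (Finset.sum_nonneg fun i _ => mul_self_nonneg _)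

theorem norm_empCov_apply_le (hκ : 0 ≤ κ) (hz : ∀ i, ‖(z i).1‖ ≤ κ) (v : H) :
    ‖empCov z v‖ ≤ κ ^ 2 * ‖v‖ := by
  rw [empCov_apply, norm_smul, norm_inv, Real.norm_natCast]
  rcases n.eq_zero_or_pos with rfl | hn
  · simp
    positivity
  have hn0 : (0 : ℝ) < n := Nat.cast_pos.2 hn
  rw [inv_mul_le_iff₀ hn0]
  calc _ ≤ ∑ _i : Fin n, κ ^ 2 * ‖v‖ := norm_sum_le_of_le _ fun i _ => by
        rw [norm_smul]
        calc _ ≤ ‖(z i).1‖ * ‖v‖ * ‖(z i).1‖ := by gcongr; exact norm_inner_le_norm _ _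
          _ ≤ κ * ‖v‖ * κ := by gcongr <;> exact hz i
          _ = _ := by ring
    _ = _ := by simp

/-- The vector `S_x* y` is orthogonal to the kernel of the empirical covariance operator. -/
theorem eigenProj_zero_empAdj (z : Fin n → H × ℝ) : eigenProj (empCov z) 0 (empAdj z) = 0 := by
  set p := eigenProj (empCov z) 0 (empAdj z) with hp
  have h1 : empCov z p = 0 := by rw [hp, apply_eigenProj, zero_smul]
  have h2 : ⟪empCov z p, p⟫ = 0 := by rw [h1, inner_zero_left]
  rw [inner_empCov] at h2
  have h3 : ⟪empAdj z, p⟫ = 0 := by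
    rw [inner_empAdj]
    rcases n.eq_zero_or_pos with rfl | hn
    · simp
    have hn0 : (n : ℝ)⁻¹ ≠ 0 := by positivity
    have h4 := (mul_eq_zero.1 h2).resolve_left hn0
    rw [Finset.sum_eq_zero_iff_of_nonneg fun i _ => mul_self_nonneg _] at h4
    rw [Finset.sum_eq_zero fun i hi => by rw [mul_self_eq_zero.1 (h4 i hi), mul_zero], mul_zero]
  rw [← inner_self_eq_zero (𝕜 := ℝ)]
  nth_rw 1 [hp]
  rw [inner_eigenProj_left, hp, eigenProj_idem, ← hp, h3]

/-- The estimator as a bounded function of the empirical covariance operator. The value of the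
filter at `0` is irrelevant because `S_x* y` is orthogonal to the kernel. -/
theorem estimator_eq_calcL (hκ : 0 ≤ κ) (hz : ∀ i, ‖(z i).1‖ ≤ κ) {τ E F l : ℝ} {g : ℝ → ℝ}
    (hl : 0 < l) (hE : 0 ≤ E) (hg : FilterBound (κ ^ 2) τ E F l g) :
    estimator g z = calcL (empCov z) (zeroAtZero g) (empAdj z) := by
  have hB := posDiagonal_empCov z
  have hb : SpecBound (empCov z) (zeroAtZero g) (2 * E * l ^ ((0 : ℝ) - 1)) :=
    hB.specBound (norm_empCov_apply_le hκ hz) fun u hu => by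
      have := hg.rpow_mul_le hl hE le_rfl zero_le_one hu
      rwa [Real.rpow_zero, one_mul] at this
  rw [hB.calcL_apply hb, estimator, specCalc, specCalc]
  congr 1
  ext σ
  by_cases h : σ = 0
  · rw [h, eigenProj_zero_empAdj, smul_zero, smul_zero]
  · rw [zeroAtZero, if_neg h]

end EmpiricalCovariance

/-! ### Concentration of the covariance form -/

section FormDeviation

open Matrix

variable {H : Type*} [NormedAddCommGroup H] [InnerProductSpace ℝ H] [CompleteSpace H]
  [TopologicalSpace.SeparableSpace H] [MeasurableSpace H] [BorelSpace H]
  {μ : Measure H} [IsProbabilityMeasure μ] {κ l N : ℝ} {n : ℕ}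

/-- The deviation of the quadratic form of the empirical covariance operator from its mean. -/
def formDev (μ : Measure H) (x : Fin n → H) (v : H) : ℝ :=
  (n : ℝ)⁻¹ * ∑ i, ⟪v, x i⟫ ^ 2 - ⟪covOp μ v, v⟫

theorem continuous_formDev (μ : Measure H) (x : Fin n → H) : Continuous (formDev μ x) := by
  unfold formDev
  fun_prop

theorem norm_calcL_rpow_neg_half_sq_le (hA : PosDiagonal (covOp μ)) (hl : 0 < l) (x : H) :
    ‖calcL (covOp μ) (fun u => (u + l) ^ (-(1 / 2) : ℝ)) x‖ ^ 2 ≤ ‖x‖ ^ 2 / l := by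
  have h := hA.norm_calcL_le (hA.specBound_add_rpow_neg hl (p := 1 / 2) (by norm_num))
    (by positivity) x
  calc _ ≤ (l ^ (-(1 / 2) : ℝ) * ‖x‖) ^ 2 := pow_le_pow_left₀ (norm_nonneg _) h 2
    _ = _ := by
      rw [mul_pow, ← Real.rpow_natCast (l ^ _), ← Real.rpow_mul hl.le]
      norm_num
      rw [Real.rpow_neg_one]
      field_simp

/-- Concentration of the covariance form along a finite-dimensional subspace: in the coordinates of
`(A + l) ^ (-1/2) x` with respect to an orthonormal system, it is the concentration of a random
matrix whose second moment matrix is at most `1` and has trace at most the effective dimension. -/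
theorem measure_formDev_span_le (hκ : 0 ≤ κ) (hK : BoundedKernel μ κ) (hl : 0 < l) (hN0 : 0 ≤ N)
    (hN : effDim (covOp μ) l ≤ ENNReal.ofReal N) (hn : n ≠ 0) {p : ℕ} (hp : 1 ≤ p)
    (hpr : (2 * p - 1) * (κ ^ 2 / l / n) ≤ 1) {ε : ℝ} (hε : 0 < ε) {ι : Type*} [Fintype ι]
    {e : ι → H} (he : Orthonormal ℝ e) :
    (Measure.pi fun _ : Fin n => μ) {x | ∃ w : ι → ℝ, ε * ‖∑ j, w j • e j‖ ^ 2 <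
      |formDev μ x (calcL (covOp μ) (fun u => (u + l) ^ (-(1 / 2) : ℝ)) (∑ j, w j • e j))|} ≤
      ENNReal.ofReal (N * (10 * p * (κ ^ 2 / l / n) / ε ^ 2) ^ p) := by
  classical
  have hA := posDiagonal_covOp hκ hK
  have hL2 := hK.memLp hκ
  set W := calcL (covOp μ) (fun u => (u + l) ^ (-(1 / 2) : ℝ)) with hW
  have hWs : ∀ v w, ⟪W v, w⟫ = ⟪v, W w⟫ :=
    hA.inner_calcL (hA.specBound_add_rpow_neg hl (p := 1 / 2) (by norm_num))
  set ψ : H → ι → ℝ := fun x j => ⟪W (e j), x⟫ with hψ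
  have hψc : Continuous ψ := by fun_prop
  have hψm : Measurable ψ := hψc.measurable
  set ν := μ.map ψ with hν
  have : IsProbabilityMeasure ν := Measure.isProbabilityMeasure_map hψm.aemeasurable
  have hdot : ∀ (w : ι → ℝ) (x : H), w ⬝ᵥ ψ x = ⟪W (∑ j, w j • e j), x⟫ := fun w x => by
    simp only [hψ, dotProduct, map_sum, map_smul, sum_inner, inner_smul_left, conj_trivial]
  have hwself : ∀ w : ι → ℝ, w ⬝ᵥ w = ‖∑ j, w j • e j‖ ^ 2 := fun w => by
    rw [← real_inner_self_eq_norm_sq, he.inner_sum]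
    simp [dotProduct]
  have hSij : ∀ i j, momentMatrix ν i j = ⟪covOp μ (W (e i)), W (e j)⟫ := fun i j => by
    rw [momentMatrix, hν, integral_map hψm.aemeasurable
      (by fun_prop : Continuous fun x : ι → ℝ => x i * x j).aestronglyMeasurable,
      inner_covOp hL2]
  have hform : ∀ w : ι → ℝ, w ⬝ᵥ momentMatrix ν *ᵥ w =
      ⟪covOp μ (W (∑ j, w j • e j)), W (∑ j, w j • e j)⟫ := fun w => by
    simp only [map_sum, map_smul, sum_inner, inner_sum, inner_smul_left, inner_smul_right,
      conj_trivial, dotProduct, mulVec, hSij, Finset.mul_sum]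
    rw [Finset.sum_comm]
    refine Finset.sum_congr rfl fun i _ => Finset.sum_congr rfl fun j _ => ?_
    ring
  have hball : ∀ᵐ x ∂ν, x ∈ ballSet ι (κ ^ 2 / l) := by
    have hms : MeasurableSet {y : ι → ℝ | y ∈ ballSet ι (κ ^ 2 / l)} :=
      (isCompact_ballSet _).measurableSet
    rw [hν, ae_map_iff hψm.aemeasurable hms]
    filter_upwards [hK.norm_le hκ] with x hx
    have h1 : ψ x ⬝ᵥ ψ x ≤ ‖W x‖ ^ 2 := by
      have := he.sum_inner_products_le (W x) (s := Finset.univ)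
      refine le_trans (le_of_eq ?_) this
      refine Finset.sum_congr rfl fun j _ => ?_
      rw [Real.norm_eq_abs, sq_abs, sq, hψ]
      simp only [hWs]
    refine h1.trans ((norm_calcL_rpow_neg_half_sq_le hA hl x).trans ?_)
    gcongr
  have htr : (momentMatrix ν).trace ≤ N := by
    refine le_trans (le_of_eq ?_) (hA.sum_inner_calcL_div_le hl hN0 hN he)
    refine Finset.sum_congr rfl fun j _ => ?_
    rw [diag_apply, hSij, hA.inner_apply_calcL_rpow_neg_half hl]
  have hone : ∀ w, w ⬝ᵥ momentMatrix ν *ᵥ w ≤ w ⬝ᵥ w := fun w => by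
    rw [hform, hwself, hA.inner_apply_calcL_rpow_neg_half hl]
    exact hA.inner_calcL_div_le hl _
  have hmain := measure_empDev_gt_le hball (by positivity) hn htr hone hp hpr hε
  have hdev : ∀ (w : ι → ℝ) (x : Fin n → H), w ⬝ᵥ empDev ν (fun i => ψ (x i)) *ᵥ w =
      formDev μ x (W (∑ j, w j • e j)) := fun w x => by
    rw [empDev, formDev, sub_mulVec, dotProduct_sub, hform, smul_mulVec, dotProduct_smul,
      sum_mulVec, dotProduct_sum, smul_eq_mul]
    congr 2
    refine Finset.sum_congr rfl fun i _ => ?_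
    rw [← hdot, ← trace_vecMulVec_mul, trace_mul_comm, trace_vecMulVec_mul, vecMulVec_mulVec]
    rw [dotProduct_smul, dotProduct_comm (ψ (x i)) w, sq]
    rfl
  have hmap : (Measure.pi fun _ : Fin n => μ).map (fun x i => ψ (x i)) =
      Measure.pi fun _ => ν := by
    rw [Measure.pi_map_pi fun _ => hψm.aemeasurable]
  rw [← hmap] at hmain
  refine le_trans ?_ ((Measure.le_map_apply (measurable_pi_lambda _ fun i =>
    hψm.comp (measurable_pi_apply i)).aemeasurable _).trans hmain)
  refine measure_mono ?_
  rintro x ⟨w, hw⟩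
  refine ⟨w, ?_⟩
  change ε * (w ⬝ᵥ w) < |w ⬝ᵥ empDev ν (fun i => ψ (x i)) *ᵥ w|
  rw [hdev, hwself]
  exact hw

/-- Concentration of the empirical covariance operator around the covariance operator, measured
relative to the form `A + l`. The finite-dimensional bound does not depend on the subspace, so it
passes to an increasing union of subspaces with dense range. -/
theorem measure_formDev_gt_le (hκ : 0 ≤ κ) (hK : BoundedKernel μ κ) (hl : 0 < l) (hN0 : 0 ≤ N)
    (hN : effDim (covOp μ) l ≤ ENNReal.ofReal N) (hn : n ≠ 0) {p : ℕ} (hp : 1 ≤ p)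
    (hpr : (2 * p - 1) * (κ ^ 2 / l / n) ≤ 1) {ε : ℝ} (hε : 0 < ε) :
    (Measure.pi fun _ : Fin n => μ)
      {x | ∃ v, ε * (⟪covOp μ v, v⟫ + l * ‖v‖ ^ 2) < |formDev μ x v|} ≤
      ENNReal.ofReal (N * (10 * p * (κ ^ 2 / l / n) / ε ^ 2) ^ p) := by
  have hA := posDiagonal_covOp hκ hK
  have hb := norm_covOp_apply_le hκ hK
  set W := calcL (covOp μ) (fun u => (u + l) ^ (-(1 / 2) : ℝ)) with hW
  set d := TopologicalSpace.denseSeq H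
  set U : ℕ → Submodule ℝ H := fun k => Submodule.span ℝ (d '' Set.Iic k) with hU
  have hfin : ∀ k, FiniteDimensional ℝ (U k) := fun k =>
    FiniteDimensional.span_of_finite ℝ ((Set.finite_Iic k).image d)
  have hUm : Monotone U := fun i j hij =>
    Submodule.span_mono (Set.image_mono (Set.Iic_subset_Iic.2 hij))
  set E : ℕ → Set (Fin n → H) := fun k =>
    {x | ∃ f ∈ U k, ε * ‖f‖ ^ 2 < |formDev μ x (W f)|} with hE
  have hEm : Monotone E := fun i j hij x ⟨f, hf, hx⟩ => ⟨f, hUm hij hf, hx⟩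
  have hEk : ∀ k, (Measure.pi fun _ : Fin n => μ) (E k) ≤
      ENNReal.ofReal (N * (10 * p * (κ ^ 2 / l / n) / ε ^ 2) ^ p) := fun k => by
    have := hfin k
    set b := stdOrthonormalBasis ℝ (U k)
    have he : Orthonormal ℝ (fun j => (b j : H)) :=
      b.orthonormal.comp_linearIsometry (U k).subtypeₗᵢ
    refine le_trans (measure_mono ?_) (measure_formDev_span_le hκ hK hl hN0 hN hn hp hpr hε he)
    rintro x ⟨f, hf, hx⟩
    refine ⟨fun j => b.repr ⟨f, hf⟩ j, ?_⟩
    have h1 := congrArg (Submodule.subtype (U k)) (b.sum_repr ⟨f, hf⟩)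
    simp only [map_sum, map_smul, Submodule.subtype_apply] at h1
    rw [h1]
    exact hx
  refine le_trans (measure_mono (t := ⋃ k, E k) ?_) ?_
  · rintro x ⟨v, hv⟩
    -- the vector `f = (A + l) ^ (1/2) v` is approximated by the spans
    set f := calcL (covOp μ) (fun u => (u + l) ^ (1 / 2 : ℝ)) v with hf
    have hp1 : SpecBound (covOp μ) (fun u => (u + l) ^ (1 / 2 : ℝ)) ((κ ^ 2 + l) ^ (1 / 2 : ℝ)) :=
      hA.specBound hb fun u hu => PosDiagonal.abs_add_rpow_le hl hu (by norm_num)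
    have hWf : W f = v := by
      refine hA.ext fun σ => ?_
      rw [hW, hf, hA.eigenProj_calcL (hA.specBound_add_rpow_neg hl (p := 1 / 2) (by norm_num)),
        hA.eigenProj_calcL hp1, smul_smul]
      by_cases h0 : eigenProj (covOp μ) σ = 0
      · rw [h0, _root_.zero_apply, smul_zero]
      · have := hA.eigenvalue_nonneg h0
        rw [← Real.rpow_add (by positivity)]
        norm_num
    have hfn : ‖f‖ ^ 2 = ⟪covOp μ v, v⟫ + l * ‖v‖ ^ 2 := hA.norm_sq_calcL_add_rpow hb hl v
    have hopen : IsOpen {f : H | ε * ‖f‖ ^ 2 < |formDev μ x (W f)|} :=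
      isOpen_lt (by fun_prop) ((continuous_formDev μ x).comp W.continuous).abs
    obtain ⟨g, hg, k, rfl⟩ := (TopologicalSpace.denseRange_denseSeq H).inter_open_nonempty _ hopen
      ⟨f, by rw [Set.mem_ofPred_eq, hWf, hfn]; exact hv⟩
    exact Set.mem_iUnion.2 ⟨k, d k, Submodule.subset_span ⟨k, Set.mem_Iic.2 le_rfl, rfl⟩, hg⟩
  · rw [hEm.measure_iUnion]
    exact iSup_le hEk

end FormDeviation

/-! ### The regularization parameter -/

section Rates

/-- The regularization parameter `n ^ (-1 / max 1 (2ζ + γ))`. -/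
def regParam (ζ γ : ℝ) (n : ℕ) : ℝ := (n : ℝ) ^ (-(1 / max 1 (2 * ζ + γ)))

/-- The logarithmic factor of the rates: it is only present when `2ζ + γ ≤ 1`. -/
def logFactor (ζ γ : ℝ) (n : ℕ) : ℝ :=
  if 1 < 2 * ζ + γ then 1 else max 1 (Real.log ((n : ℝ) ^ γ))

variable {ζ γ : ℝ} {n : ℕ}

theorem regParam_pos (hn : 1 ≤ n) : 0 < regParam ζ γ n :=
  Real.rpow_pos_of_pos (by exact_mod_cast hn) _

theorem regParam_le_one (hn : 1 ≤ n) : regParam ζ γ n ≤ 1 :=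
  Real.rpow_le_one_of_one_le_of_nonpos (by exact_mod_cast hn)
    (neg_nonpos.2 (div_nonneg zero_le_one (zero_le_one.trans (le_max_left _ _))))

theorem one_le_logFactor : 1 ≤ logFactor ζ γ n := by
  unfold logFactor
  split_ifs
  · exact le_rfl
  · exact le_max_left _ _

theorem log_inv_regParam (hn : 1 ≤ n) :
    Real.log (regParam ζ γ n)⁻¹ = 1 / max 1 (2 * ζ + γ) * Real.log n := by
  have hn0 : (0 : ℝ) < n := by exact_mod_cast hn
  rw [regParam, ← Real.rpow_neg hn0.le, neg_neg, Real.log_rpow hn0]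

/-- The sample size beats the effective dimension: `n λ` times the logarithmic factor dominates
`log λ⁻¹`. -/
theorem exists_le_mul_regParam (ζ : ℝ) (hγ : 0 < γ) (c : ℝ) (hc : 0 ≤ c) {b : ℝ} (hb : 0 < b) :
    ∃ K, 1 ≤ K ∧ ∀ n : ℕ, 1 ≤ n → ∀ u : ℝ, 1 ≤ u →
      b * (u + c + γ * Real.log (regParam ζ γ n)⁻¹) ≤
        K * logFactor ζ γ n * u * regParam ζ γ n * n := by
  by_cases h : 1 < 2 * ζ + γ
  · have hmax : max 1 (2 * ζ + γ) = 2 * ζ + γ := max_eq_right h.le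
    set m := 2 * ζ + γ with hm
    have hm0 : 0 < m := zero_lt_one.trans h
    set s := 1 - 1 / m with hs
    have hs0 : 0 < s := by
      rw [hs, sub_pos, div_lt_one hm0]
      exact h
    refine ⟨max 1 (b * (1 + c + γ * (1 / m) / s)), le_max_left _ _, fun n hn u hu => ?_⟩
    have hn1 : (1 : ℝ) ≤ n := by exact_mod_cast hn
    have hn0 : (0 : ℝ) < n := by linarith
    have hlog := Real.log_le_rpow_div hn0.le hs0
    have hns : 1 ≤ (n : ℝ) ^ s := Real.one_le_rpow hn1 hs0.le
    have hreg : regParam ζ γ n * n = (n : ℝ) ^ s := by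
      rw [regParam, hmax]
      nth_rw 2 [← Real.rpow_one (n : ℝ)]
      rw [← Real.rpow_add hn0, hs]
      congr 1
      ring
    rw [log_inv_regParam hn, hmax, logFactor, if_pos h, mul_one, mul_assoc _ (regParam _ _ _), hreg]
    have hx : 1 ≤ u * (n : ℝ) ^ s := one_le_mul_of_one_le_of_one_le hu hns
    have h1 : u ≤ u * (n : ℝ) ^ s := le_mul_of_one_le_right (by linarith) hns
    have h2 : (n : ℝ) ^ s ≤ u * (n : ℝ) ^ s := le_mul_of_one_le_left (by linarith) hu
    calc b * (u + c + γ * (1 / m * Real.log n))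
        ≤ b * (u * (n : ℝ) ^ s + c * (u * (n : ℝ) ^ s) +
            γ * (1 / m * (u * (n : ℝ) ^ s / s))) := by
          gcongr
          · exact le_mul_of_one_le_right hc hx
          · exact hlog.trans (by gcongr)
      _ = b * (1 + c + γ * (1 / m) / s) * (u * (n : ℝ) ^ s) := by ring
      _ ≤ max 1 (b * (1 + c + γ * (1 / m) / s)) * (u * (n : ℝ) ^ s) := by
          gcongr
          exact le_max_right _ _
      _ = _ := by ring
  · have hmax : max 1 (2 * ζ + γ) = 1 := max_eq_left (not_lt.1 h)
    refine ⟨max 1 (b * (2 + c)), le_max_left _ _, fun n hn u hu => ?_⟩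
    have hn1 : (1 : ℝ) ≤ n := by exact_mod_cast hn
    have hn0 : (0 : ℝ) < n := by linarith
    have hreg : regParam ζ γ n * n = 1 := by
      rw [regParam, hmax, div_one, Real.rpow_neg_one, inv_mul_cancel₀ hn0.ne']
    have hl1 := one_le_logFactor (ζ := ζ) (γ := γ) (n := n)
    have hlog : γ * Real.log n ≤ logFactor ζ γ n := by
      rw [logFactor, if_neg h, ← Real.log_rpow hn0]
      exact le_max_right _ _
    rw [log_inv_regParam hn, hmax, div_one, one_mul, mul_assoc _ (regParam _ _ _), hreg, mul_one]
    set L := logFactor ζ γ n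
    have hx : 1 ≤ L * u := one_le_mul_of_one_le_of_one_le hl1 hu
    have h1 : u ≤ L * u := le_mul_of_one_le_left (by linarith) hl1
    have h2 : L ≤ L * u := le_mul_of_one_le_right (by linarith) hu
    calc b * (u + c + γ * Real.log n) ≤ b * (L * u + c * (L * u) + L * u) := by
          refine mul_le_mul_of_nonneg_left ?_ hb.le
          linarith [le_mul_of_one_le_right hc hx, hlog.trans h2]
      _ = b * (2 + c) * (L * u) := by ring
      _ ≤ max 1 (b * (2 + c)) * (L * u) := by
          gcongr
          exact le_max_right _ _
      _ = _ := by ring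

end Rates

/-! ### Comparison of the covariance operator with its empirical version -/

section CovarianceConcentration

variable {H : Type*} [NormedAddCommGroup H] [InnerProductSpace ℝ H] [CompleteSpace H]
  [TopologicalSpace.SeparableSpace H] [MeasurableSpace H] [BorelSpace H]
  {μ : Measure H} [IsProbabilityMeasure μ] {κ l : ℝ} {n : ℕ}

/-- The norm of a symmetric operator is bounded by its quadratic form. -/
theorem norm_apply_le_of_abs_inner_le {T : H →L[ℝ] H} (hT : ∀ v w, ⟪T v, w⟫ = ⟪v, T w⟫) {D : ℝ}
    (hD : ∀ v, |⟪T v, v⟫| ≤ D * ‖v‖ ^ 2) (v : H) : ‖T v‖ ≤ D * ‖v‖ := by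
  by_cases hv : ‖v‖ = 0
  · rw [norm_eq_zero.1 hv, map_zero, norm_zero, mul_zero]
  by_cases hw : ‖T v‖ = 0
  · rw [hw]
    have h1 := (abs_nonneg _).trans (hD v)
    have h2 : 0 < ‖v‖ := (norm_nonneg v).lt_of_ne' hv
    nlinarith [h2, sq_nonneg ‖v‖]
  -- polarization at `v` and the multiple `w` of `T v` with the same norm as `v`
  set w := (‖v‖ / ‖T v‖) • T v with hwd
  have hwn : ‖w‖ = ‖v‖ := by
    rw [hwd, norm_smul, Real.norm_of_nonneg (by positivity), div_mul_cancel₀ _ hw]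
  have hin : ⟪T v, w⟫ = ‖v‖ * ‖T v‖ := by
    rw [hwd, inner_smul_right, real_inner_self_eq_norm_sq]
    field_simp
  have hpol : 4 * ⟪T v, w⟫ = ⟪T (v + w), v + w⟫ - ⟪T (v - w), v - w⟫ := by
    have : ⟪T w, v⟫ = ⟪T v, w⟫ := by rw [hT, real_inner_comm]
    simp only [map_add, map_sub, inner_add_left, inner_add_right, inner_sub_left, inner_sub_right,
      this]
    ring
  have hpar := parallelogram_law_with_norm ℝ v w
  have h1 := (abs_le.1 (hD (v + w))).2
  have h2 := (abs_le.1 (hD (v - w))).1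
  have h3 : ‖v‖ * ‖T v‖ ≤ ‖v‖ * (D * ‖v‖) := by
    rw [← hin]
    rw [hwn] at hpar
    have h4 : D * (‖v + w‖ ^ 2 + ‖v - w‖ ^ 2) = D * (2 * (‖v‖ ^ 2 + ‖v‖ ^ 2)) := by rw [hpar]
    linarith
  exact le_of_mul_le_mul_left h3 ((norm_nonneg v).lt_of_ne' hv)

/-- When `n l` exceeds a multiple of `log (N / δ)`, the covariance operator is dominated by twice
the empirical one, up to `l`. -/
theorem measure_not_form_le (hκ : 0 < κ) (hK : BoundedKernel μ κ) (hl : 0 < l) {N : ℝ}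
    (hN0 : 0 < N) (hN : effDim (covOp μ) l ≤ ENNReal.ofReal N) (hn : 1 ≤ n) {u : ℝ} (hu : 0 ≤ u)
    (h : 40 * Real.exp 1 * κ ^ 2 * (u + 1 + max 0 (Real.log N)) ≤ l * n) :
    (Measure.pi fun _ : Fin n => μ) {x | ¬ ∀ v, ⟪covOp μ v, v⟫ ≤
      2 * ((n : ℝ)⁻¹ * ∑ i, ⟪v, x i⟫ ^ 2) + l * ‖v‖ ^ 2} ≤ ENNReal.ofReal (Real.exp (-u)) := by
  have hn0 : (0 : ℝ) < n := by exact_mod_cast hn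
  have he1 : 1 ≤ Real.exp 1 := Real.one_le_exp zero_le_one
  have hb : 0 < 40 * Real.exp 1 * κ ^ 2 := by positivity
  set s := l * n / (40 * Real.exp 1 * κ ^ 2) with hs
  have hs1 : u + 1 + max 0 (Real.log N) ≤ s := by
    rw [hs, le_div_iff₀ hb, mul_comm]
    exact h
  have hs2 : 1 ≤ s := by linarith [le_max_left 0 (Real.log N)]
  -- the moment of order `2 p`, with `p` maximal such that the base of the power in the bound is at
  -- most `exp (-1)`
  set p := ⌊s⌋₊ with hp
  have hp1 : 1 ≤ p := (Nat.one_le_floor_iff s).2 hs2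
  have hps : (p : ℝ) ≤ s := Nat.floor_le (by linarith)
  have hsp : s < p + 1 := Nat.lt_floor_add_one s
  have hr : κ ^ 2 / l / n * s = (40 * Real.exp 1)⁻¹ := by
    rw [hs]
    field_simp
  have hr0 : 0 < κ ^ 2 / l / n := by positivity
  have hpr' : p * (κ ^ 2 / l / n) ≤ (40 * Real.exp 1)⁻¹ := by
    rw [← hr, mul_comm]
    gcongr
  have hpr : (2 * p - 1) * (κ ^ 2 / l / n) ≤ 1 := by
    have : (40 * Real.exp 1)⁻¹ ≤ 1 / 2 := by
      rw [inv_le_comm₀ (by positivity) (by norm_num)]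
      linarith
    nlinarith
  have hmain := measure_formDev_gt_le hκ.le hK hl hN0.le hN (by omega : n ≠ 0) hp1 hpr
    (by norm_num : (0 : ℝ) < 1 / 2)
  refine le_trans (measure_mono ?_) (hmain.trans (ENNReal.ofReal_le_ofReal ?_))
  · intro x hx
    by_contra hcon
    refine hx fun v => ?_
    by_contra hlt
    refine hcon ⟨v, ?_⟩
    push Not at hlt
    have : -formDev μ x v ≤ |formDev μ x v| := neg_le_abs _
    rw [formDev] at this ⊢
    linarith
  · have hbase : 10 * p * (κ ^ 2 / l / n) / (1 / 2) ^ 2 ≤ Real.exp (-1) := by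
      rw [Real.exp_neg]
      calc 10 * p * (κ ^ 2 / l / n) / (1 / 2) ^ 2 = 40 * (p * (κ ^ 2 / l / n)) := by ring
        _ ≤ 40 * (40 * Real.exp 1)⁻¹ := by gcongr
        _ = _ := by field_simp
    calc N * (10 * p * (κ ^ 2 / l / n) / (1 / 2) ^ 2) ^ p ≤ N * Real.exp (-1) ^ p := by gcongr
      _ = Real.exp (Real.log N - p) := by
        rw [← Real.exp_nat_mul, Real.exp_sub, Real.exp_log hN0, mul_neg_one, Real.exp_neg]
        rfl
      _ ≤ Real.exp (-u) := by
        refine Real.exp_le_exp.2 ?_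
        linarith [le_max_right 0 (Real.log N)]

theorem inner_covOp_self_le (hκ : 0 ≤ κ) (hK : BoundedKernel μ κ) (v : H) :
    ⟪covOp μ v, v⟫ ≤ κ ^ 2 * ‖v‖ ^ 2 := by
  rw [covOp, inner_adjoint_comp_self, real_inner_self_eq_norm_sq]
  exact norm_sq_inclusion_le hκ hK v

/-- The quadratic form of the empirical covariance operator deviates from its mean at the rate
`n ^ (-1/2)`. -/
theorem measure_not_abs_formDev_le (hκ : 0 < κ) (hK : BoundedKernel μ κ) {N : ℝ}
    (hN0 : 0 < N) (hN : effDim (covOp μ) (κ ^ 2) ≤ ENNReal.ofReal N) (hn : 1 ≤ n) {u : ℝ}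
    (hu : 1 ≤ u) :
    (Measure.pi fun _ : Fin n => μ) {x | (∀ i, ‖x i‖ ≤ κ) ∧ ¬ ∀ v, |formDev μ x v| ≤
      16 * κ ^ 2 * √(u / n) * ‖v‖ ^ 2} ≤ ENNReal.ofReal (N * Real.exp (-u)) := by
  have hn0 : (0 : ℝ) < n := by exact_mod_cast hn
  have hu0 : 0 < u := by linarith
  by_cases hnu : n < 3 * u
  · -- a small sample: the trivial bound
    refine le_trans (le_of_eq ?_) zero_le
    convert measure_empty (μ := Measure.pi fun _ : Fin n => μ)
    refine Set.eq_empty_of_forall_notMem ?_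
    rintro x ⟨hx, hcon⟩
    refine hcon fun v => ?_
    have h1 := inner_covOp_self_le hκ.le hK v
    have h2 := (posDiagonal_covOp hκ.le hK).nonneg v
    have h3 : 0 ≤ (n : ℝ)⁻¹ * ∑ i, ⟪v, x i⟫ ^ 2 := by positivity
    have h4 : (n : ℝ)⁻¹ * ∑ i, ⟪v, x i⟫ ^ 2 ≤ κ ^ 2 * ‖v‖ ^ 2 := by
      rw [inv_mul_le_iff₀ hn0]
      calc ∑ i, ⟪v, x i⟫ ^ 2 ≤ ∑ _i : Fin n, κ ^ 2 * ‖v‖ ^ 2 := by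
            refine Finset.sum_le_sum fun i _ => ?_
            rw [← sq_abs, ← mul_pow, mul_comm]
            refine pow_le_pow_left₀ (abs_nonneg _) ((abs_real_inner_le_norm _ _).trans ?_) 2
            gcongr
            exact hx i
        _ = _ := by simp
    have h5 : |formDev μ x v| ≤ κ ^ 2 * ‖v‖ ^ 2 := by
      rw [formDev, abs_le]
      constructor <;> linarith
    refine h5.trans ?_
    have h6 : (1 : ℝ) / 16 ≤ √(u / n) := by
      refine Real.le_sqrt_of_sq_le ?_
      rw [le_div_iff₀ hn0]
      linarith
    have : 0 ≤ κ ^ 2 * ‖v‖ ^ 2 := by positivity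
    calc κ ^ 2 * ‖v‖ ^ 2 = 16 * κ ^ 2 * (1 / 16) * ‖v‖ ^ 2 := by ring
      _ ≤ _ := by gcongr
  push Not at hnu
  set p := ⌈u⌉₊ with hp
  have hp1 : 1 ≤ p := Nat.one_le_ceil_iff.2 hu0
  have hup : u ≤ p := Nat.le_ceil u
  have hpu : (p : ℝ) < u + 1 := Nat.ceil_lt_add_one hu0.le
  have he : Real.exp 1 < 2.7182818286 := Real.exp_one_lt_d9
  set ε := 8 * √(u / n) with hε
  have hε2 : ε ^ 2 = 64 * (u / n) := by
    rw [hε, mul_pow, Real.sq_sqrt (by positivity)]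
    norm_num
  have hε0 : 0 < ε := by positivity
  have hκ1 : κ ^ 2 / κ ^ 2 = 1 := div_self (by positivity)
  have hpr : (2 * p - 1) * (κ ^ 2 / κ ^ 2 / n) ≤ 1 := by
    rw [hκ1, mul_one_div, div_le_one hn0]
    linarith
  have hmain := measure_formDev_gt_le hκ.le hK (by positivity : 0 < κ ^ 2) hN0.le hN
    (by omega : n ≠ 0) hp1 hpr hε0
  refine le_trans (measure_mono ?_) (hmain.trans (ENNReal.ofReal_le_ofReal ?_))
  · rintro x ⟨-, hx⟩
    by_contra hcon
    refine hx fun v => ?_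
    by_contra hlt
    refine hcon ⟨v, ?_⟩
    push Not at hlt
    refine lt_of_le_of_lt ?_ hlt
    calc ε * (⟪covOp μ v, v⟫ + κ ^ 2 * ‖v‖ ^ 2) ≤ ε * (κ ^ 2 * ‖v‖ ^ 2 + κ ^ 2 * ‖v‖ ^ 2) := by
          gcongr
          exact inner_covOp_self_le hκ.le hK v
      _ = _ := by rw [hε]; ring
  · rw [hκ1, hε2]
    have hbase : 10 * p * (1 / n) / (64 * (u / n)) ≤ Real.exp (-1) := by
      rw [Real.exp_neg, div_le_iff₀ (by positivity), ← div_eq_inv_mul, le_div_iff₀ (by positivity)]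
      have : 10 * p * Real.exp 1 ≤ 64 * u := by nlinarith [Real.exp_pos 1]
      calc 10 * p * (1 / n) * Real.exp 1 = 10 * p * Real.exp 1 / n := by ring
        _ ≤ 64 * u / n := by gcongr
        _ = _ := by ring
    calc N * (10 * p * (1 / n) / (64 * (u / n))) ^ p ≤ N * Real.exp (-1) ^ p := by gcongr
      _ ≤ N * Real.exp (-u) := by
        gcongr
        rw [← Real.exp_nat_mul]
        refine Real.exp_le_exp.2 ?_
        linarith

end CovarianceConcentration

/-! ### Exponential tails for sums of Hilbert space valued random variables -/

section CoshMoment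

/-- Convexity of `cosh` as a function of the square of its argument. -/
theorem cosh_le_of_sq_eq {p q r s t : ℝ} (hs : 0 ≤ s) (ht : 0 ≤ t) (hst : s + t = 1)
    (h : r ^ 2 = s * p ^ 2 + t * q ^ 2) :
    Real.cosh r ≤ s * Real.cosh p + t * Real.cosh q := by
  -- `cosh` is a power series in the square of its argument, with nonnegative coefficients
  refine hasSum_le (fun k => ?_) (Real.hasSum_cosh r)
    (((Real.hasSum_cosh p).mul_left s).add ((Real.hasSum_cosh q).mul_left t))
  have h1 := (convexOn_pow k).2 (Set.mem_Ici.2 (sq_nonneg p)) (Set.mem_Ici.2 (sq_nonneg q)) hs ht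
    hst
  simp only [smul_eq_mul] at h1
  rw [← h, ← pow_mul, ← pow_mul, ← pow_mul] at h1
  calc r ^ (2 * k) / ((2 * k).factorial : ℝ)
      ≤ (s * p ^ (2 * k) + t * q ^ (2 * k)) / ((2 * k).factorial : ℝ) := by gcongr
    _ = _ := by ring

variable {H : Type*} [NormedAddCommGroup H] [InnerProductSpace ℝ H]

/-- The Hilbert space norm is smooth enough for a second order expansion of `cosh ‖·‖`, the
remainder being of exponential type. -/
theorem cosh_norm_add_le (s x : H) :
    Real.cosh ‖s + x‖ ≤ Real.cosh ‖s‖ + Real.sinh ‖s‖ / ‖s‖ * ⟪s, x⟫ +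
      Real.cosh ‖s‖ * (Real.exp ‖x‖ - 1 - ‖x‖) := by
  set a := ‖s‖ with ha
  set b := ‖x‖ with hb
  have ha0 : 0 ≤ a := norm_nonneg s
  have hb0 : 0 ≤ b := norm_nonneg x
  have hexp : Real.exp b = Real.cosh b + Real.sinh b := (Real.cosh_add_sinh b).symm
  rcases ha0.eq_or_lt with h | ha1
  · have hs : s = 0 := norm_eq_zero.1 (ha.symm.trans h.symm)
    rw [← h, hs, zero_add, inner_zero_left, Real.cosh_zero, ← hb, hexp]
    have := Real.self_le_sinh_iff.2 hb0
    linarith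
  rcases hb0.eq_or_lt with h | hb1
  · have hx : x = 0 := norm_eq_zero.1 (hb.symm.trans h.symm)
    rw [← h, hx, add_zero, inner_zero_right, ← ha]
    simp
  set c := ⟪s, x⟫ with hc
  have hcab : |c| ≤ a * b := abs_real_inner_le_norm s x
  have hab : 0 < a * b := by positivity
  set k := c / (a * b) with hk
  have hk1 : |k| ≤ 1 := by
    rw [hk, abs_div, abs_of_pos hab, div_le_one hab]
    exact hcab
  have hck : c = k * (a * b) := by rw [hk, div_mul_cancel₀ _ hab.ne']
  obtain ⟨hk2, hk3⟩ := abs_le.1 hk1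
  have h1 : Real.cosh ‖s + x‖ ≤
      (1 + k) / 2 * Real.cosh (a + b) + (1 - k) / 2 * Real.cosh (a - b) := by
    refine cosh_le_of_sq_eq (by linarith) (by linarith) (by ring) ?_
    rw [norm_add_sq_real, ← ha, ← hb, ← hc, hck]
    ring
  have h2 : (1 + k) / 2 * Real.cosh (a + b) + (1 - k) / 2 * Real.cosh (a - b) =
      Real.cosh a * Real.cosh b + k * Real.sinh a * Real.sinh b := by
    rw [Real.cosh_add, Real.cosh_sub]
    ring
  have h3 : Real.sinh a / a * c = k * Real.sinh a * b := by
    rw [hck]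
    field_simp
  have hsb : b ≤ Real.sinh b := Real.self_le_sinh_iff.2 hb0
  have hsa : Real.sinh a ≤ Real.cosh a := (Real.sinh_lt_cosh a).le
  have hsa0 : 0 ≤ Real.sinh a := Real.sinh_nonneg_iff.2 ha0
  have h4 : k * Real.sinh a * (Real.sinh b - b) ≤ Real.cosh a * (Real.sinh b - b) := by
    refine mul_le_mul_of_nonneg_right ?_ (by linarith)
    nlinarith
  rw [h3, hexp]
  rw [h2] at h1
  linarith

variable [CompleteSpace H] [TopologicalSpace.SeparableSpace H] [MeasurableSpace H] [BorelSpace H]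
  {X : Type*} [MeasurableSpace X] {ρ : Measure X} [IsProbabilityMeasure ρ] {ξ : X → H} {m v : ℝ}

/-- Adding one random vector `ξ` multiplies `cosh ‖s‖` by at most `1 + m + v` in the mean, where `m`
bounds the norm of the mean of `ξ` and `v` its exponential second moment. -/
theorem lintegral_cosh_norm_add_le (hξ : Measurable ξ)
    (hi : Integrable (fun x => Real.exp ‖ξ x‖) ρ) (hm : ∀ s, ∫ x, ⟪s, ξ x⟫ ∂ρ ≤ m * ‖s‖)
    (hm0 : 0 ≤ m) (hv : ∫ x, (Real.exp ‖ξ x‖ - 1 - ‖ξ x‖) ∂ρ ≤ v) (s : H) :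
    ∫⁻ x, ENNReal.ofReal (Real.cosh ‖s + ξ x‖) ∂ρ ≤
      ENNReal.ofReal (Real.cosh ‖s‖ * (1 + m + v)) := by
  have := secondCountableTopology_of_separable (H := H)
  have hn : Integrable (fun x => ‖ξ x‖) ρ := hi.mono' hξ.norm.aestronglyMeasurable
    (Eventually.of_forall fun x => by
      rw [norm_norm]
      linarith [Real.add_one_le_exp ‖ξ x‖])
  have hξi : Integrable ξ ρ := ⟨hξ.aestronglyMeasurable, (integrable_norm_iff
    hξ.aestronglyMeasurable).1 hn |>.2⟩
  have hin : Integrable (fun x => ⟪s, ξ x⟫) ρ := hξi.const_inner s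
  have he : Integrable (fun x => Real.exp ‖ξ x‖ - 1 - ‖ξ x‖) ρ :=
    (hi.sub (integrable_const 1)).sub hn
  have hG : Integrable (fun x => Real.cosh ‖s‖ + Real.sinh ‖s‖ / ‖s‖ * ⟪s, ξ x⟫ +
      Real.cosh ‖s‖ * (Real.exp ‖ξ x‖ - 1 - ‖ξ x‖)) ρ :=
    ((integrable_const _).add (hin.const_mul _)).add (he.const_mul _)
  have hnn : ∀ x, 0 ≤ Real.cosh ‖s‖ + Real.sinh ‖s‖ / ‖s‖ * ⟪s, ξ x⟫ +
      Real.cosh ‖s‖ * (Real.exp ‖ξ x‖ - 1 - ‖ξ x‖) := fun x =>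
    (Real.cosh_pos _).le.trans (cosh_norm_add_le s (ξ x))
  calc ∫⁻ x, ENNReal.ofReal (Real.cosh ‖s + ξ x‖) ∂ρ
      ≤ ∫⁻ x, ENNReal.ofReal (Real.cosh ‖s‖ + Real.sinh ‖s‖ / ‖s‖ * ⟪s, ξ x⟫ +
          Real.cosh ‖s‖ * (Real.exp ‖ξ x‖ - 1 - ‖ξ x‖)) ∂ρ :=
        lintegral_mono fun x => ENNReal.ofReal_le_ofReal (cosh_norm_add_le s (ξ x))
    _ = ENNReal.ofReal (∫ x, (Real.cosh ‖s‖ + Real.sinh ‖s‖ / ‖s‖ * ⟪s, ξ x⟫ +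
          Real.cosh ‖s‖ * (Real.exp ‖ξ x‖ - 1 - ‖ξ x‖)) ∂ρ) :=
        (ofReal_integral_eq_lintegral_ofReal hG (Eventually.of_forall hnn)).symm
    _ ≤ _ := by
      refine ENNReal.ofReal_le_ofReal ?_
      have hadd : Integrable (fun x => Real.cosh ‖s‖ + Real.sinh ‖s‖ / ‖s‖ * ⟪s, ξ x⟫) ρ :=
        (integrable_const _).add (hin.const_mul _)
      rw [integral_add hadd (he.const_mul _), integral_add (integrable_const _) (hin.const_mul _),
        integral_const_mul, integral_const_mul]
      simp only [integral_const, probReal_univ, one_smul]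
      have hs0 : 0 ≤ Real.sinh ‖s‖ := Real.sinh_nonneg_iff.2 (norm_nonneg s)
      have h1 : Real.sinh ‖s‖ / ‖s‖ * ∫ x, ⟪s, ξ x⟫ ∂ρ ≤ Real.cosh ‖s‖ * m := by
        calc _ ≤ Real.sinh ‖s‖ / ‖s‖ * (m * ‖s‖) := by gcongr; exact hm s
          _ = Real.sinh ‖s‖ * m * (‖s‖ / ‖s‖) := by ring
          _ ≤ Real.sinh ‖s‖ * m * 1 := by
            gcongr
            exact div_self_le_one _
          _ ≤ Real.cosh ‖s‖ * m := by
            rw [mul_one]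
            gcongr
            exact (Real.sinh_lt_cosh _).le
      have h2 := mul_le_mul_of_nonneg_left hv (Real.cosh_pos ‖s‖).le
      linarith

theorem lintegral_cosh_norm_add_sum_le (hξ : Measurable ξ)
    (hi : Integrable (fun x => Real.exp ‖ξ x‖) ρ) (hm : ∀ s, ∫ x, ⟪s, ξ x⟫ ∂ρ ≤ m * ‖s‖)
    (hm0 : 0 ≤ m) (hv : ∫ x, (Real.exp ‖ξ x‖ - 1 - ‖ξ x‖) ∂ρ ≤ v) (hv0 : 0 ≤ v) (n : ℕ) (s : H) :
    ∫⁻ x : Fin n → X, ENNReal.ofReal (Real.cosh ‖s + ∑ i, ξ (x i)‖) ∂(Measure.pi fun _ => ρ) ≤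
      ENNReal.ofReal (Real.cosh ‖s‖ * (1 + m + v) ^ n) := by
  have := secondCountableTopology_of_separable (H := H)
  induction n generalizing s with
  | zero => simp
  | succ n ih =>
    have hmp := (measurePreserving_piFinSuccAbove (fun _ : Fin (n + 1) => ρ) 0).symm
    rw [← hmp.map_eq, lintegral_map (by fun_prop) (by fun_prop), lintegral_prod _ (by fun_prop)]
    calc _ = ∫⁻ x, ∫⁻ y : Fin n → X, ENNReal.ofReal (Real.cosh ‖(s + ξ x) + ∑ i, ξ (y i)‖)
          ∂(Measure.pi fun _ => ρ) ∂ρ := by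
          refine lintegral_congr fun x => lintegral_congr fun y => ?_
          simp [MeasurableEquiv.piFinSuccAbove_symm_apply, Fin.sum_univ_succ, Fin.insertNthEquiv,
            add_assoc]
      _ ≤ ∫⁻ x, ENNReal.ofReal (Real.cosh ‖s + ξ x‖ * (1 + m + v) ^ n) ∂ρ :=
        lintegral_mono fun x => ih _
      _ = (∫⁻ x, ENNReal.ofReal (Real.cosh ‖s + ξ x‖) ∂ρ) * ENNReal.ofReal ((1 + m + v) ^ n) := by
        simp only [ENNReal.ofReal_mul (Real.cosh_pos _).le]
        rw [lintegral_mul_const _ (by fun_prop)]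
      _ ≤ ENNReal.ofReal (Real.cosh ‖s‖ * (1 + m + v)) * ENNReal.ofReal ((1 + m + v) ^ n) := by
        gcongr
        exact lintegral_cosh_norm_add_le hξ hi hm hm0 hv s
      _ = _ := by
        rw [← ENNReal.ofReal_mul (mul_nonneg (Real.cosh_pos _).le (by positivity)), mul_assoc,
          ← pow_succ']

/-- An exponential tail bound for sums of independent Hilbert space valued random variables, which
need not be centred. -/
theorem measure_lt_norm_sum_le (hξ : Measurable ξ)
    (hi : Integrable (fun x => Real.exp ‖ξ x‖) ρ) (hm : ∀ s, ∫ x, ⟪s, ξ x⟫ ∂ρ ≤ m * ‖s‖)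
    (hm0 : 0 ≤ m) (hv : ∫ x, (Real.exp ‖ξ x‖ - 1 - ‖ξ x‖) ∂ρ ≤ v) (hv0 : 0 ≤ v) (n : ℕ) (u : ℝ) :
    (Measure.pi fun _ : Fin n => ρ) {x | n * (m + v) + u < ‖∑ i, ξ (x i)‖} ≤
      ENNReal.ofReal (2 * Real.exp (-u)) := by
  have := secondCountableTopology_of_separable (H := H)
  have h := lintegral_cosh_norm_add_sum_le hξ hi hm hm0 hv hv0 n 0
  simp only [zero_add, norm_zero, Real.cosh_zero, one_mul] at h
  set K := Real.exp (n * (m + v) + u) / 2 with hK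
  have hK0 : 0 < K := by positivity
  have hmk := mul_meas_ge_le_lintegral (μ := Measure.pi fun _ : Fin n => ρ)
    (f := fun x : Fin n → X => ENNReal.ofReal (Real.cosh ‖∑ i, ξ (x i)‖)) (by fun_prop)
    (ENNReal.ofReal K)
  have hsub : {x : Fin n → X | n * (m + v) + u < ‖∑ i, ξ (x i)‖} ⊆
      {x | ENNReal.ofReal K ≤ ENNReal.ofReal (Real.cosh ‖∑ i, ξ (x i)‖)} := fun x hx => by
    refine ENNReal.ofReal_le_ofReal ?_
    rw [hK, Real.cosh_eq]
    have := Real.exp_le_exp.2 (Set.mem_ofPred_eq.mp hx).le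
    have := Real.exp_pos (-‖∑ i, ξ (x i)‖)
    linarith
  have h1 : ENNReal.ofReal K * (Measure.pi fun _ : Fin n => ρ)
      {x | n * (m + v) + u < ‖∑ i, ξ (x i)‖} ≤ ENNReal.ofReal (Real.exp (n * (m + v))) := by
    refine (mul_le_mul_right (measure_mono hsub) _).trans (hmk.trans (h.trans ?_))
    refine ENNReal.ofReal_le_ofReal ?_
    rw [Real.exp_nat_mul]
    refine pow_le_pow_left₀ (by positivity) ?_ n
    linarith [Real.add_one_le_exp (m + v)]
  rw [mul_comm, ← ENNReal.le_div_iff_mul_le (Or.inl (ENNReal.ofReal_pos.2 hK0).ne')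
    (Or.inl ENNReal.ofReal_ne_top), ← ENNReal.ofReal_div_of_pos hK0] at h1
  refine h1.trans (ENNReal.ofReal_le_ofReal (le_of_eq ?_))
  rw [hK, Real.exp_add, Real.exp_neg]
  field_simp

end CoshMoment

/-! ### Weighted covariance forms and the effective dimension -/

section WeightedTrace

variable {H : Type*} [NormedAddCommGroup H] [InnerProductSpace ℝ H] [CompleteSpace H]
  [TopologicalSpace.SeparableSpace H] [MeasurableSpace H] [BorelSpace H]
  {μ : Measure H} [IsProbabilityMeasure μ] {κ l N : ℝ}

theorem countable_of_orthonormal {s : Set H} (hs : Orthonormal ℝ ((↑) : s → H)) : s.Countable := by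
  refine Set.PairwiseDisjoint.countable_of_isOpen (s := fun x : H => Metric.ball x (1 / 2))
    (fun x hx y hy hxy => ?_) (fun x _ => Metric.isOpen_ball)
    fun x _ => ⟨x, Metric.mem_ball_self (by norm_num)⟩
  refine Metric.ball_disjoint_ball ?_
  have h1 : ⟪x, y⟫ = 0 := hs.2 (i := ⟨x, hx⟩) (j := ⟨y, hy⟩) (by simpa using hxy)
  have h2 : ‖x‖ = 1 := hs.1 ⟨x, hx⟩
  have h3 : ‖y‖ = 1 := hs.1 ⟨y, hy⟩
  have h4 := norm_sub_sq_real x y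
  rw [h1, h2, h3] at h4
  rw [dist_eq_norm]
  nlinarith [norm_nonneg (x - y)]

/-- If a weighted covariance form is dominated by the covariance form, then the weighted mean of
`‖(A + l) ^ (-1/2) x‖²` is dominated by the effective dimension. -/
theorem lintegral_mul_norm_calcL_le (hκ : 0 ≤ κ) (hK : BoundedKernel μ κ) (hl : 0 < l)
    (hN0 : 0 ≤ N) (hN : effDim (covOp μ) l ≤ ENNReal.ofReal N) {w : H → ℝ≥0∞}
    (hw : AEMeasurable w μ) {c : ℝ} (hc : 0 ≤ c)
    (h : ∀ v, ∫⁻ x, w x * ENNReal.ofReal (⟪v, x⟫ ^ 2) ∂μ ≤ ENNReal.ofReal (c * ⟪covOp μ v, v⟫)) :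
    ∫⁻ x, w x * ENNReal.ofReal
      (‖calcL (covOp μ) (fun u => (u + l) ^ (-(1 / 2) : ℝ)) x‖ ^ 2) ∂μ ≤
      ENNReal.ofReal (c * N) := by
  have hA := posDiagonal_covOp hκ hK
  set W := calcL (covOp μ) (fun u => (u + l) ^ (-(1 / 2) : ℝ)) with hW
  have hWs : ∀ v w, ⟪W v, w⟫ = ⟪v, W w⟫ :=
    hA.inner_calcL (hA.specBound_add_rpow_neg hl (p := 1 / 2) (by norm_num))
  obtain ⟨s, b, hb⟩ := exists_hilbertBasis ℝ H
  have hos : Orthonormal ℝ ((↑) : s → H) := hb ▸ b.orthonormal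
  have : Countable s := (countable_of_orthonormal hos).to_subtype
  have hpar : ∀ x, ENNReal.ofReal (‖W x‖ ^ 2) =
      ∑' i, ENNReal.ofReal (⟪W (b i), x⟫ ^ 2) := fun x => by
    have h1 := b.hasSum_inner_mul_inner (W x) (W x)
    rw [real_inner_self_eq_norm_sq] at h1
    have h2 : ∀ i, ⟪W x, b i⟫ * ⟪b i, W x⟫ = ⟪W (b i), x⟫ ^ 2 := fun i => by
      rw [real_inner_comm, ← hWs, sq]
    simp only [h2] at h1
    rw [← ENNReal.ofReal_tsum_of_nonneg (fun i => sq_nonneg _) h1.summable, h1.tsum_eq]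
  have hmeas : ∀ i, AEMeasurable (fun x => w x * ENNReal.ofReal (⟪W (b i), x⟫ ^ 2)) μ := fun i =>
    hw.mul (ENNReal.continuous_ofReal.comp
      (by fun_prop : Continuous fun x => ⟪W (b i), x⟫ ^ 2)).aemeasurable
  calc _ = ∫⁻ x, ∑' i, w x * ENNReal.ofReal (⟪W (b i), x⟫ ^ 2) ∂μ := by
        simp only [hpar, ENNReal.tsum_mul_left]
    _ = ∑' i, ∫⁻ x, w x * ENNReal.ofReal (⟪W (b i), x⟫ ^ 2) ∂μ := lintegral_tsum hmeas
    _ ≤ ∑' i, ENNReal.ofReal (c * ⟪b i, calcL (covOp μ) (fun u => u / (u + l)) (b i)⟫) := by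
      refine ENNReal.tsum_le_tsum fun i => (h _).trans (le_of_eq ?_)
      rw [hA.inner_apply_calcL_rpow_neg_half hl]
    _ ≤ ENNReal.ofReal (c * N) := by
      rw [ENNReal.tsum_eq_iSup_sum]
      refine iSup_le fun t => ?_
      rw [← ENNReal.ofReal_sum_of_nonneg fun i _ =>
        mul_nonneg hc (hA.inner_calcL_div_nonneg hl _), ← Finset.mul_sum]
      refine ENNReal.ofReal_le_ofReal (mul_le_mul_of_nonneg_left ?_ hc)
      have ht : Orthonormal ℝ (fun i : t => b i) := b.orthonormal.comp _ Subtype.val_injective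
      have := hA.sum_inner_calcL_div_le hl hN0 hN ht
      rwa [Finset.sum_coe_sort t
        (fun i => ⟪b i, calcL (covOp μ) (fun u => u / (u + l)) (b i)⟫)] at this

theorem lintegral_ofReal_inner_sq (hκ : 0 ≤ κ) (hK : BoundedKernel μ κ) (v : H) :
    ∫⁻ x, ENNReal.ofReal (⟪v, x⟫ ^ 2) ∂μ = ENNReal.ofReal ⟪covOp μ v, v⟫ := by
  have hL2 := hK.memLp hκ
  rw [inner_covOp hL2, ofReal_integral_eq_lintegral_ofReal (integrable_inner_mul_inner hL2 v v)
    (Eventually.of_forall fun x => mul_self_nonneg _)]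
  simp only [sq]

end WeightedTrace

/-! ### Exponential moments of the output -/

section NoiseMoments

variable {H : Type*} [NormedAddCommGroup H] [InnerProductSpace ℝ H] [CompleteSpace H]
  [TopologicalSpace.SeparableSpace H] [MeasurableSpace H] [BorelSpace H]
  {ρ : Measure (H × ℝ)} [IsProbabilityMeasure ρ] {κ l N M Q B : ℝ}

theorem exp_sub_one_sub_le {t : ℝ} (ht : 0 ≤ t) : Real.exp t - 1 - t ≤ t ^ 2 * Real.exp t := by
  have h1 : Real.exp t - 1 ≤ t * Real.exp t := by
    have h := Real.add_one_le_exp (-t)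
    have h2 := mul_le_mul_of_nonneg_right h (Real.exp_pos t).le
    rw [← Real.exp_add, neg_add_cancel, Real.exp_zero] at h2
    linarith
  have h3 := mul_le_mul_of_nonneg_left h1 ht
  nlinarith

/-- The bound for the mean of `exp (|y| / (2 M))` given the input, where the moment condition is
summed as a geometric series of ratio `1 / 4`. -/
def expMoment (M Q : ℝ) : ℝ := (2 + Q ^ 2 / M ^ 2) * (4 / 3)

theorem expMoment_pos (M Q : ℝ) : 0 < expMoment M Q := by
  unfold expMoment
  positivity

theorem lintegral_exp_abs_le (hM : 0 < M) (h : MomentCondition ρ M Q) : ∀ᵐ x ∂ρ.fst,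
    ∫⁻ y, ENNReal.ofReal (Real.exp (|y| / (2 * M))) ∂(ρ.condKernel x) ≤
      ENNReal.ofReal (expMoment M Q) := by
  filter_upwards [h] with x hx
  -- only even moments enter when `exp` is replaced by `2 cosh`
  set f : ℕ → ℝ → ℝ := fun k y => 2 * ((|y| / (2 * M)) ^ (2 * k) / ((2 * k).factorial : ℝ)) with hf
  have hf0 : ∀ k y, 0 ≤ f k y := fun k y => by positivity
  have h1 : ∀ y, ENNReal.ofReal (Real.exp (|y| / (2 * M))) ≤ ∑' k, ENNReal.ofReal (f k y) := by
    intro y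
    have hs := (Real.hasSum_cosh (|y| / (2 * M))).mul_left 2
    rw [← ENNReal.ofReal_tsum_of_nonneg (fun k => hf0 k y) hs.summable, hs.tsum_eq]
    refine ENNReal.ofReal_le_ofReal ?_
    rw [Real.cosh_eq]
    linarith [Real.exp_pos (-(|y| / (2 * M)))]
  have h2 : ∀ k, ∫⁻ y, ENNReal.ofReal (f k y) ∂(ρ.condKernel x) ≤
      ENNReal.ofReal ((2 + Q ^ 2 / M ^ 2) * (1 / 4) ^ k) := by
    intro k
    rcases k.eq_zero_or_pos with rfl | hk
    · simp only [hf, mul_zero, pow_zero, Nat.factorial_zero, Nat.cast_one, div_one, mul_one,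
        lintegral_const, measure_univ]
      refine ENNReal.ofReal_le_ofReal ?_
      linarith [show 0 ≤ Q ^ 2 / M ^ 2 by positivity]
    have hfac : (0 : ℝ) < ((2 * k).factorial : ℝ) := by positivity
    set c : ℝ := 2 / ((2 * M) ^ (2 * k) * ((2 * k).factorial : ℝ)) with hc
    have hc0 : 0 ≤ c := by positivity
    have hfc : ∀ y, f k y = c * |y| ^ (2 * k) := fun y => by
      rw [hf, hc]
      dsimp only
      rw [div_pow]
      field_simp
    simp only [hfc, ENNReal.ofReal_mul hc0]
    rw [lintegral_const_mul _ (by fun_prop)]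
    refine (mul_le_mul_right (hx (2 * k) (by omega)) _).trans ?_
    rw [← ENNReal.ofReal_mul hc0]
    refine ENNReal.ofReal_le_ofReal ?_
    have hpow : M ^ (2 * k) = M ^ (2 * k - 2) * M ^ 2 := by
      rw [← pow_add]
      congr 1
      omega
    have h4 : (2 : ℝ) ^ (2 * k) = 4 ^ k := by
      rw [pow_mul]
      norm_num
    have : c * (1 / 2 * ((2 * k).factorial : ℝ) * M ^ (2 * k - 2) * Q ^ 2) =
        Q ^ 2 / M ^ 2 * (1 / 4) ^ k := by
      rw [hc, mul_pow, hpow, h4, one_div_pow]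
      field_simp
    rw [this]
    gcongr
    linarith
  calc _ ≤ ∫⁻ y, ∑' k, ENNReal.ofReal (f k y) ∂(ρ.condKernel x) := lintegral_mono h1
    _ = ∑' k, ∫⁻ y, ENNReal.ofReal (f k y) ∂(ρ.condKernel x) :=
      lintegral_tsum fun k => by simp only [hf]; fun_prop
    _ ≤ ∑' k, ENNReal.ofReal ((2 + Q ^ 2 / M ^ 2) * (1 / 4) ^ k) := ENNReal.tsum_le_tsum h2
    _ = _ := by
      have hg := (hasSum_geometric_of_lt_one (by norm_num : (0 : ℝ) ≤ 1 / 4)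
        (by norm_num)).mul_left (2 + Q ^ 2 / M ^ 2)
      rw [← ENNReal.ofReal_tsum_of_nonneg (fun k => by positivity) hg.summable, hg.tsum_eq,
        expMoment]
      norm_num

theorem lintegral_exp_abs_lt_top (hM : 0 < M) (h : MomentCondition ρ M Q) :
    ∫⁻ z, ENNReal.ofReal (Real.exp (|z.2| / (2 * M))) ∂ρ ≤ ENNReal.ofReal (expMoment M Q) := by
  rw [← Measure.lintegral_condKernel (by fun_prop)]
  calc _ ≤ ∫⁻ _, ENNReal.ofReal (expMoment M Q) ∂ρ.fst := lintegral_mono_ae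
        (lintegral_exp_abs_le hM h)
    _ = _ := by simp

theorem abs_regFun_le (hM : 0 < M) (h : MomentCondition ρ M Q) :
    ∀ᵐ x ∂ρ.fst, |regFun ρ x| ≤ 2 * M * expMoment M Q := by
  filter_upwards [lintegral_exp_abs_le hM h] with x hx
  have h0 := enorm_integral_le_lintegral_enorm (μ := ρ.condKernel x) (fun y : ℝ => y)
  have h1 : ∫⁻ y, ‖y‖ₑ ∂(ρ.condKernel x) ≤ ENNReal.ofReal (2 * M * expMoment M Q) := by
    rw [ENNReal.ofReal_mul (by positivity)]
    refine le_trans ?_ (mul_le_mul_right hx _)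
    rw [← lintegral_const_mul _ (by fun_prop)]
    refine lintegral_mono fun y => ?_
    rw [← ENNReal.ofReal_mul (by positivity), ← ofReal_norm, Real.norm_eq_abs]
    refine ENNReal.ofReal_le_ofReal ?_
    have := Real.add_one_le_exp (|y| / (2 * M))
    rw [← div_le_iff₀' (by positivity)]
    linarith
  have h2 := h0.trans h1
  rw [← ofReal_norm] at h2
  have := (ENNReal.ofReal_le_ofReal_iff (mul_pos (by positivity) (expMoment_pos M Q)).le).1 h2
  exact this

theorem sub_sq_mul_exp_le (hM : 0 < M) (y c : ℝ) :
    (y - c) ^ 2 * Real.exp (|y| / (4 * M)) ≤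
      (64 * M ^ 2 + 2) * (1 + c ^ 2) * Real.exp (|y| / (2 * M)) := by
  set t := |y| / (4 * M) with ht
  have ht0 : 0 ≤ t := by positivity
  have h2 : Real.exp (|y| / (2 * M)) = Real.exp t * Real.exp t := by
    rw [← Real.exp_add, ht]
    congr 1
    field_simp
    ring
  have hy : y ^ 2 = 16 * M ^ 2 * t ^ 2 := by
    rw [ht, div_pow, sq_abs]
    field_simp
    norm_num
  have h3 : t ^ 2 ≤ 2 * Real.exp t := by
    linarith [Real.quadratic_le_exp_of_nonneg ht0]
  have h4 : 1 ≤ Real.exp t := Real.one_le_exp ht0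
  have h5 : (y - c) ^ 2 ≤ 2 * y ^ 2 + 2 * c ^ 2 := by nlinarith [sq_nonneg (y + c)]
  rw [h2, ← mul_assoc]
  refine mul_le_mul_of_nonneg_right ?_ (Real.exp_pos t).le
  have h6 : M ^ 2 * t ^ 2 ≤ M ^ 2 * (2 * Real.exp t) := by gcongr
  have h7 : 0 ≤ M ^ 2 * c ^ 2 * Real.exp t := by positivity
  have h8 : c ^ 2 * 1 ≤ c ^ 2 * Real.exp t := by gcongr
  nlinarith

end NoiseMoments

/-! ### Moments of the noise -/

section NoiseBound

variable {H : Type*} [NormedAddCommGroup H] [InnerProductSpace ℝ H] [CompleteSpace H]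
  [TopologicalSpace.SeparableSpace H] [MeasurableSpace H] [BorelSpace H]
  {ρ : Measure (H × ℝ)} [IsProbabilityMeasure ρ] {κ l N M Q B : ℝ}

theorem lintegral_ofReal_sq_Lp {X : Type*} [MeasurableSpace X] {μ : Measure X} (f : Lp ℝ 2 μ) :
    ∫⁻ x, ENNReal.ofReal (f x ^ 2) ∂μ = ENNReal.ofReal (‖f‖ ^ 2) := by
  have h := L2.integrable_inner (𝕜 := ℝ) f f
  rw [← real_inner_self_eq_norm_sq, L2.inner_def, ofReal_integral_eq_lintegral_ofReal h
    (Eventually.of_forall fun x => real_inner_self_nonneg)]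
  refine lintegral_congr fun x => ?_
  rw [real_inner_self_eq_norm_sq, Real.norm_eq_abs, sq_abs]

theorem coeFn_regFunLp (h : MomentCondition ρ M Q) : regFunLp ρ =ᵐ[ρ.fst] regFun ρ := by
  have h2 := memLp_regFun h
  rw [regFunLp, dif_pos h2]
  exact h2.coeFn_toLp

theorem inner_target_inclusion (w : H) :
    ⟪target ρ, inclusion ρ.fst w⟫ = ⟪regFunLp ρ, inclusion ρ.fst w⟫ := by
  have hmem : inclusion ρ.fst w ∈ (inclusion ρ.fst).range.topologicalClosure :=
    Submodule.le_topologicalClosure _ ⟨w, rfl⟩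
  rw [target, Submodule.inner_starProjection_left_eq_right,
    Submodule.starProjection_eq_self_iff.2 hmem]

/-- The approximation condition in terms of quadratic forms. -/
theorem lintegral_approx_le (hκ : 0 ≤ κ) (hK : BoundedKernel ρ.fst κ)
    (hm : MomentCondition ρ M Q) (hB : ApproxCondition ρ B) (v : H) :
    ∫⁻ x, ENNReal.ofReal ((target ρ x - regFun ρ x) ^ 2) * ENNReal.ofReal (⟪v, x⟫ ^ 2) ∂ρ.fst ≤
      ENNReal.ofReal (B ^ 2 * ⟪covOp ρ.fst v, v⟫) := by
  have hL : MemLp (fun x => target ρ x - regFun ρ x) 2 ρ.fst :=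
    (Lp.memLp (target ρ)).sub (memLp_regFun hm)
  have hw : Integrable (fun x => (target ρ x - regFun ρ x) ^ 2) ρ.fst := hL.integrable_sq
  have hb := hK.norm_le hκ
  have h1 := inner_integral_smul_rankOne hb hw v v
  have h2 : ⟪(∫ x, (target ρ x - regFun ρ x) ^ 2 • InnerProductSpace.rankOne ℝ x x ∂ρ.fst) v, v⟫ ≤
      B ^ 2 * ⟪covOp ρ.fst v, v⟫ := by
    have h3 := ((ContinuousLinearMap.le_def _ _).1 hB).inner_nonneg_left v
    rw [sub_apply, inner_sub_left, smul_apply, inner_smul_left] at h3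
    simpa using h3
  rw [h1] at h2
  have hint : Integrable (fun x => (target ρ x - regFun ρ x) ^ 2 * (⟪v, x⟫ * ⟪v, x⟫)) ρ.fst := by
    refine (hw.mul_const ((‖v‖ * κ) ^ 2)).mono'
      (hw.aestronglyMeasurable.mul (by fun_prop)) ?_
    filter_upwards [hb] with x hx
    rw [Real.norm_of_nonneg (mul_nonneg (sq_nonneg _) (mul_self_nonneg _)), ← sq, ← sq_abs ⟪v, x⟫]
    have : |⟪v, x⟫| ≤ ‖v‖ * κ := (abs_real_inner_le_norm _ _).trans (by gcongr)
    gcongr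
  refine le_trans (le_of_eq ?_) (ENNReal.ofReal_le_ofReal h2)
  rw [ofReal_integral_eq_lintegral_ofReal hint
    (Eventually.of_forall fun x => mul_nonneg (sq_nonneg _) (mul_self_nonneg _))]
  refine lintegral_congr fun x => ?_
  rw [← ENNReal.ofReal_mul (sq_nonneg _), ← sq]

/-- The second moments of the noise, weighted by `‖(A + l) ^ (-1/2) x‖²`. The function `⟪ω, x⟫` is
split into the approximation error of `ω`, the misfit of the target, and the regression function,
which is bounded. -/
theorem lintegral_one_add_sq_mul_le (hκ : 0 ≤ κ) (hK : BoundedKernel ρ.fst κ) (hM : 0 < M)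
    (hm : MomentCondition ρ M Q) (hB : ApproxCondition ρ B) (hl : 0 < l) (hN0 : 0 ≤ N)
    (hN : effDim (covOp ρ.fst) l ≤ ENNReal.ofReal N) (ω : H) :
    ∫⁻ x, ENNReal.ofReal ((1 + ⟪ω, x⟫ ^ 2) *
      ‖calcL (covOp ρ.fst) (fun u => (u + l) ^ (-(1 / 2) : ℝ)) x‖ ^ 2) ∂ρ.fst ≤
      ENNReal.ofReal ((1 + 3 * (2 * M * expMoment M Q) ^ 2 + 3 * B ^ 2) * N +
        3 * κ ^ 2 / l * ‖inclusion ρ.fst ω - target ρ‖ ^ 2) := by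
  have hA := posDiagonal_covOp hκ hK
  set W := calcL (covOp ρ.fst) (fun u => (u + l) ^ (-(1 / 2) : ℝ)) with hW
  set q := 2 * M * expMoment M Q with hq
  set f : Lp ℝ 2 ρ.fst := inclusion ρ.fst ω - target ρ with hf
  have hL : MemLp (fun x => target ρ x - regFun ρ x) 2 ρ.fst :=
    (Lp.memLp (target ρ)).sub (memLp_regFun hm)
  have h1 : ∫⁻ x, ENNReal.ofReal ((1 + 3 * q ^ 2)) * ENNReal.ofReal (‖W x‖ ^ 2) ∂ρ.fst ≤
      ENNReal.ofReal ((1 + 3 * q ^ 2) * N) :=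
    lintegral_mul_norm_calcL_le hκ hK hl hN0 hN aemeasurable_const (by positivity) fun v => by
      rw [lintegral_const_mul _ (by fun_prop), lintegral_ofReal_inner_sq hκ hK,
        ENNReal.ofReal_mul (by positivity)]
  have h2 : ∫⁻ x, ENNReal.ofReal 3 * ENNReal.ofReal ((target ρ x - regFun ρ x) ^ 2) *
      ENNReal.ofReal (‖W x‖ ^ 2) ∂ρ.fst ≤ ENNReal.ofReal (3 * B ^ 2 * N) :=
    lintegral_mul_norm_calcL_le hκ hK hl hN0 hN
      ((hL.aestronglyMeasurable.aemeasurable.pow_const 2).ennreal_ofReal.const_mul _)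
      (by positivity) fun v => by
        simp only [mul_assoc]
        rw [lintegral_const_mul' _ _ ENNReal.ofReal_ne_top, ENNReal.ofReal_mul (by norm_num)]
        gcongr
        exact lintegral_approx_le hκ hK hm hB v
  have h3 : ∫⁻ x, ENNReal.ofReal (3 * κ ^ 2 / l) * ENNReal.ofReal (f x ^ 2) ∂ρ.fst =
      ENNReal.ofReal (3 * κ ^ 2 / l * ‖f‖ ^ 2) := by
    rw [lintegral_const_mul' _ _ ENNReal.ofReal_ne_top, lintegral_ofReal_sq_Lp,
      ENNReal.ofReal_mul (by positivity)]
  have hWm : AEMeasurable (fun x => ENNReal.ofReal (‖W x‖ ^ 2)) ρ.fst := by fun_prop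
  have hpt : ∀ᵐ x ∂ρ.fst, ENNReal.ofReal ((1 + ⟪ω, x⟫ ^ 2) * ‖W x‖ ^ 2) ≤
      ENNReal.ofReal ((1 + 3 * q ^ 2)) * ENNReal.ofReal (‖W x‖ ^ 2) +
      ENNReal.ofReal 3 * ENNReal.ofReal ((target ρ x - regFun ρ x) ^ 2) *
        ENNReal.ofReal (‖W x‖ ^ 2) +
      ENNReal.ofReal (3 * κ ^ 2 / l) * ENNReal.ofReal (f x ^ 2) := by
    filter_upwards [hK.norm_le hκ, abs_regFun_le hM hm, inclusion_apply (hK.memLp hκ) ω,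
      Lp.coeFn_sub (inclusion ρ.fst ω) (target ρ)] with x hx hreg hinc hsub
    rw [← ENNReal.ofReal_mul (by positivity), ← ENNReal.ofReal_mul (by norm_num),
      ← ENNReal.ofReal_mul (by positivity), ← ENNReal.ofReal_mul (by positivity),
      ← ENNReal.ofReal_add (by positivity) (by positivity),
      ← ENNReal.ofReal_add (by positivity) (by positivity)]
    refine ENNReal.ofReal_le_ofReal ?_
    have hfx : f x = ⟪ω, x⟫ - target ρ x := by
      rw [hf, hsub, Pi.sub_apply, hinc]
    have hW2 : ‖W x‖ ^ 2 ≤ κ ^ 2 / l :=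
      (norm_calcL_rpow_neg_half_sq_le hA hl x).trans (by gcongr)
    have hr2 : regFun ρ x ^ 2 ≤ q ^ 2 := by
      rw [← sq_abs]
      exact pow_le_pow_left₀ (abs_nonneg _) hreg 2
    set r := regFun ρ x
    set t := target ρ x
    have hsq : ⟪ω, x⟫ ^ 2 ≤ 3 * (f x ^ 2 + (t - r) ^ 2 + r ^ 2) := by
      have : ⟪ω, x⟫ = f x + (t - r) + r := by rw [hfx]; ring
      rw [this]
      nlinarith [sq_nonneg (f x - (t - r)), sq_nonneg (f x - r), sq_nonneg ((t - r) - r)]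
    have h4 : f x ^ 2 * ‖W x‖ ^ 2 ≤ f x ^ 2 * (κ ^ 2 / l) := by gcongr
    have h5 : (1 + ⟪ω, x⟫ ^ 2) * ‖W x‖ ^ 2 ≤
        (1 + 3 * (f x ^ 2 + (t - r) ^ 2 + q ^ 2)) * ‖W x‖ ^ 2 := by
      gcongr
      linarith
    have h6 : 3 * κ ^ 2 / l * f x ^ 2 = 3 * (f x ^ 2 * (κ ^ 2 / l)) := by ring
    rw [h6]
    linarith
  refine (lintegral_mono_ae hpt).trans ?_
  have hm2 : AEMeasurable (fun x => ENNReal.ofReal 3 * ENNReal.ofReal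
      ((target ρ x - regFun ρ x) ^ 2) * ENNReal.ofReal (‖W x‖ ^ 2)) ρ.fst :=
    ((hL.aestronglyMeasurable.aemeasurable.pow_const 2).ennreal_ofReal.const_mul _).mul hWm
  have hm12 : AEMeasurable (fun x => ENNReal.ofReal (1 + 3 * q ^ 2) * ENNReal.ofReal (‖W x‖ ^ 2) +
      ENNReal.ofReal 3 * ENNReal.ofReal ((target ρ x - regFun ρ x) ^ 2) *
        ENNReal.ofReal (‖W x‖ ^ 2)) ρ.fst := (hWm.const_mul _).add hm2
  rw [lintegral_add_left' hm12, lintegral_add_left' (hWm.const_mul _), h3]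
  refine (add_le_add_left (add_le_add h1 h2) _).trans (le_of_eq ?_)
  rw [← ENNReal.ofReal_add (by positivity) (by positivity),
    ← ENNReal.ofReal_add (by positivity) (by positivity)]
  congr 1
  ring

theorem ae_norm_fst_le (hκ : 0 ≤ κ) (hK : BoundedKernel ρ.fst κ) : ∀ᵐ z ∂ρ, ‖z.1‖ ≤ κ := by
  have h := hK.norm_le hκ
  rwa [Measure.fst, ae_map_iff measurable_fst.aemeasurable
    (measurableSet_le (by fun_prop) measurable_const)] at h

/-- The mean of the noise is controlled by the approximation error of `ω`. -/
theorem integral_residual_inner_le (hκ : 0 ≤ κ) (hK : BoundedKernel ρ.fst κ)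
    (hm : MomentCondition ρ M Q) (hy : Integrable (fun z : H × ℝ => z.2) ρ) (ω v : H) :
    ∫ z, (z.2 - ⟪ω, z.1⟫) * ⟪v, z.1⟫ ∂ρ ≤
      ‖inclusion ρ.fst ω - target ρ‖ * ‖inclusion ρ.fst v‖ := by
  have hL2 := hK.memLp hκ
  have hb := ae_norm_fst_le hκ hK
  have hvb : ∀ᵐ z ∂ρ, ‖⟪v, z.1⟫‖ ≤ ‖v‖ * κ := by
    filter_upwards [hb] with z hz
    exact (norm_inner_le_norm _ _).trans (by gcongr)
  have hvm : AEStronglyMeasurable (fun z : H × ℝ => ⟪v, z.1⟫) ρ := by fun_prop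
  have hi1 : Integrable (fun z : H × ℝ => z.2 * ⟪v, z.1⟫) ρ :=
    hy.mul_bdd (c := ‖v‖ * κ) hvm hvb
  have hi2 : Integrable (fun z : H × ℝ => ⟪ω, z.1⟫ * ⟪v, z.1⟫) ρ := by
    have := integrable_inner_mul_inner hL2 ω v
    exact (integrable_map_measure this.aestronglyMeasurable measurable_fst.aemeasurable).1 this
  have h1 : ∫ z, z.2 * ⟪v, z.1⟫ ∂ρ = ⟪target ρ, inclusion ρ.fst v⟫ := by
    rw [inner_target_inclusion, real_inner_comm, inner_inclusion hL2,
      ← Measure.integral_condKernel hi1]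
    refine integral_congr_ae ?_
    filter_upwards [coeFn_regFunLp hm] with x hx
    rw [hx, regFun, integral_mul_const, mul_comm]
  have h2 : ∫ z, ⟪ω, z.1⟫ * ⟪v, z.1⟫ ∂ρ = ⟪inclusion ρ.fst ω, inclusion ρ.fst v⟫ := by
    rw [← inner_adjoint_comp_self, ← covOp, inner_covOp hL2, Measure.fst,
      integral_map measurable_fst.aemeasurable (by fun_prop)]
  simp only [sub_mul]
  rw [integral_sub hi1 hi2, h1, h2, ← inner_sub_left, norm_sub_rev]
  exact real_inner_le_norm _ _

end NoiseBound

/-! ### The tail of the noise -/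

section NoiseTail

variable {H : Type*} [NormedAddCommGroup H] [InnerProductSpace ℝ H] [CompleteSpace H]
  [TopologicalSpace.SeparableSpace H] [MeasurableSpace H] [BorelSpace H]
  {ρ : Measure (H × ℝ)} [IsProbabilityMeasure ρ] {κ l N M Q B : ℝ}

theorem integrable_exp_abs (hM : 0 < M) (hm : MomentCondition ρ M Q) :
    Integrable (fun z : H × ℝ => Real.exp (|z.2| / (2 * M))) ρ := by
  refine ⟨by fun_prop, ?_⟩
  rw [hasFiniteIntegral_iff_ofReal (Eventually.of_forall fun z => (Real.exp_pos _).le)]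
  exact (lintegral_exp_abs_lt_top hM hm).trans_lt ENNReal.ofReal_lt_top

theorem integrable_output (hM : 0 < M) (hm : MomentCondition ρ M Q) :
    Integrable (fun z : H × ℝ => z.2) ρ := by
  refine ((integrable_exp_abs hM hm).const_mul (2 * M)).mono' (by fun_prop)
    (Eventually.of_forall fun z => ?_)
  rw [Real.norm_eq_abs, ← div_le_iff₀' (by positivity)]
  linarith [Real.add_one_le_exp (|z.2| / (2 * M))]

/-- The weighted second moments of the noise remain under control after multiplication with an
exponential of the output: the output is integrated first, given the input. -/
theorem lintegral_noise_le (hκ : 0 ≤ κ) (hK : BoundedKernel ρ.fst κ) (hM : 0 < M)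
    (hm : MomentCondition ρ M Q) (hB : ApproxCondition ρ B) (hl : 0 < l) (hN0 : 0 ≤ N)
    (hN : effDim (covOp ρ.fst) l ≤ ENNReal.ofReal N) (ω : H) :
    ∫⁻ z, ENNReal.ofReal ((1 + ⟪ω, z.1⟫ ^ 2) *
      ‖calcL (covOp ρ.fst) (fun u => (u + l) ^ (-(1 / 2) : ℝ)) z.1‖ ^ 2) *
        ENNReal.ofReal (Real.exp (|z.2| / (2 * M))) ∂ρ ≤
      ENNReal.ofReal (((1 + 3 * (2 * M * expMoment M Q) ^ 2 + 3 * B ^ 2) * N +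
        3 * κ ^ 2 / l * ‖inclusion ρ.fst ω - target ρ‖ ^ 2) * expMoment M Q) := by
  have h1 := lintegral_one_add_sq_mul_le hκ hK hM hm hB hl hN0 hN ω
  rw [← Measure.lintegral_condKernel (by fun_prop), ENNReal.ofReal_mul (by positivity)]
  refine le_trans ?_ (mul_le_mul_left h1 _)
  rw [← lintegral_mul_const _ (by fun_prop)]
  refine lintegral_mono_ae ?_
  filter_upwards [lintegral_exp_abs_le hM hm] with x hx
  rw [lintegral_const_mul _ (by fun_prop)]
  gcongr

/-- Tail bound for the noise `S_x* y - T_x ω`, in the norm dual to the form `A + l`. The exponential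
tail bound for sums is applied to the vectors `θ (y - ⟪ω, x⟫) (A + l) ^ (-1/2) x`; the scale `θ` is
at the disposal of the caller. -/
theorem measure_noise_le (hκ : 0 ≤ κ) (hK : BoundedKernel ρ.fst κ) (hM : 0 < M)
    (hm : MomentCondition ρ M Q) (hB : ApproxCondition ρ B) (hl : 0 < l) (hN0 : 0 ≤ N)
    (hN : effDim (covOp ρ.fst) l ≤ ENNReal.ofReal N) (ω : H) {n : ℕ} (hn : 1 ≤ n) {θ c d V : ℝ}
    (hθ : 0 < θ) (hθ1 : θ * (κ * l ^ (-(1 / 2) : ℝ)) ≤ 1 / (4 * M))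
    (hθ2 : θ * (κ * l ^ (-(1 / 2) : ℝ)) * (κ * ‖ω‖) ≤ c)
    (hd : ‖inclusion ρ.fst ω - target ρ‖ ≤ d)
    (hV : (1 + 3 * (2 * M * expMoment M Q) ^ 2 + 3 * B ^ 2) * N + 3 * κ ^ 2 / l * d ^ 2 ≤ V)
    (u : ℝ) :
    (Measure.pi fun _ : Fin n => ρ) {z | ¬ ∀ v, ⟪empAdj z - empCov z ω, v⟫ ≤
      (d + θ * (Real.exp c * (64 * M ^ 2 + 2) * expMoment M Q * V) + u / (n * θ)) *
        √(⟪covOp ρ.fst v, v⟫ + l * ‖v‖ ^ 2)} ≤ ENNReal.ofReal (2 * Real.exp (-u)) := by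
  have hn0 : (0 : ℝ) < n := by exact_mod_cast hn
  have hA := posDiagonal_covOp hκ hK
  have hbA := norm_covOp_apply_le hκ hK
  have hWb := hA.specBound_add_rpow_neg hl (p := 1 / 2) (by norm_num)
  set W := calcL (covOp ρ.fst) (fun u => (u + l) ^ (-(1 / 2) : ℝ)) with hW
  have hWs : ∀ v w, ⟪W v, w⟫ = ⟪v, W w⟫ := hA.inner_calcL hWb
  have hE0 := expMoment_pos M Q
  have hd0 : 0 ≤ d := (norm_nonneg _).trans hd
  have hV0 : 0 ≤ V := le_trans (by positivity) hV
  set ξ : H × ℝ → H := fun z => (θ * (z.2 - ⟪ω, z.1⟫)) • W z.1 with hξ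
  have := secondCountableTopology_of_separable (H := H)
  have hξm : Measurable ξ := by
    have h1 : Measurable fun z : H × ℝ => θ * (z.2 - ⟪ω, z.1⟫) := by fun_prop
    exact h1.smul (W.continuous.measurable.comp measurable_fst)
  have hb := ae_norm_fst_le hκ hK
  have hξn : ∀ᵐ z ∂ρ, ‖ξ z‖ ≤ |z.2| / (4 * M) + c := by
    filter_upwards [hb] with z hz
    have h1 : ‖W z.1‖ ≤ κ * l ^ (-(1 / 2) : ℝ) := by
      refine (hA.norm_calcL_le hWb (by positivity) z.1).trans ?_
      rw [mul_comm]
      gcongr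
    have h2 : |z.2 - ⟪ω, z.1⟫| ≤ |z.2| + κ * ‖ω‖ := by
      refine (abs_sub _ _).trans (add_le_add le_rfl ((abs_real_inner_le_norm _ _).trans ?_))
      rw [mul_comm]
      gcongr
    calc ‖ξ z‖ = θ * |z.2 - ⟪ω, z.1⟫| * ‖W z.1‖ := by
          rw [hξ]
          dsimp only
          rw [norm_smul, Real.norm_eq_abs, abs_mul, abs_of_pos hθ]
      _ ≤ θ * (|z.2| + κ * ‖ω‖) * (κ * l ^ (-(1 / 2) : ℝ)) := by gcongr
      _ = θ * (κ * l ^ (-(1 / 2) : ℝ)) * |z.2| + θ * (κ * l ^ (-(1 / 2) : ℝ)) * (κ * ‖ω‖) := by ring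
      _ ≤ 1 / (4 * M) * |z.2| + c := by gcongr
      _ = _ := by ring
  have hexp : ∀ᵐ z ∂ρ, Real.exp ‖ξ z‖ ≤ Real.exp c * Real.exp (|z.2| / (4 * M)) := by
    filter_upwards [hξn] with z hz
    rw [← Real.exp_add]
    exact Real.exp_le_exp.2 (by linarith)
  have hexp2 : ∀ y : ℝ, Real.exp (|y| / (4 * M)) ≤ Real.exp (|y| / (2 * M)) := fun y => by
    refine Real.exp_le_exp.2 ?_
    gcongr
    norm_num
  have hi : Integrable (fun z => Real.exp ‖ξ z‖) ρ := by
    refine ((integrable_exp_abs hM hm).const_mul (Real.exp c)).mono'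
      (Real.measurable_exp.comp hξm.norm).aestronglyMeasurable ?_
    filter_upwards [hexp] with z hz
    rw [Real.norm_of_nonneg (Real.exp_pos _).le]
    exact hz.trans (mul_le_mul_of_nonneg_left (hexp2 _) (Real.exp_pos c).le)
  have hm' : ∀ s, ∫ z, ⟪s, ξ z⟫ ∂ρ ≤ θ * d * ‖s‖ := fun s => by
    have h1 : ∀ z : H × ℝ, ⟪s, ξ z⟫ = θ * ((z.2 - ⟪ω, z.1⟫) * ⟪W s, z.1⟫) := fun z => by
      rw [hξ]
      dsimp only
      rw [inner_smul_right, hWs]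
      ring
    simp only [h1]
    rw [integral_const_mul, mul_assoc]
    refine mul_le_mul_of_nonneg_left ?_ hθ.le
    refine (integral_residual_inner_le hκ hK hm (integrable_output hM hm) ω (W s)).trans ?_
    have h2 : ‖inclusion ρ.fst (W s)‖ ≤ ‖s‖ := by
      refine (sq_le_sq₀ (norm_nonneg _) (norm_nonneg _)).1 ?_
      rw [← real_inner_self_eq_norm_sq, ← inner_adjoint_comp_self, ← covOp,
        hA.inner_apply_calcL_rpow_neg_half hl]
      exact hA.inner_calcL_div_le hl s
    gcongr
  have hv : ∫ z, (Real.exp ‖ξ z‖ - 1 - ‖ξ z‖) ∂ρ ≤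
      θ ^ 2 * (Real.exp c * (64 * M ^ 2 + 2) * expMoment M Q * V) := by
    have hnn : ∀ z, 0 ≤ Real.exp ‖ξ z‖ - 1 - ‖ξ z‖ := fun z => by
      linarith [Real.add_one_le_exp ‖ξ z‖]
    rw [integral_eq_lintegral_of_nonneg_ae (Eventually.of_forall hnn)
      (by fun_prop : Measurable fun z => Real.exp ‖ξ z‖ - 1 - ‖ξ z‖).aestronglyMeasurable]
    refine ENNReal.toReal_le_of_le_ofReal (by positivity) ?_
    have hpt : ∀ᵐ z ∂ρ, ENNReal.ofReal (Real.exp ‖ξ z‖ - 1 - ‖ξ z‖) ≤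
        ENNReal.ofReal (θ ^ 2 * (Real.exp c * (64 * M ^ 2 + 2))) *
          (ENNReal.ofReal ((1 + ⟪ω, z.1⟫ ^ 2) * ‖W z.1‖ ^ 2) *
            ENNReal.ofReal (Real.exp (|z.2| / (2 * M)))) := by
      filter_upwards [hexp] with z hz
      rw [← ENNReal.ofReal_mul (by positivity), ← ENNReal.ofReal_mul (by positivity)]
      refine ENNReal.ofReal_le_ofReal ((exp_sub_one_sub_le (norm_nonneg _)).trans ?_)
      have h2 : ‖ξ z‖ ^ 2 = θ ^ 2 * (z.2 - ⟪ω, z.1⟫) ^ 2 * ‖W z.1‖ ^ 2 := by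
        rw [hξ]
        dsimp only
        rw [norm_smul, Real.norm_eq_abs, mul_pow, sq_abs, mul_pow]
      rw [h2]
      calc _ ≤ θ ^ 2 * (z.2 - ⟪ω, z.1⟫) ^ 2 * ‖W z.1‖ ^ 2 *
            (Real.exp c * Real.exp (|z.2| / (4 * M))) := by gcongr
        _ = θ ^ 2 * Real.exp c * ‖W z.1‖ ^ 2 *
            ((z.2 - ⟪ω, z.1⟫) ^ 2 * Real.exp (|z.2| / (4 * M))) := by ring
        _ ≤ θ ^ 2 * Real.exp c * ‖W z.1‖ ^ 2 *
            ((64 * M ^ 2 + 2) * (1 + ⟪ω, z.1⟫ ^ 2) * Real.exp (|z.2| / (2 * M))) := by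
          exact mul_le_mul_of_nonneg_left (sub_sq_mul_exp_le hM _ _) (by positivity)
        _ = _ := by ring
    refine (lintegral_mono_ae hpt).trans ?_
    rw [lintegral_const_mul' _ _ ENNReal.ofReal_ne_top]
    refine (mul_le_mul_right (lintegral_noise_le hκ hK hM hm hB hl hN0 hN ω) _).trans ?_
    rw [← ENNReal.ofReal_mul (by positivity)]
    refine ENNReal.ofReal_le_ofReal ?_
    calc _ ≤ θ ^ 2 * (Real.exp c * (64 * M ^ 2 + 2)) * (V * expMoment M Q) := by
          gcongr
          refine le_trans ?_ hV
          gcongr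
      _ = _ := by ring
  have hmain := measure_lt_norm_sum_le hξm hi hm' (by positivity) hv (by positivity) n u
  refine le_trans (measure_mono ?_) hmain
  intro z hz
  by_contra hcon
  refine hz fun v => ?_
  have hcon' : ‖∑ i, ξ (z i)‖ ≤ n * (θ * d + θ ^ 2 * (Real.exp c * (64 * M ^ 2 + 2) *
      expMoment M Q * V)) + u := not_lt.1 hcon
  -- the form norm of `v` is the norm of `x = (A + l) ^ (1/2) v`, and `v = W x`
  set x := calcL (covOp ρ.fst) (fun u => (u + l) ^ (1 / 2 : ℝ)) v with hx
  have hp1 : SpecBound (covOp ρ.fst) (fun u => (u + l) ^ (1 / 2 : ℝ)) ((κ ^ 2 + l) ^ (1 / 2 : ℝ)) :=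
    hA.specBound hbA fun u hu => PosDiagonal.abs_add_rpow_le hl hu (by norm_num)
  have hWx : W x = v := by
    refine hA.ext fun σ => ?_
    rw [hW, hx, hA.eigenProj_calcL hWb, hA.eigenProj_calcL hp1, smul_smul]
    by_cases h0 : eigenProj (covOp ρ.fst) σ = 0
    · rw [h0, zero_apply, smul_zero]
    · have := hA.eigenvalue_nonneg h0
      rw [← Real.rpow_add (by positivity)]
      norm_num
  have hxn : √(⟪covOp ρ.fst v, v⟫ + l * ‖v‖ ^ 2) = ‖x‖ := by
    rw [← hA.norm_sq_calcL_add_rpow hbA hl v, Real.sqrt_sq (norm_nonneg _)]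
  have hzx : ⟪empAdj z - empCov z ω, v⟫ = (n * θ)⁻¹ * ⟪∑ i, ξ (z i), x⟫ := by
    rw [inner_sub_left, inner_empAdj, inner_empCov, ← mul_sub, ← Finset.sum_sub_distrib, sum_inner,
      mul_inv, mul_assoc, Finset.mul_sum (a := θ⁻¹)]
    congr 1
    refine Finset.sum_congr rfl fun i _ => ?_
    rw [hξ]
    dsimp only
    rw [inner_smul_left, hWs, hWx, real_inner_comm v, conj_trivial]
    field_simp
  rw [hzx, hxn]
  have hnθ : 0 < n * θ := by positivity
  calc (n * θ)⁻¹ * ⟪∑ i, ξ (z i), x⟫ ≤ (n * θ)⁻¹ * (‖∑ i, ξ (z i)‖ * ‖x‖) := by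
        gcongr
        exact real_inner_le_norm _ _
    _ ≤ (n * θ)⁻¹ * ((n * (θ * d + θ ^ 2 * (Real.exp c * (64 * M ^ 2 + 2) *
      expMoment M Q * V)) + u) * ‖x‖) := by gcongr
    _ = _ := by field_simp

end NoiseTail

/-! ### Comparison of spectral components -/

section Comparison

variable {H V : Type*} [NormedAddCommGroup H] [InnerProductSpace ℝ H] [CompleteSpace H]
  [NormedAddCommGroup V] [InnerProductSpace ℝ V] [CompleteSpace V]
  {A : H →L[ℝ] H} {L : V →L[ℝ] V} {g : ℝ → ℝ} {f : V} {x : H} {C : ℝ}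

/-- Spectral components of vectors in two different spaces can be compared one by one. -/
theorem PosDiagonal.norm_le_mul_norm (hA : PosDiagonal A) (hL : PosDiagonal L) (hC : 0 ≤ C)
    (h : ∀ σ, ‖eigenProj L σ f‖ ≤ C * ‖eigenProj A σ x‖) : ‖f‖ ≤ C * ‖x‖ := by
  refine (sq_le_sq₀ (norm_nonneg _) (by positivity)).1 ?_
  rw [mul_pow]
  refine hasSum_le (fun σ => ?_) (hL.hasSum_norm_sq f) ((hA.hasSum_norm_sq x).mul_left (C ^ 2))
  rw [← mul_pow]
  exact pow_le_pow_left₀ (norm_nonneg _) (h σ) 2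

theorem PosDiagonal.inDomain_of_le (hA : PosDiagonal A) (hL : PosDiagonal L)
    (h : ∀ σ, |g σ| * ‖eigenProj L σ f‖ ≤ C * ‖eigenProj A σ x‖) : InDomain L g f := by
  rw [hL.inDomain_iff]
  refine .of_nonneg_of_le (fun σ => by positivity) (fun σ => ?_)
    ((hA.hasSum_norm_sq x).mul_left (C ^ 2)).summable
  rw [← sq_abs (g σ), ← mul_pow, ← mul_pow]
  exact pow_le_pow_left₀ (by positivity) (h σ) 2

theorem PosDiagonal.norm_specCalc_le (hA : PosDiagonal A) (hL : PosDiagonal L) (hC : 0 ≤ C)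
    (h : ∀ σ, |g σ| * ‖eigenProj L σ f‖ ≤ C * ‖eigenProj A σ x‖) :
    ‖specCalc L g f‖ ≤ C * ‖x‖ := by
  refine hA.norm_le_mul_norm hL hC fun σ => ?_
  rw [hL.eigenProj_specCalc (hA.inDomain_of_le hL h), norm_smul, Real.norm_eq_abs]
  exact h σ

end Comparison

/-! ### The source condition and the approximation error -/

section Source

variable {H : Type*} [NormedAddCommGroup H] [InnerProductSpace ℝ H] [CompleteSpace H]
  [TopologicalSpace.SeparableSpace H] [MeasurableSpace H] [BorelSpace H]
  {ρ : Measure (H × ℝ)} [IsProbabilityMeasure ρ] {κ ζ R a c l : ℝ}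

theorem eigenProj_intOp_inclusion (hκ : 0 ≤ κ) (hK : BoundedKernel ρ.fst κ) (σ : ℝ) (v : H) :
    eigenProj (intOp ρ.fst) σ (inclusion ρ.fst v) =
      inclusion ρ.fst (eigenProj (covOp ρ.fst) σ v) :=
  eigenProj_comp_adjoint_apply (posDiagonal_covOp hκ hK) σ v

theorem norm_sq_inclusion_eigenProj (σ : ℝ) (v : H) :
    ‖inclusion ρ.fst (eigenProj (covOp ρ.fst) σ v)‖ ^ 2 =
      σ * ‖eigenProj (covOp ρ.fst) σ v‖ ^ 2 :=
  norm_apply_eigenProj (inclusion ρ.fst) σ v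

theorem norm_inclusion_eigenProj {σ : ℝ} (hσ : 0 ≤ σ) (v : H) :
    ‖inclusion ρ.fst (eigenProj (covOp ρ.fst) σ v)‖ =
      σ ^ (1 / 2 : ℝ) * ‖eigenProj (covOp ρ.fst) σ v‖ := by
  rw [← sq_eq_sq₀ (norm_nonneg _) (by positivity), norm_sq_inclusion_eigenProj, mul_pow,
    ← Real.rpow_natCast (σ ^ _), ← Real.rpow_mul hσ]
  norm_num

/-- The target is orthogonal to the kernel of the integral operator. -/
theorem eigenProj_zero_target : eigenProj (intOp ρ.fst) 0 (target ρ) = 0 := by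
  set p := eigenProj (intOp ρ.fst) 0 (target ρ) with hp
  have h1 : intOp ρ.fst p = 0 := by rw [hp, apply_eigenProj, zero_smul]
  have h2 : ContinuousLinearMap.adjoint (inclusion ρ.fst) p = 0 := by
    have h3 : ⟪intOp ρ.fst p, p⟫ = 0 := by rw [h1, inner_zero_left]
    rw [intOp, inner_self_comp_adjoint] at h3
    exact inner_self_eq_zero.1 h3
  -- `p` is orthogonal to the range of the inclusion, hence to the target
  have h3 : p ∈ (inclusion ρ.fst).range.topologicalClosureᗮ := by
    rw [Submodule.orthogonal_closure, Submodule.mem_orthogonal]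
    rintro _ ⟨w, rfl⟩
    rw [ContinuousLinearMap.coe_coe, ← ContinuousLinearMap.adjoint_inner_right, h2,
      inner_zero_right]
  have h4 : ⟪target ρ, p⟫ = 0 := (Submodule.mem_orthogonal _ _).1 h3 _
    (Submodule.starProjection_apply_mem _ _)
  rw [← inner_self_eq_zero (𝕜 := ℝ)]
  nth_rw 1 [hp]
  rw [inner_eigenProj_left, hp, eigenProj_idem, ← hp, h4]

/-- The source condition transported to `H`: the target is `c A ^ (ζ - 1/2) h`, read in `L²`, for
an `h` orthogonal to the kernel of `A` with norm at most `R`. -/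
structure IsSource (ρ : Measure (H × ℝ)) [IsProbabilityMeasure ρ] (ζ R c : ℝ) (h : H) : Prop where
  norm_le : ‖h‖ ≤ R
  eigenProj_zero : eigenProj (covOp ρ.fst) 0 h = 0
  eigenProj_target : ∀ σ, eigenProj (intOp ρ.fst) σ (target ρ) =
    (c * σ ^ (ζ - 1 / 2)) • inclusion ρ.fst (eigenProj (covOp ρ.fst) σ h)

theorem exists_source (hκ : 0 ≤ κ) (hK : BoundedKernel ρ.fst κ) (hζ : 0 ≤ ζ)
    (hS : SourceCondition ρ (fun u => c * u ^ ζ) R) :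
    ∃ h : H, IsSource ρ ζ R c h := by
  have hA := posDiagonal_covOp hκ hK
  have hL := posDiagonal_intOp hκ hK
  obtain ⟨g, hgR, hg⟩ := hS
  obtain ⟨h, hhg, hh0, hh⟩ := exists_polar (S := inclusion ρ.fst) hA g
  refine ⟨h, hhg.trans hgR, hh0, fun σ => ?_⟩
  have hbd : SpecBound (intOp ρ.fst) (fun u => c * u ^ ζ) (|c| * (κ ^ 2) ^ ζ) :=
    hL.specBound (norm_intOp_apply_le hκ hK) fun u hu => by
      rw [abs_mul]
      gcongr
      exact PosDiagonal.abs_rpow_le hu hζ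
  have h1 : eigenProj (intOp ρ.fst) σ (target ρ) = (c * σ ^ ζ) • eigenProj (intOp ρ.fst) σ g := by
    rw [hg, hL.eigenProj_specCalc (hL.inDomain_of_bound hbd g)]
  have h2 : inclusion ρ.fst (eigenProj (covOp ρ.fst) σ h) =
      σ ^ (1 / 2 : ℝ) • eigenProj (intOp ρ.fst) σ g := hh σ
  rcases eq_or_ne σ 0 with rfl | hσ
  · rw [eigenProj_zero_target, h2, Real.zero_rpow (by norm_num : (1 / 2 : ℝ) ≠ 0), zero_smul,
      smul_zero]
  by_cases h0 : eigenProj (intOp ρ.fst) σ = 0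
  · rw [h2, h0, zero_apply, zero_apply, smul_zero, smul_zero]
  have hσ0 : 0 < σ := (hL.eigenvalue_nonneg h0).lt_of_ne' hσ
  rw [h1, h2, smul_smul, mul_assoc, ← Real.rpow_add hσ0]
  norm_num

/-- The spectral cut-off `ω_l = 1_{A ≥ l} c A ^ (ζ - 1/2) h` at level `l` of the (possibly formal)
solution of `S ω = f_H` represented by `h`. -/
def cutSol (ρ : Measure (H × ℝ)) [IsProbabilityMeasure ρ] (ζ c l : ℝ) (h : H) : H :=
  calcL (covOp ρ.fst) (cutPow c (ζ - 1 / 2) l) h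

theorem abs_cutPow_le {s u b : ℝ} (hc : 0 ≤ c) (hc1 : c ≤ 1) (hl : 0 < l)
    (hu : u ∈ Set.Icc 0 b) : |cutPow c s l u| ≤ b ^ max s 0 * l ^ min s 0 := by
  rcases le_total 0 s with hs | hs
  · rw [max_eq_left hs, min_eq_right hs, Real.rpow_zero, mul_one]
    exact abs_cutPow_le_of_nonneg hc hc1 hs hu
  · rw [max_eq_right hs, min_eq_left hs, Real.rpow_zero, one_mul]
    exact abs_cutPow_le_of_nonpos hc hc1 hs hl

theorem specBound_cutPow {s : ℝ} (hκ : 1 ≤ κ) (hK : BoundedKernel ρ.fst κ) (hc : 0 ≤ c)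
    (hc1 : c ≤ 1) (hl : 0 < l) :
    SpecBound (covOp ρ.fst) (cutPow c s l) ((κ ^ 2) ^ max s 0 * l ^ min s 0) :=
  (posDiagonal_covOp (by linarith) hK).specBound (norm_covOp_apply_le (by linarith) hK)
    fun _ hu => abs_cutPow_le hc hc1 hl hu

theorem norm_cutSol_le {h : H} (hκ : 1 ≤ κ) (hK : BoundedKernel ρ.fst κ) (hc : 0 ≤ c) (hc1 : c ≤ 1)
    (hl : 0 < l) (hh : ‖h‖ ≤ R) :
    ‖cutSol ρ ζ c l h‖ ≤ (κ ^ 2) ^ max (ζ - 1 / 2) 0 * l ^ min (ζ - 1 / 2) 0 * R := by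
  refine ((posDiagonal_covOp (by linarith) hK).norm_calcL_le
    (specBound_cutPow hκ hK hc hc1 hl) (by positivity) h).trans ?_
  gcongr

/-- The scalar inequality behind the approximation error of the spectral cut-off. -/
theorem rpow_mul_abs_cutPow_sub_le {σ p s : ℝ} (hc : 0 ≤ c) (hc1 : c ≤ 1) (hl : 0 < l)
    (hσ : 0 < σ) (hps : 0 ≤ p + s) :
    σ ^ p * |cutPow c s l σ - c * σ ^ s| ≤ l ^ (p + s) := by
  unfold cutPow
  split_ifs with h
  · rw [sub_self, abs_zero, mul_zero]
    positivity
  · push Not at h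
    rw [zero_sub, abs_neg, abs_of_nonneg (by positivity), mul_left_comm, ← Real.rpow_add hσ]
    calc c * σ ^ (p + s) ≤ 1 * l ^ (p + s) := by gcongr
      _ = _ := one_mul _

/-- The approximation error of the spectral cut-off, componentwise. -/
theorem rpow_neg_mul_norm_eigenProj_le {h : H} (hκ : 1 ≤ κ) (hK : BoundedKernel ρ.fst κ)
    (hc : 0 ≤ c) (hc1 : c ≤ 1) (hl : 0 < l) (hh : IsSource ρ ζ R c h)
    (haζ : a ≤ ζ) (σ : ℝ) :
    |σ ^ (-a)| * ‖eigenProj (intOp ρ.fst) σ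
      (inclusion ρ.fst (cutSol ρ ζ c l h) - target ρ)‖ ≤
      l ^ (ζ - a) * ‖eigenProj (covOp ρ.fst) σ h‖ := by
  have hκ0 : 0 ≤ κ := by linarith
  have hA := posDiagonal_covOp hκ0 hK
  rw [map_sub, eigenProj_intOp_inclusion hκ0 hK, cutSol,
    hA.eigenProj_calcL (specBound_cutPow hκ hK hc hc1 hl), hh.eigenProj_target, map_smul,
    ← sub_smul, norm_smul, Real.norm_eq_abs]
  by_cases h0 : eigenProj (covOp ρ.fst) σ = 0
  · simp [h0]
  rcases (hA.eigenvalue_nonneg h0).eq_or_lt with rfl | hσ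
  · simp [hh.eigenProj_zero]
  rw [norm_inclusion_eigenProj hσ.le, abs_of_pos (Real.rpow_pos_of_pos hσ _)]
  have h1 := rpow_mul_abs_cutPow_sub_le (p := 1 / 2 - a) (s := ζ - 1 / 2) hc hc1 hl hσ (by linarith)
  have h2 : σ ^ (-a) * σ ^ (1 / 2 : ℝ) = σ ^ (1 / 2 - a) := by
    rw [← Real.rpow_add hσ]
    congr 1
    ring
  have h3 : 1 / 2 - a + (ζ - 1 / 2) = ζ - a := by ring
  rw [h3] at h1
  calc _ = σ ^ (-a) * σ ^ (1 / 2 : ℝ) *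
        |cutPow c (ζ - 1 / 2) l σ - c * σ ^ (ζ - 1 / 2)| * ‖eigenProj (covOp ρ.fst) σ h‖ := by ring
    _ ≤ _ := by
      rw [h2]
      gcongr

/-- The approximation error of the spectral cut-off in `L²`. -/
theorem norm_inclusion_cutSol_sub_le {h : H} (hκ : 1 ≤ κ) (hK : BoundedKernel ρ.fst κ)
    (hc : 0 ≤ c) (hc1 : c ≤ 1) (hl : 0 < l) (hζ : 0 ≤ ζ) (hh : IsSource ρ ζ R c h) :
    ‖inclusion ρ.fst (cutSol ρ ζ c l h) - target ρ‖ ≤ l ^ ζ * R := by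
  have hκ0 : 0 ≤ κ := by linarith
  refine ((posDiagonal_covOp hκ0 hK).norm_le_mul_norm (posDiagonal_intOp hκ0 hK)
    (by positivity) fun σ => ?_).trans (mul_le_mul_of_nonneg_left hh.norm_le (by positivity))
  have := rpow_neg_mul_norm_eigenProj_le hκ hK hc hc1 hl hh hζ σ
  simpa using this

theorem specBound_rpow_half_sub (hκ : 0 ≤ κ) (hK : BoundedKernel ρ.fst κ) (ha2 : a ≤ 1 / 2) :
    SpecBound (covOp ρ.fst) (fun u => u ^ (1 / 2 - a)) ((κ ^ 2) ^ (1 / 2 - a)) :=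
  (posDiagonal_covOp hκ hK).specBound (norm_covOp_apply_le hκ hK)
    fun _ hu => PosDiagonal.abs_rpow_le hu (by linarith)

/-- `L ^ (-a) S` is dominated by `A ^ (1/2 - a)`, componentwise. -/
theorem rpow_neg_mul_norm_inclusion_le (hκ : 0 ≤ κ) (hK : BoundedKernel ρ.fst κ)
    (ha2 : a ≤ 1 / 2) (v : H) (σ : ℝ) :
    |σ ^ (-a)| * ‖eigenProj (intOp ρ.fst) σ (inclusion ρ.fst v)‖ ≤
      1 * ‖eigenProj (covOp ρ.fst) σ (calcL (covOp ρ.fst) (fun u => u ^ (1 / 2 - a)) v)‖ := by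
  have hA := posDiagonal_covOp hκ hK
  rw [eigenProj_intOp_inclusion hκ hK, hA.eigenProj_calcL (specBound_rpow_half_sub hκ hK ha2),
    one_mul, norm_smul, Real.norm_eq_abs]
  by_cases h0 : eigenProj (covOp ρ.fst) σ = 0
  · simp [h0]
  have hσ0 := hA.eigenvalue_nonneg h0
  rw [norm_inclusion_eigenProj hσ0]
  rcases hσ0.eq_or_lt with rfl | hσ
  · rw [Real.zero_rpow (by norm_num : (1 / 2 : ℝ) ≠ 0), zero_mul, mul_zero]
    positivity
  rw [abs_of_pos (Real.rpow_pos_of_pos hσ _), abs_of_pos (Real.rpow_pos_of_pos hσ _), ← mul_assoc,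
    ← Real.rpow_add hσ]
  refine le_of_eq ?_
  congr 2
  ring

/-- The error `S w - f_H` of any `w` lies in the domain of `L ^ (-a)`; its norm is at most the
distance of `w` to the spectral cut-off plus the approximation error of the latter. -/
theorem inDomain_rpow_neg {h : H} (hκ : 1 ≤ κ) (hK : BoundedKernel ρ.fst κ)
    (hc : 0 ≤ c) (hc1 : c ≤ 1) (hl : 0 < l) (hh : IsSource ρ ζ R c h)
    (haζ : a ≤ ζ) (ha2 : a ≤ 1 / 2) (w : H) :
    InDomain (intOp ρ.fst) (fun u => u ^ (-a)) (inclusion ρ.fst w - target ρ) ∧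
    ‖specCalc (intOp ρ.fst) (fun u => u ^ (-a)) (inclusion ρ.fst w - target ρ)‖ ≤
      ‖calcL (covOp ρ.fst) (fun u => u ^ (1 / 2 - a)) (w - cutSol ρ ζ c l h)‖ +
        l ^ (ζ - a) * R := by
  have hκ0 : 0 ≤ κ := by linarith
  have hA := posDiagonal_covOp hκ0 hK
  have hL := posDiagonal_intOp hκ0 hK
  set x := cutSol ρ ζ c l h
  have h1 := rpow_neg_mul_norm_inclusion_le hκ0 hK ha2 (w - x)
  have h2 := rpow_neg_mul_norm_eigenProj_le hκ hK hc hc1 hl hh haζ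
  have hd1 := hA.inDomain_of_le hL h1
  have hd2 := hA.inDomain_of_le hL h2
  have hsplit : inclusion ρ.fst w - target ρ =
      inclusion ρ.fst (w - x) + (inclusion ρ.fst x - target ρ) := by
    rw [map_sub]
    abel
  have hfun : (fun σ : ℝ => σ ^ (-a) • eigenProj (intOp ρ.fst) σ (inclusion ρ.fst w - target ρ)) =
      fun σ => σ ^ (-a) • eigenProj (intOp ρ.fst) σ (inclusion ρ.fst (w - x)) +
        σ ^ (-a) • eigenProj (intOp ρ.fst) σ (inclusion ρ.fst x - target ρ) := by
    ext1 σ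
    rw [hsplit, map_add, smul_add]
  refine ⟨?_, ?_⟩
  · rw [InDomain, hfun]
    exact hd1.add hd2
  · rw [specCalc, hfun, Summable.tsum_add hd1 hd2]
    refine (norm_add_le _ _).trans (add_le_add ?_ ?_)
    · exact (hA.norm_specCalc_le hL zero_le_one h1).trans (one_mul _).le
    · exact (hA.norm_specCalc_le hL (by positivity) h2).trans
        (mul_le_mul_of_nonneg_left hh.norm_le (by positivity))

/-- In the case `ζ ≥ 1/2`, the target is attained at `c A ^ (ζ - 1/2) h`, which is the solution of
minimal norm because `h` is orthogonal to the kernel; the distance to it is estimated through the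
spectral cut-off. -/
theorem exists_minimal_solution {h : H} (hκ : 1 ≤ κ) (hK : BoundedKernel ρ.fst κ)
    (hc : 0 ≤ c) (hc1 : c ≤ 1) (hh : IsSource ρ ζ R c h) (hζ : 1 / 2 ≤ ζ) (haζ : a ≤ ζ)
    (ha2 : a ≤ 1 / 2) :
    ∃ ωH : H, inclusion ρ.fst ωH = target ρ ∧
      (∀ w : H, inclusion ρ.fst w = target ρ → ‖ωH‖ ≤ ‖w‖) ∧
      ∀ l, 0 < l → ∀ w : H,
        ‖specCalc (covOp ρ.fst) (fun u => u ^ (1 / 2 - a)) (w - ωH)‖ ≤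
          ‖calcL (covOp ρ.fst) (fun u => u ^ (1 / 2 - a)) (w - cutSol ρ ζ c l h)‖ +
            l ^ (ζ - a) * R := by
  have hκ0 : 0 ≤ κ := by linarith
  have hA := posDiagonal_covOp hκ0 hK
  have hL := posDiagonal_intOp hκ0 hK
  have hbd : SpecBound (covOp ρ.fst) (fun u => c * u ^ (ζ - 1 / 2))
      (|c| * (κ ^ 2) ^ (ζ - 1 / 2)) :=
    hA.specBound (norm_covOp_apply_le hκ0 hK) fun u hu => by
      rw [abs_mul]
      gcongr
      exact PosDiagonal.abs_rpow_le hu (by linarith)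
  have hs := specBound_rpow_half_sub hκ0 hK ha2
  set ωH := calcL (covOp ρ.fst) (fun u => c * u ^ (ζ - 1 / 2)) h with hωH
  have hSω : inclusion ρ.fst ωH = target ρ := hL.ext fun σ => by
    rw [eigenProj_intOp_inclusion hκ0 hK, hωH, hA.eigenProj_calcL hbd, map_smul,
      hh.eigenProj_target]
  refine ⟨ωH, hSω, fun w hw => ?_, fun l hl w => ?_⟩
  · refine hA.norm_le_norm fun σ => ?_
    by_cases hσ : σ = 0
    · rw [hσ, hωH, hA.eigenProj_calcL hbd, hh.eigenProj_zero, smul_zero, norm_zero]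
      exact norm_nonneg _
    · have h1 : covOp ρ.fst w = covOp ρ.fst ωH := by
        rw [covOp, ContinuousLinearMap.comp_apply, ContinuousLinearMap.comp_apply, hw, hSω]
      have h2 := congrArg (eigenProj (covOp ρ.fst) σ) h1
      rw [hA.eigenProj_apply, hA.eigenProj_apply] at h2
      rw [smul_right_injective H hσ h2]
  · rw [← hA.calcL_apply hs]
    have hsplit : w - ωH = (w - cutSol ρ ζ c l h) + (cutSol ρ ζ c l h - ωH) := by abel
    rw [hsplit, map_add]
    refine (norm_add_le _ _).trans (add_le_add le_rfl ?_)
    refine (hA.norm_le_mul_norm hA (by positivity) fun σ => ?_).trans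
      (mul_le_mul_of_nonneg_left hh.norm_le (Real.rpow_nonneg hl.le (ζ - a)))
    rw [hA.eigenProj_calcL hs, map_sub, cutSol, hωH, hA.eigenProj_calcL hbd,
      hA.eigenProj_calcL (specBound_cutPow hκ hK hc hc1 hl), ← sub_smul, smul_smul, norm_smul,
      Real.norm_eq_abs, abs_mul]
    by_cases h0 : eigenProj (covOp ρ.fst) σ = 0
    · simp [h0]
    rcases (hA.eigenvalue_nonneg h0).eq_or_lt with rfl | hσ
    · simp [hh.eigenProj_zero]
    have h1 := rpow_mul_abs_cutPow_sub_le (p := 1 / 2 - a) (s := ζ - 1 / 2) hc hc1 hl hσ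
      (by linarith)
    rw [show 1 / 2 - a + (ζ - 1 / 2) = ζ - a by ring] at h1
    rw [abs_of_pos (Real.rpow_pos_of_pos hσ _)]
    gcongr

end Source

/-! ### The rate of the noise -/

section NoiseRate

variable {κ cγ γ ζ B M Q R : ℝ}

/-- The rate of the noise at the level `l = regParam ζ γ n` is `l ^ ζ`, with a constant that does
not depend on the distribution. -/
theorem exists_measure_noise_le (hκ : 1 ≤ κ) (hcγ : 0 < cγ) (hγ : 0 < γ) (hζ : 0 ≤ ζ) (hM : 0 < M)
    (hR : 0 ≤ R) :
    ∃ Cη, 0 ≤ Cη ∧ ∀ {H : Type*} [NormedAddCommGroup H] [InnerProductSpace ℝ H] [CompleteSpace H]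
      [TopologicalSpace.SeparableSpace H] [MeasurableSpace H] [BorelSpace H]
      (ρ : Measure (H × ℝ)) [IsProbabilityMeasure ρ], BoundedKernel ρ.fst κ →
      MomentCondition ρ M Q → ApproxCondition ρ B → CapacityCondition ρ.fst cγ γ →
      ∀ (c : ℝ) (h : H), 0 ≤ c → c ≤ 1 → IsSource ρ ζ R c h → ∀ n : ℕ, 1 ≤ n → ∀ u : ℝ, 1 ≤ u →
      ∃ η, 0 ≤ η ∧ η ≤ Cη * u * regParam ζ γ n ^ ζ ∧
      (Measure.pi fun _ : Fin n => ρ) {z | ¬ ∀ v,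
        ⟪empAdj z - empCov z (cutSol ρ ζ c (regParam ζ γ n) h), v⟫ ≤
          η * √(⟪covOp ρ.fst v, v⟫ + regParam ζ γ n * ‖v‖ ^ 2)} ≤
        ENNReal.ofReal (2 * Real.exp (-u)) := by
  have hκ0 : 0 < κ := by linarith
  -- `θ = c0 * l ^ (max 1 (2 ζ + γ) - ζ)` is of order `1 / (n l ^ ζ)`: the fluctuation `u / (n θ)`
  -- is then of the order of the approximation error, and the vectors stay in the range where
  -- exponential moments exist because `max 1 (2 ζ + γ) - ζ ≥ 1 / 2`
  set c0 := 1 / (4 * M * κ) with hc0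
  have hc00 : 0 < c0 := by positivity
  set e := κ * ((κ ^ 2) ^ max (ζ - 1 / 2) 0 * R) / (4 * M) with he
  set D := Real.exp e * (64 * M ^ 2 + 2) * expMoment M Q with hD
  have hD0 : 0 ≤ D := by
    have := expMoment_pos M Q
    positivity
  set v1 := (1 + 3 * (2 * M * expMoment M Q) ^ 2 + 3 * B ^ 2) * cγ with hv1
  have hv10 : 0 ≤ v1 := by positivity
  refine ⟨R + c0 * (D * (v1 + 3 * κ ^ 2 * R ^ 2)) + 1 / c0, by positivity, ?_⟩
  intro H _ _ _ _ _ _ ρ _ hK hm hB hcap c h hc hc1 hh n hn u hu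
  have hn0 : (0 : ℝ) < n := by exact_mod_cast hn
  set l := regParam ζ γ n with hl
  have hl0 : 0 < l := regParam_pos hn
  have hl1 : l ≤ 1 := regParam_le_one hn
  set m := max 1 (2 * ζ + γ) with hmd
  have hm1 : 1 ≤ m := le_max_left _ _
  have hm2 : 2 * ζ + γ ≤ m := le_max_right _ _
  have hln : l ^ m = (n : ℝ)⁻¹ := by
    rw [hl, regParam, ← Real.rpow_mul hn0.le, ← hmd, ← Real.rpow_neg_one]
    congr 1
    field_simp
  have hmono : ∀ {p q : ℝ}, q ≤ p → l ^ p ≤ l ^ q := fun h =>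
    Real.rpow_le_rpow_of_exponent_ge hl0 hl1 h
  have hle1 : ∀ {p : ℝ}, 0 ≤ p → l ^ p ≤ 1 := fun h => Real.rpow_le_one hl0.le hl1 h
  set θ := c0 * l ^ (m - ζ) with hθ
  have hθ0 : 0 < θ := by positivity
  have hθκ : θ * (κ * l ^ (-(1 / 2) : ℝ)) = l ^ (m - ζ - 1 / 2) / (4 * M) := by
    rw [hθ, hc0, show m - ζ - 1 / 2 = (m - ζ) + -(1 / 2) by ring, Real.rpow_add hl0]
    field_simp
  have hθ1 : θ * (κ * l ^ (-(1 / 2) : ℝ)) ≤ 1 / (4 * M) := by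
    rw [hθκ]
    gcongr
    exact hle1 (by linarith)
  set ω := cutSol ρ ζ c l h with hω
  have hωn : ‖ω‖ ≤ (κ ^ 2) ^ max (ζ - 1 / 2) 0 * l ^ min (ζ - 1 / 2) 0 * R :=
    norm_cutSol_le hκ hK hc hc1 hl0 hh.norm_le
  have hθ2 : θ * (κ * l ^ (-(1 / 2) : ℝ)) * (κ * ‖ω‖) ≤ e := by
    rw [hθκ]
    calc l ^ (m - ζ - 1 / 2) / (4 * M) * (κ * ‖ω‖)
        ≤ l ^ (m - ζ - 1 / 2) / (4 * M) *
          (κ * ((κ ^ 2) ^ max (ζ - 1 / 2) 0 * l ^ min (ζ - 1 / 2) 0 * R)) := by gcongr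
      _ = (l ^ (m - ζ - 1 / 2) * l ^ min (ζ - 1 / 2) 0) * e := by rw [he]; ring
      _ ≤ 1 * e := by
        gcongr
        rw [← Real.rpow_add hl0]
        refine hle1 ?_
        rcases min_choice (ζ - 1 / 2) 0 with h | h <;> rw [h] <;> linarith
      _ = e := one_mul e
  have hd : ‖inclusion ρ.fst ω - target ρ‖ ≤ l ^ ζ * R :=
    norm_inclusion_cutSol_sub_le hκ hK hc hc1 hl0 hζ hh
  have hsq : (l ^ ζ) ^ 2 = l ^ (2 * ζ) := by
    rw [← Real.rpow_natCast, ← Real.rpow_mul hl0.le]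
    congr 1
    push_cast
    ring
  have hV : (1 + 3 * (2 * M * expMoment M Q) ^ 2 + 3 * B ^ 2) * (cγ * l ^ (-γ)) +
      3 * κ ^ 2 / l * (l ^ ζ * R) ^ 2 ≤ v1 * l ^ (-γ) + 3 * κ ^ 2 * R ^ 2 * l ^ (2 * ζ - 1) := by
    refine le_of_eq ?_
    rw [mul_pow (l ^ ζ) R, hsq, Real.rpow_sub_one hl0.ne', hv1]
    ring
  have hmain := measure_noise_le hκ0.le hK hM hm hB hl0 (by positivity) (hcap l hl0) ω hn hθ0 hθ1
    hθ2 hd hV u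
  refine ⟨_, ?_, ?_, hmain⟩
  · have := expMoment_pos M Q
    positivity
  · have h1 : l ^ (m - ζ) * l ^ (-γ) ≤ l ^ ζ := by
      rw [← Real.rpow_add hl0]
      exact hmono (by linarith)
    have h2 : l ^ (m - ζ) * l ^ (2 * ζ - 1) ≤ l ^ ζ := by
      rw [← Real.rpow_add hl0]
      exact hmono (by linarith)
    have h3 : u / (n * θ) = u * (1 / c0 * l ^ ζ) := by
      have h4 : l ^ ζ * l ^ (m - ζ) = (n : ℝ)⁻¹ := by
        rw [← Real.rpow_add hl0, ← hln]
        congr 1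
        ring
      rw [hθ, div_eq_iff (by positivity)]
      calc u = u * (n * (n : ℝ)⁻¹) * (1 / c0 * c0) := by field_simp
        _ = _ := by rw [← h4]; ring
    have h5 : θ * (D * (v1 * l ^ (-γ) + 3 * κ ^ 2 * R ^ 2 * l ^ (2 * ζ - 1))) ≤
        c0 * (D * (v1 + 3 * κ ^ 2 * R ^ 2)) * l ^ ζ := by
      calc _ = c0 * (D * (v1 * (l ^ (m - ζ) * l ^ (-γ)) +
            3 * κ ^ 2 * R ^ 2 * (l ^ (m - ζ) * l ^ (2 * ζ - 1)))) := by rw [hθ]; ring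
        _ ≤ c0 * (D * (v1 * l ^ ζ + 3 * κ ^ 2 * R ^ 2 * l ^ ζ)) := by gcongr
        _ = _ := by ring
    have h6 : 0 ≤ (R + c0 * (D * (v1 + 3 * κ ^ 2 * R ^ 2))) * l ^ ζ := by positivity
    rw [h3]
    have h7 := mul_le_mul_of_nonneg_right hu h6
    have h8 : (0 : ℝ) ≤ 1 / c0 * l ^ ζ := by positivity
    linarith

end NoiseRate

/-! ### The tail of the estimation error -/

section CoreTail

variable {κ cγ γ ζ τ B M Q R E F a : ℝ}

/-- The inputs of a sample are a sample of the marginal distribution. -/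
theorem measure_pi_fst_le {H : Type*} [MeasurableSpace H] {ρ : Measure (H × ℝ)}
    [IsProbabilityMeasure ρ] {n : ℕ} (S : Set (Fin n → H)) :
    (Measure.pi fun _ : Fin n => ρ) {z | (fun i => (z i).1) ∈ S} ≤
      (Measure.pi fun _ : Fin n => ρ.fst) S := by
  have h : (Measure.pi fun _ : Fin n => ρ).map (fun z i => (z i).1) =
      Measure.pi fun _ => ρ.fst := by
    rw [Measure.pi_map_pi fun _ => measurable_fst.aemeasurable]
    rfl
  rw [← h]
  exact Measure.le_map_apply
    (measurable_pi_lambda _ fun i => measurable_fst.comp (measurable_pi_apply i)).aemeasurable S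

/-- The covariance operator is dominated by the empirical one, at the level `regParam`. -/
theorem exists_measure_form_le (hκ : 1 ≤ κ) (hcγ : 0 < cγ) (hγ : 0 < γ) (ζ : ℝ) :
    ∃ K0, 1 ≤ K0 ∧ ∀ {H : Type*} [NormedAddCommGroup H] [InnerProductSpace ℝ H] [CompleteSpace H]
      [TopologicalSpace.SeparableSpace H] [MeasurableSpace H] [BorelSpace H]
      (μ : Measure H) [IsProbabilityMeasure μ], BoundedKernel μ κ → CapacityCondition μ cγ γ →
      ∀ n : ℕ, 1 ≤ n → ∀ u : ℝ, 1 ≤ u →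
      (Measure.pi fun _ : Fin n => μ) {x | ¬ ∀ v, ⟪covOp μ v, v⟫ ≤
        2 * ((n : ℝ)⁻¹ * ∑ i, ⟪v, x i⟫ ^ 2) +
          K0 * logFactor ζ γ n * u * regParam ζ γ n * ‖v‖ ^ 2} ≤
        ENNReal.ofReal (Real.exp (-u)) := by
  have hκ0 : 0 < κ := by linarith
  obtain ⟨K0, hK1, hK0⟩ := exists_le_mul_regParam ζ hγ (1 + |Real.log cγ|) (by positivity)
    (by positivity : 0 < 40 * Real.exp 1 * κ ^ 2)
  refine ⟨K0, hK1, ?_⟩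
  intro H _ _ _ _ _ _ μ _ hK hcap n hn u hu
  have hl0 : 0 < regParam ζ γ n := regParam_pos hn
  have hl1 : regParam ζ γ n ≤ 1 := regParam_le_one hn
  have hL := one_le_logFactor (ζ := ζ) (γ := γ) (n := n)
  have hfac : 1 ≤ K0 * logFactor ζ γ n * u :=
    one_le_mul_of_one_le_of_one_le (one_le_mul_of_one_le_of_one_le hK1 hL) hu
  set l := K0 * logFactor ζ γ n * u * regParam ζ γ n with hl
  have hll : regParam ζ γ n ≤ l := le_mul_of_one_le_left hl0.le hfac
  have hlpos : 0 < l := hl0.trans_le hll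
  refine measure_not_form_le hκ0 hK hlpos (by positivity : 0 < cγ * l ^ (-γ)) (hcap l hlpos) hn
    (by linarith) (le_trans ?_ (hK0 n hn u hu))
  have hlog0 : 0 ≤ Real.log (regParam ζ γ n)⁻¹ := Real.log_nonneg ((one_le_inv₀ hl0).2 hl1)
  have hlog : Real.log (cγ * l ^ (-γ)) ≤ |Real.log cγ| + γ * Real.log (regParam ζ γ n)⁻¹ := by
    rw [Real.log_mul hcγ.ne' (by positivity), Real.log_rpow hlpos, Real.log_inv]
    have h1 := Real.log_le_log hl0 hll
    nlinarith [le_abs_self (Real.log cγ)]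
  have : max 0 (Real.log (cγ * l ^ (-γ))) ≤ |Real.log cγ| + γ * Real.log (regParam ζ γ n)⁻¹ :=
    max_le (by positivity) hlog
  refine mul_le_mul_of_nonneg_left ?_ (by positivity)
  linarith

/-- The tail of the error of the estimator, compared with the spectral cut-off: outside three
exceptional events the deterministic error bound applies, with the noise level `η = O(u l ^ ζ)` and
the comparison constant `2 K0 ℓ u` of the forms, where `ℓ` is the logarithmic factor. -/
theorem exists_measure_error_le (hκ : 1 ≤ κ) (hcγ : 0 < cγ) (hγ : 0 < γ)
    (hτ : 1 ≤ τ) (hζ : 0 ≤ ζ) (hζτ : ζ ≤ τ) (hM : 0 < M) (hR : 0 ≤ R) (hE : 0 < E)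
    (ha : 0 ≤ a) (ha2 : a ≤ 1 / 2) :
    ∃ C, 0 ≤ C ∧ ∀ {H : Type*} [NormedAddCommGroup H] [InnerProductSpace ℝ H] [CompleteSpace H]
      [TopologicalSpace.SeparableSpace H] [MeasurableSpace H] [BorelSpace H]
      (ρ : Measure (H × ℝ)) [IsProbabilityMeasure ρ], BoundedKernel ρ.fst κ →
      MomentCondition ρ M Q → ApproxCondition ρ B → CapacityCondition ρ.fst cγ γ →
      ∀ (c : ℝ) (h : H), 0 ≤ c → c ≤ 1 → IsSource ρ ζ R c h → ∀ n : ℕ, 1 ≤ n → ∀ g : ℝ → ℝ,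
      FilterBound (κ ^ 2) τ E F (regParam ζ γ n) g → ∀ u : ℝ, 1 ≤ u →
      (Measure.pi fun _ : Fin n => ρ) {z | ¬ ‖calcL (covOp ρ.fst) (fun u => u ^ (1 / 2 - a))
        (estimator g z - cutSol ρ ζ c (regParam ζ γ n) h)‖ ≤
          C * (regParam ζ γ n ^ (ζ - a) * logFactor ζ γ n ^ (1 - a) * u ^ (2 - a))} ≤
        ENNReal.ofReal ((3 + cγ) * Real.exp (-u)) := by
  have hκ0 : 0 < κ := by linarith
  obtain ⟨K0, hK01, hform⟩ := exists_measure_form_le hκ hcγ hγ ζ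
  obtain ⟨Cη, hCη, hnoise⟩ := exists_measure_noise_le (κ := κ) (γ := γ) (B := B) (Q := Q) hκ hcγ hγ
    hζ hM hR
  have hb1 : 1 ≤ κ ^ 2 := one_le_pow₀ hκ
  set C1 := 2 * E * Cη + 2 ^ (τ + 1) * max F 1 * ((1 + 16 * κ ^ 2) *
    (1 + ⌊ζ - 1 / 2⌋₊ * (κ ^ 2) ^ (⌊ζ - 1 / 2⌋₊ + 1))) * R with hC1
  have hC10 : 0 ≤ C1 := by positivity
  refine ⟨C1 * (2 * K0) ^ (1 - a), by positivity, ?_⟩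
  intro H _ _ _ _ _ _ ρ _ hK hm hB hcap c h hc hc1 hh n hn g hg u hu
  obtain ⟨η, hη0, hηC, hηP⟩ := hnoise ρ hK hm hB hcap c h hc hc1 hh n hn u hu
  have hn0 : (0 : ℝ) < n := by exact_mod_cast hn
  have hn1 : (1 : ℝ) ≤ n := by exact_mod_cast hn
  have hA := posDiagonal_covOp hκ0.le hK
  have hl0 : 0 < regParam ζ γ n := regParam_pos hn
  have hl1 : regParam ζ γ n ≤ 1 := regParam_le_one hn
  have hL1 := one_le_logFactor (ζ := ζ) (γ := γ) (n := n)
  have hfP := hform ρ.fst hK hcap n hn u hu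
  have hdP := measure_not_abs_formDev_le hκ0 hK (by positivity : 0 < cγ * (κ ^ 2) ^ (-γ))
    (hcap (κ ^ 2) (by positivity)) hn hu
  have hae : ∀ᵐ z ∂(Measure.pi fun _ : Fin n => ρ), ∀ i, ‖(z i).1‖ ≤ κ :=
    ae_all_iff.2 fun i => (Measure.quasiMeasurePreserving_eval (fun _ : Fin n => ρ) i).ae
      (ae_norm_fst_le hκ0.le hK)
  set l := regParam ζ γ n with hl
  set L := logFactor ζ γ n with hL
  -- the exceptional events: the form comparison, the distance of the operators, the noise
  set S1 := {x : Fin n → H | ¬ ∀ v, ⟪covOp ρ.fst v, v⟫ ≤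
        2 * ((n : ℝ)⁻¹ * ∑ i, ⟪v, x i⟫ ^ 2) + K0 * L * u * l * ‖v‖ ^ 2} with hS1
  set S2 := {x : Fin n → H | (∀ i, ‖x i‖ ≤ κ) ∧ ¬ ∀ v, |formDev ρ.fst x v| ≤
      16 * κ ^ 2 * √(u / n) * ‖v‖ ^ 2} with hS2
  set S3 := {z : Fin n → H × ℝ | ¬ ∀ v, ⟪empAdj z - empCov z (cutSol ρ ζ c l h), v⟫ ≤
          η * √(⟪covOp ρ.fst v, v⟫ + l * ‖v‖ ^ 2)} with hS3
  have hexp0 := Real.exp_pos (-u)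
  calc _ ≤ (Measure.pi fun _ : Fin n => ρ) ({z | (fun i => (z i).1) ∈ S1} ∪
        {z | (fun i => (z i).1) ∈ S2} ∪ S3) := by
        refine measure_mono_ae ?_
        filter_upwards [hae] with z hz hbad
        by_contra hcon
        refine hbad ?_
        have hcon' : z ∉ {z | (fun i => (z i).1) ∈ S1} ∪ {z | (fun i => (z i).1) ∈ S2} ∪ S3 := hcon
        simp only [Set.mem_union, not_or] at hcon'
        obtain ⟨⟨h1, h2⟩, h3⟩ := hcon'
        have h1' : ∀ v, ⟪covOp ρ.fst v, v⟫ ≤ 2 * ((n : ℝ)⁻¹ * ∑ i, ⟪v, (z i).1⟫ ^ 2) +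
            K0 * L * u * l * ‖v‖ ^ 2 := not_not.1 h1
        have h2' : ∀ v, |formDev ρ.fst (fun i => (z i).1) v| ≤
            16 * κ ^ 2 * √(u / n) * ‖v‖ ^ 2 := by
          by_contra h4
          exact h2 ⟨hz, h4⟩
        have h3' := not_not.1 h3
        have hBform : ∀ v, ⟪empCov z v, v⟫ = (n : ℝ)⁻¹ * ∑ i, ⟪v, (z i).1⟫ ^ 2 := fun v => by
          rw [inner_empCov]
          simp only [sq]
        have hBd := posDiagonal_empCov z
        have hBb := norm_empCov_apply_le hκ0.le hz
        have hfac : 1 ≤ K0 * L * u :=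
          one_le_mul_of_one_le_of_one_le (one_le_mul_of_one_le_of_one_le hK01 hL1) hu
        have hKK : ∀ v, ⟪covOp ρ.fst v, v⟫ + l * ‖v‖ ^ 2 ≤
            (2 * K0 * L * u) * (⟪empCov z v, v⟫ + l * ‖v‖ ^ 2) := fun v => by
          have h5 := h1' v
          rw [← hBform] at h5
          have h6 : 0 ≤ l * ‖v‖ ^ 2 := by positivity
          have h7 := hBd.nonneg v
          nlinarith [mul_le_mul_of_nonneg_right hfac h6, mul_le_mul_of_nonneg_right hfac h7]
        -- for `ζ ≥ 1` the deviation `n ^ (-1/2)` is smaller than `l` and `l ^ (ζ - 1/2)`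
        have hDD : 1 ≤ ζ → (∀ v, ‖covOp ρ.fst v - empCov z v‖ ≤ 16 * κ ^ 2 * √(u / n) * ‖v‖) ∧
            16 * κ ^ 2 * √(u / n) ≤ 16 * κ ^ 2 * u * l ∧
            16 * κ ^ 2 * √(u / n) ≤ 16 * κ ^ 2 * u * l ^ (ζ - 1 / 2) := fun hζ1 => by
          have hm : max 1 (2 * ζ + γ) = 2 * ζ + γ := max_eq_right (by linarith)
          have hsq : √(u / n) ≤ u * (n : ℝ) ^ (-(1 / 2) : ℝ) := by
            rw [Real.sqrt_div (by linarith), Real.rpow_neg hn0.le, ← Real.sqrt_eq_rpow,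
              div_eq_mul_inv]
            gcongr
            rw [Real.sqrt_le_left (by linarith)]
            nlinarith
          have hle : ∀ p : ℝ, p / (2 * ζ + γ) ≤ 1 / 2 → √(u / n) ≤ u * l ^ p := fun p hp => by
            refine hsq.trans (mul_le_mul_of_nonneg_left ?_ (by linarith))
            rw [hl, regParam, hm, ← Real.rpow_mul hn0.le]
            refine Real.rpow_le_rpow_of_exponent_le hn1 ?_
            rw [neg_mul, neg_le_neg_iff, one_div_mul_eq_div]
            exact hp
          refine ⟨fun v => ?_, ?_, ?_⟩
          · have h8 := norm_apply_le_of_abs_inner_le (T := covOp ρ.fst - empCov z)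
              (fun v w => by
                rw [sub_apply, sub_apply, inner_sub_left, inner_sub_right, hA.symm, hBd.symm])
              (D := 16 * κ ^ 2 * √(u / n)) (fun v => by
                refine le_trans (le_of_eq ?_) (h2' v)
                rw [sub_apply, inner_sub_left, hBform, abs_sub_comm, formDev]) v
            rwa [sub_apply] at h8
          · have := hle 1 (by rw [div_le_iff₀ (by linarith)]; linarith)
            rw [Real.rpow_one] at this
            rw [mul_assoc _ u]
            gcongr
          · have := hle (ζ - 1 / 2) (by rw [div_le_iff₀ (by linarith)]; linarith)
            rw [mul_assoc _ u]
            gcongr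
        have hfin := hA.norm_calcL_error_le hBd hb1 (norm_covOp_apply_le hκ0.le hK) hBb hl0 hg hE.le
          (by nlinarith : 1 ≤ 2 * K0 * L * u) hu hKK (by positivity : 0 ≤ 16 * κ ^ 2)
          (by positivity : 0 ≤ 16 * κ ^ 2 * √(u / n)) hDD hζτ hτ hc hc1 (ω := cutSol ρ ζ c l h)
          (h := h) (y := empAdj z) rfl hη0 hηC h3' ha ha2
        rw [estimator_eq_calcL hκ0.le hz hl0 hE.le hg]
        refine hfin.trans ?_
        have hup : u * u ^ (1 - a) = u ^ (2 - a) := by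
          have hu0 : 0 < u := by linarith
          nth_rw 1 [← Real.rpow_one u]
          rw [← Real.rpow_add hu0]
          congr 1
          ring
        calc _ ≤ C1 * (u * (2 * K0 * L * u) ^ (1 - a) * l ^ (ζ - a)) := by
              gcongr
              rw [hC1]
              gcongr
              exact hh.norm_le
          _ = _ := by
            rw [Real.mul_rpow (by positivity) (by linarith), Real.mul_rpow (by positivity)
              (by linarith), ← hup]
            ring
    _ ≤ ENNReal.ofReal (Real.exp (-u)) +
        ENNReal.ofReal (cγ * (κ ^ 2) ^ (-γ) * Real.exp (-u)) +
        ENNReal.ofReal (2 * Real.exp (-u)) := by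
      refine (measure_union_le _ _).trans (add_le_add ((measure_union_le _ _).trans
        (add_le_add ?_ ?_)) hηP)
      · exact (measure_pi_fst_le S1).trans hfP
      · exact (measure_pi_fst_le S2).trans hdP
    _ ≤ _ := by
      rw [← ENNReal.ofReal_add (by positivity) (by positivity),
        ← ENNReal.ofReal_add (by positivity) (by positivity)]
      refine ENNReal.ofReal_le_ofReal ?_
      have : (κ ^ 2) ^ (-γ) ≤ 1 := Real.rpow_le_one_of_one_le_of_nonpos hb1 (by linarith)
      nlinarith [mul_le_mul_of_nonneg_left this hcγ.le]

end CoreTail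

/-! ### Tails, moments and almost sure bounds -/

section Tail

variable {Ω : Type*} [MeasurableSpace Ω] {P : Measure Ω}

/-- Moments from a tail of exponential type, by summation over the levels `u = 1, 2, …`. The
function `X` need not be measurable. -/
theorem lintegral_pow_le_of_tail [IsProbabilityMeasure P] {X : Ω → ℝ} {D : ℝ} (hD : 0 < D)
    (hX : ∀ ω, 0 ≤ X ω)
    (h : ∀ u : ℝ, 1 ≤ u → P {ω | ¬ X ω ≤ D * u ^ 2} ≤ ENNReal.ofReal (Real.exp (-u))) (q : ℕ) :
    ∫⁻ ω, ENNReal.ofReal (X ω) ^ q ∂P ≤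
      ENNReal.ofReal (D ^ q *
        (1 + ∑' k : ℕ, ((k : ℝ) + 2) ^ (2 * q) * Real.exp (-((k : ℝ) + 1)))) := by
  set S : ℕ → Set Ω := fun k => {ω | ¬ X ω ≤ D * ((k : ℝ) + 1) ^ 2} with hS
  set w : ℕ → ℝ := fun k => D ^ q * ((k : ℝ) + 2) ^ (2 * q) with hw
  have hw0 : ∀ k, 0 ≤ w k := fun k => by positivity
  -- `k` is the first level such that `X ω ≤ D * (k + 1) ^ 2`
  have hpt : ∀ ω, ENNReal.ofReal (X ω) ^ q ≤ ENNReal.ofReal (D ^ q) +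
      ∑' k, (toMeasurable P (S k)).indicator (fun _ => ENNReal.ofReal (w k)) ω := by
    intro ω
    have hex : ∃ k : ℕ, X ω ≤ D * ((k : ℝ) + 1) ^ 2 := by
      obtain ⟨k, hk⟩ := exists_nat_ge (X ω / D)
      refine ⟨k, ?_⟩
      rw [div_le_iff₀ hD] at hk
      nlinarith [mul_nonneg hD.le (Nat.cast_nonneg (α := ℝ) k),
        mul_nonneg hD.le (sq_nonneg (k : ℝ))]
    classical
    have hk := Nat.find_spec hex
    have hmin := fun j => Nat.find_min hex (m := j)
    rw [← ENNReal.ofReal_pow (hX ω)]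
    generalize Nat.find hex = k at hk hmin
    rcases k with _ | k
    · refine le_add_right (ENNReal.ofReal_le_ofReal (pow_le_pow_left₀ (hX ω) ?_ q))
      simpa using hk
    · refine le_add_left (le_trans ?_ (ENNReal.le_tsum k))
      have hm : ω ∈ toMeasurable P (S k) := subset_toMeasurable P _ (hmin k k.lt_succ_self)
      rw [Set.indicator_of_mem hm]
      refine ENNReal.ofReal_le_ofReal ((pow_le_pow_left₀ (hX ω) hk q).trans (le_of_eq ?_))
      rw [hw, mul_pow, ← pow_mul]
      push_cast
      ring
  have hsum : Summable fun k : ℕ => ((k : ℝ) + 2) ^ (2 * q) * Real.exp (-((k : ℝ) + 1)) := by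
    have h1 := ((summable_nat_add_iff 2).2
      (Real.summable_pow_mul_exp_neg_nat_mul (2 * q) zero_lt_one)).mul_right (Real.exp 1)
    refine h1.congr fun k => ?_
    rw [mul_assoc, ← Real.exp_add]
    push_cast
    congr 2
    ring
  calc _ ≤ ∫⁻ ω, (ENNReal.ofReal (D ^ q) +
        ∑' k, (toMeasurable P (S k)).indicator (fun _ => ENNReal.ofReal (w k)) ω) ∂P :=
        lintegral_mono hpt
    _ = ENNReal.ofReal (D ^ q) + ∑' k, ENNReal.ofReal (w k) * P (S k) := by
        rw [lintegral_add_left measurable_const, lintegral_const, measure_univ, mul_one,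
          lintegral_tsum fun k =>
            (measurable_const.indicator (measurableSet_toMeasurable P _)).aemeasurable]
        congr 2 with k
        rw [lintegral_indicator_const (measurableSet_toMeasurable P _), measure_toMeasurable]
    _ ≤ ENNReal.ofReal (D ^ q) + ∑' k : ℕ, ENNReal.ofReal (w k * Real.exp (-((k : ℝ) + 1))) := by
        refine add_le_add le_rfl (ENNReal.tsum_le_tsum fun k => ?_)
        rw [ENNReal.ofReal_mul (hw0 k)]
        refine mul_le_mul_right (h _ ?_) _
        linarith [Nat.cast_nonneg (α := ℝ) k]
    _ = _ := by
        have hs : Summable fun k : ℕ => w k * Real.exp (-((k : ℝ) + 1)) :=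
          (hsum.mul_left (D ^ q)).congr fun k => by rw [hw]; ring
        rw [← ENNReal.ofReal_tsum_of_nonneg (fun k => by positivity) hs,
          ← ENNReal.ofReal_add (by positivity) (tsum_nonneg fun k => by positivity), mul_add,
          mul_one, ← tsum_mul_left]
        congr 3 with k
        rw [hw]
        ring

/-- Borel–Cantelli for a sequence with tails of exponential type, at the summable levels `u = 1 + 2
log n`. -/
theorem ae_eventually_le_of_tail {X : ℕ → Ω → ℝ} {D : ℕ → ℝ}
    (h : ∀ᶠ n in atTop, ∀ u : ℝ, 1 ≤ u →
      P {ω | ¬ X n ω ≤ D n * u ^ 2} ≤ ENNReal.ofReal (Real.exp (-u))) :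
    ∀ᵐ ω ∂P, ∀ᶠ n : ℕ in atTop, X n ω ≤ D n * (1 + 2 * Real.log n) ^ 2 := by
  obtain ⟨N, hN⟩ := eventually_atTop.1 (h.and (eventually_ge_atTop 1))
  set S : ℕ → Set Ω := fun n => {ω | N ≤ n ∧ ¬ X n ω ≤ D n * (1 + 2 * Real.log n) ^ 2} with hS
  have hle : ∀ n, P (S n) ≤ ENNReal.ofReal (1 / (n : ℝ) ^ 2) := by
    intro n
    by_cases hn : N ≤ n
    · obtain ⟨h1, h2⟩ := hN n hn
      have hn0 : (0 : ℝ) < n := by exact_mod_cast h2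
      have hlog : 0 ≤ Real.log n := Real.log_natCast_nonneg n
      refine (measure_mono fun ω hω => hω.2).trans ((h1 _ (by linarith)).trans
        (ENNReal.ofReal_le_ofReal ?_))
      calc Real.exp (-(1 + 2 * Real.log n)) ≤ Real.exp (-(2 * Real.log n)) :=
            Real.exp_le_exp.2 (by linarith)
        _ = 1 / (n : ℝ) ^ 2 := by
            rw [Real.exp_neg, two_mul, Real.exp_add, Real.exp_log hn0, sq, one_div]
    · have : S n = ∅ := Set.eq_empty_of_forall_notMem fun ω hω => hn hω.1
      rw [this, measure_empty]
      exact zero_le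
  have hfin : ∑' n, P (S n) ≠ ∞ := by
    refine ne_top_of_le_ne_top ?_ (ENNReal.tsum_le_tsum hle)
    rw [← ENNReal.ofReal_tsum_of_nonneg (fun n => by positivity)
      (Real.summable_one_div_nat_pow.2 one_lt_two)]
    exact ENNReal.ofReal_ne_top
  filter_upwards [ae_eventually_notMem hfin] with ω hω
  filter_upwards [hω, eventually_ge_atTop N] with n h1 h2
  by_contra h3
  exact h1 ⟨h2, h3⟩

/-- A sample of size `n` from an i.i.d. sequence has the product law. -/
theorem measure_sample_le {E : Type*} [MeasurableSpace E] {ρ : Measure E} [IsProbabilityMeasure P]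
    {Z : ℕ → Ω → E} (hZ : ∀ i, Measurable (Z i)) (hind : iIndepFun Z P)
    (hlaw : ∀ i, P.map (Z i) = ρ) (n : ℕ) (S : Set (Fin n → E)) :
    P {ω | (fun i : Fin n => Z i ω) ∈ S} ≤ (Measure.pi fun _ : Fin n => ρ) S := by
  have hind' : iIndepFun (fun i : Fin n => Z i) P := hind.precomp Fin.val_injective
  have h := (iIndepFun_iff_map_fun_eq_pi_map fun i : Fin n => (hZ i).aemeasurable).1 hind'
  simp only [hlaw] at h
  rw [← h]
  exact Measure.le_map_apply (measurable_pi_lambda _ fun i : Fin n => hZ i).aemeasurable S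

end Tail

/-! ### The tail of the total error -/

section Final

variable {κ cγ γ ζ τ B M Q R E F a : ℝ}

/-- The rate as it appears in the moment bounds. -/
theorem rate_pow (ζ γ a : ℝ) {n : ℕ} (q : ℕ) :
    (regParam ζ γ n ^ (ζ - a) * logFactor ζ γ n ^ (1 - a)) ^ q =
      if 1 < 2 * ζ + γ then (n : ℝ) ^ (-(q * (ζ - a) / (2 * ζ + γ)))
      else (n : ℝ) ^ (-(q * (ζ - a))) * (max 1 (Real.log ((n : ℝ) ^ γ))) ^ (q * (1 - a)) := by
  have hn0 : (0 : ℝ) ≤ n := Nat.cast_nonneg n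
  have hreg : (regParam ζ γ n ^ (ζ - a)) ^ q =
      (n : ℝ) ^ (-(q * (ζ - a) / max 1 (2 * ζ + γ))) := by
    rw [regParam, ← Real.rpow_mul hn0, ← Real.rpow_natCast, ← Real.rpow_mul hn0]
    congr 1
    ring
  rw [mul_pow, hreg, logFactor]
  split_ifs with h
  · rw [max_eq_right h.le, Real.one_rpow, one_pow, mul_one]
  · rw [max_eq_left (not_lt.1 h), div_one, ← Real.rpow_natCast (_ ^ (1 - a)), ← Real.rpow_mul
      (zero_le_one.trans (le_max_left _ _)), mul_comm (1 - a)]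

/-- Powers of logarithms do not change a polynomial rate, up to an arbitrarily small exponent. -/
theorem tendsto_rate (hγ1 : γ ≤ 1) (ha : 0 ≤ a) (C : ℝ) (hC : 0 ≤ C)
    {ε : ℝ} (hε : 0 < ε) :
    Tendsto (fun n : ℕ => C * (regParam ζ γ n ^ (ζ - a) * logFactor ζ γ n ^ (1 - a)) *
      (1 + 2 * Real.log n) ^ 2 * (n : ℝ) ^ ((ζ - a - ε) / max 1 (2 * ζ + γ))) atTop (𝓝 0) := by
  set m := max 1 (2 * ζ + γ) with hm
  have hm0 : 0 < m := zero_lt_one.trans_le (le_max_left _ _)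
  set s := ε / (6 * m) with hs
  have hs0 : 0 < s := by positivity
  have hlim : Tendsto (fun n : ℕ => C * (1 + 2 / s) ^ 3 * (n : ℝ) ^ (-(3 * s))) atTop (𝓝 0) := by
    have h1 := ((tendsto_rpow_neg_atTop (by positivity : 0 < 3 * s)).comp
      tendsto_natCast_atTop_atTop).const_mul (C * (1 + 2 / s) ^ 3)
    rw [mul_zero] at h1
    exact h1
  refine tendsto_of_tendsto_of_tendsto_of_le_of_le' tendsto_const_nhds hlim ?_ ?_
  · filter_upwards [eventually_ge_atTop 1] with n hn
    have := regParam_pos (ζ := ζ) (γ := γ) hn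
    have h2 := one_le_logFactor (ζ := ζ) (γ := γ) (n := n)
    positivity
  · filter_upwards [eventually_ge_atTop 1] with n hn
    have hn1 : (1 : ℝ) ≤ n := by exact_mod_cast hn
    have hn0 : (0 : ℝ) < n := by linarith
    have hlog0 : 0 ≤ Real.log n := Real.log_natCast_nonneg n
    have hl1 := one_le_logFactor (ζ := ζ) (γ := γ) (n := n)
    have hl2 : logFactor ζ γ n ≤ 1 + 2 * Real.log n := by
      unfold logFactor
      split_ifs
      · linarith
      · rw [Real.log_rpow hn0]
        exact max_le (by linarith) (by nlinarith)
    have hl3 : logFactor ζ γ n ^ (1 - a) ≤ 1 + 2 * Real.log n := by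
      refine le_trans ?_ hl2
      calc logFactor ζ γ n ^ (1 - a) ≤ logFactor ζ γ n ^ (1 : ℝ) :=
            Real.rpow_le_rpow_of_exponent_le hl1 (by linarith)
        _ = _ := Real.rpow_one _
    -- three powers of the logarithm cost half of the exponent `6 * s = ε / m`
    have hlog : 1 + 2 * Real.log n ≤ (1 + 2 / s) * (n : ℝ) ^ s := by
      have h1 := Real.log_le_rpow_div hn0.le hs0
      have h2 := Real.one_le_rpow hn1 hs0.le
      calc 1 + 2 * Real.log n ≤ (n : ℝ) ^ s + 2 * ((n : ℝ) ^ s / s) := by linarith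
        _ = _ := by ring
    have hreg : regParam ζ γ n ^ (ζ - a) * (n : ℝ) ^ ((ζ - a - ε) / m) = (n : ℝ) ^ (-(6 * s)) := by
      rw [regParam, ← Real.rpow_mul hn0.le, ← Real.rpow_add hn0, hs]
      congr 1
      field_simp
      ring
    calc _ = C * (n : ℝ) ^ (-(6 * s)) * (logFactor ζ γ n ^ (1 - a) * (1 + 2 * Real.log n) ^ 2) := by
          rw [← hreg]
          ring
      _ ≤ C * (n : ℝ) ^ (-(6 * s)) * ((1 + 2 * Real.log n) * (1 + 2 * Real.log n) ^ 2) := by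
          gcongr
      _ = C * (n : ℝ) ^ (-(6 * s)) * (1 + 2 * Real.log n) ^ 3 := by ring
      _ ≤ C * (n : ℝ) ^ (-(6 * s)) * ((1 + 2 / s) * (n : ℝ) ^ s) ^ 3 := by gcongr
      _ = C * (1 + 2 / s) ^ 3 * ((n : ℝ) ^ (-(6 * s)) * ((n : ℝ) ^ s) ^ 3) := by ring
      _ = _ := by
          rw [← Real.rpow_natCast ((n : ℝ) ^ s), ← Real.rpow_mul hn0.le, ← Real.rpow_add hn0]
          congr 2
          push_cast
          ring

/-- The tail of the total error, for an i.i.d. sample: estimation plus approximation. -/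
theorem exists_sample_error_le (hκ : 1 ≤ κ) (hcγ : 0 < cγ) (hγ : 0 < γ)
    (hτ : 1 ≤ τ) (hζ : 0 ≤ ζ) (hζτ : ζ ≤ τ) (hM : 0 < M) (hR : 0 ≤ R) (hE : 0 < E)
    (ha : 0 ≤ a) (ha2 : a ≤ 1 / 2) :
    ∃ C, 0 < C ∧ ∀ {H : Type*} [NormedAddCommGroup H] [InnerProductSpace ℝ H] [CompleteSpace H]
      [TopologicalSpace.SeparableSpace H] [MeasurableSpace H] [BorelSpace H]
      (ρ : Measure (H × ℝ)) [IsProbabilityMeasure ρ], BoundedKernel ρ.fst κ →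
      MomentCondition ρ M Q → ApproxCondition ρ B → CapacityCondition ρ.fst cγ γ →
      ∀ (c : ℝ) (h : H), 0 ≤ c → c ≤ 1 → IsSource ρ ζ R c h →
      ∀ {Ω : Type*} [MeasurableSpace Ω] (P : Measure Ω) [IsProbabilityMeasure P]
        (Z : ℕ → Ω → H × ℝ), (∀ i, Measurable (Z i)) → iIndepFun Z P → (∀ i, P.map (Z i) = ρ) →
      ∀ n : ℕ, 1 ≤ n → ∀ g : ℝ → ℝ,
      FilterBound (κ ^ 2) τ E F (regParam ζ γ n) g → ∀ u : ℝ, 1 ≤ u →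
      P {ω | ¬ ‖calcL (covOp ρ.fst) (fun u => u ^ (1 / 2 - a))
        (estimator g (fun i : Fin n => Z i ω) - cutSol ρ ζ c (regParam ζ γ n) h)‖ +
          regParam ζ γ n ^ (ζ - a) * R ≤
          C * (regParam ζ γ n ^ (ζ - a) * logFactor ζ γ n ^ (1 - a)) * u ^ (2 - a)} ≤
        ENNReal.ofReal (Real.exp (-u)) := by
  obtain ⟨C, hC, hmain⟩ := exists_measure_error_le (Q := Q) (B := B) (F := F) hκ hcγ hγ hτ hζ hζτ
    hM hR hE ha ha2
  set k := 1 + Real.log (3 + cγ) with hk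
  have hlog : 0 ≤ Real.log (3 + cγ) := Real.log_nonneg (by linarith)
  have hk1 : 1 ≤ k := by linarith
  refine ⟨C * k ^ (2 - a) + R + 1, by positivity, ?_⟩
  intro H _ _ _ _ _ _ ρ _ hK hm hB hcap c h hc hc1 hh Ω _ P _ Z hZ hind hlaw n hn g hg u hu
  have hl0 : 0 < regParam ζ γ n := regParam_pos hn
  have hL1 := one_le_logFactor (ζ := ζ) (γ := γ) (n := n)
  -- the inflated parameter `u * k` absorbs the factor `3 + cγ` of the tail
  have hexp : (3 + cγ) * Real.exp (-(u * k)) ≤ Real.exp (-u) := by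
    nth_rw 1 [← Real.exp_log (by linarith : 0 < 3 + cγ)]
    rw [← Real.exp_add, Real.exp_le_exp, hk]
    nlinarith
  refine le_trans (measure_mono ?_) ((measure_sample_le hZ hind hlaw n _).trans
    ((hmain ρ hK hm hB hcap c h hc hc1 hh n hn g hg (u * k)
      (one_le_mul_of_one_le_of_one_le hu hk1)).trans (ENNReal.ofReal_le_ofReal hexp)))
  intro ω hω hle
  refine hω ?_
  have h1 : 1 ≤ logFactor ζ γ n ^ (1 - a) := Real.one_le_rpow hL1 (by linarith)
  have h2 : 1 ≤ u ^ (2 - a) := Real.one_le_rpow hu (by linarith)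
  have h3 : 0 < regParam ζ γ n ^ (ζ - a) := by positivity
  have h4 : regParam ζ γ n ^ (ζ - a) ≤
      regParam ζ γ n ^ (ζ - a) * logFactor ζ γ n ^ (1 - a) * u ^ (2 - a) := by
    rw [mul_assoc]
    exact le_mul_of_one_le_right h3.le (one_le_mul_of_one_le_of_one_le h1 h2)
  rw [Real.mul_rpow (by linarith) (by linarith)] at hle
  have h5 := mul_le_mul_of_nonneg_right h4 hR
  have h6 : 0 ≤ regParam ζ γ n ^ (ζ - a) * logFactor ζ γ n ^ (1 - a) * u ^ (2 - a) := by
    positivity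
  linarith

end Final

end SpectralReg

end

theorem corollary4p3
    (κ cγ γ ζ τ B M Q R E F a t : ℝ)
    (hκ : 1 ≤ κ) (hcγ : 0 < cγ) (hγ : 0 < γ) (hγ1 : γ ≤ 1)
    (hτ : 1 ≤ τ) (hζ : 0 ≤ ζ) (hζτ : ζ ≤ τ)
    (hB : 0 ≤ B) (hM : 0 < M) (hQ : 0 < Q) (hR : 0 ≤ R) (hE : 0 < E) (hF : 0 < F)
    (ha : 0 ≤ a) (ha2 : a ≤ 1 / 2) (haζ : a ≤ ζ) :
    ∃ (C : ℕ → ℝ) (C' : ℝ), (∀ q, 0 < C q) ∧ 0 < C' ∧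
      ∀ (H : Type u) [NormedAddCommGroup H] [InnerProductSpace ℝ H] [CompleteSpace H]
        [TopologicalSpace.SeparableSpace H] [MeasurableSpace H] [BorelSpace H]
        (ρ : Measure (H × ℝ)) [IsProbabilityMeasure ρ]
        (Λ : Set ℝ) (G : ℝ → ℝ → ℝ)
        (Ω : Type v) [MeasurableSpace Ω] (P : Measure Ω) [IsProbabilityMeasure P]
        (Z : ℕ → Ω → H × ℝ),
        -- standing assumptions on the distribution
        IsCompact ρ.fst.support →
        BoundedKernel ρ.fst κ →
        ‖covOp ρ.fst‖ = t →
        MomentCondition ρ M Q →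
        ApproxCondition ρ B →
        SourceCondition ρ (fun u => κ ^ (-2 * max (ζ - 1) 0) * u ^ ζ) R →
        CapacityCondition ρ.fst cγ γ →
        -- the filter functions
        IsFilter κ τ E F Λ G →
        -- the i.i.d. sample
        (∀ i, Measurable (Z i)) → iIndepFun Z P → (∀ i, P.map (Z i) = ρ) →
        let lam : ℕ → ℝ := fun n => (n : ℝ) ^ (-(1 / max 1 (2 * ζ + γ)))
        let est : ℕ → Ω → H := fun n ω => estimator (G (lam n)) (fun i : Fin n => Z i ω)
        let diff : ℕ → Ω → Lp ℝ 2 ρ.fst := fun n ω => inclusion ρ.fst (est n ω) - target ρ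
        let err : ℕ → Ω → Lp ℝ 2 ρ.fst := fun n ω =>
          specCalc (intOp ρ.fst) (fun u => u ^ (-a)) (diff n ω)
        -- `L ^ (-a) (f̂ - f_H)` is well defined
        (∀ n ω, InDomain (intOp ρ.fst) (fun u => u ^ (-a)) (diff n ω)) ∧
        -- bounds in expectation
        (∀ q : ℕ, 1 ≤ q → ∀ n : ℕ, 1 ≤ n → lam n ∈ Λ →
          ∫⁻ ω, ‖err n ω‖ₑ ^ q ∂P ≤ ENNReal.ofReal (C q *
            if 1 < 2 * ζ + γ then (n : ℝ) ^ (-(q * (ζ - a) / (2 * ζ + γ)))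
            else (n : ℝ) ^ (-(q * (ζ - a))) *
              (max 1 (Real.log ((n : ℝ) ^ γ))) ^ (q * (1 - a)))) ∧
        -- almost sure convergence
        ((∀ᶠ n in atTop, lam n ∈ Λ) → ∀ ε : ℝ, 0 < ε → ε < ζ - a →
          ∀ᵐ ω ∂P, Tendsto
            (fun n : ℕ => ‖err n ω‖ * (n : ℝ) ^ ((ζ - a - ε) / max 1 (2 * ζ + γ)))
            atTop (𝓝 0)) ∧
        -- bounds in `H`, where `ωH` is the solution of `S ω = f_H` of minimal norm
        (1 / 2 ≤ ζ → ∃ ωH : H, inclusion ρ.fst ωH = target ρ ∧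
          (∀ w : H, inclusion ρ.fst w = target ρ → ‖ωH‖ ≤ ‖w‖) ∧
          ∀ n : ℕ, 1 ≤ n → lam n ∈ Λ → ∀ δ : ℝ, 0 < δ → δ < 1 →
            P {ω | ¬ ‖specCalc (covOp ρ.fst) (fun u => u ^ (1 / 2 - a)) (est n ω - ωH)‖ ≤
                C' * (n : ℝ) ^ (-((ζ - a) / (2 * ζ + γ))) * (Real.log (6 / δ)) ^ (2 - a)} ≤
              ENNReal.ofReal δ) := by
  obtain ⟨D, hD, hmain⟩ := exists_sample_error_le (Q := Q) (B := B) (F := F) hκ hcγ hγ hτ hζ hζτ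
    hM hR hE ha ha2
  have hmom : ∀ q : ℕ,
      0 ≤ ∑' k : ℕ, ((k : ℝ) + 2) ^ (2 * q) * Real.exp (-((k : ℝ) + 1)) := fun q =>
    tsum_nonneg fun k => by positivity
  refine ⟨fun q => D ^ q *
    (1 + ∑' k : ℕ, ((k : ℝ) + 2) ^ (2 * q) * Real.exp (-((k : ℝ) + 1))), D,
    fun q => mul_pos (pow_pos hD q) (by linarith [hmom q]), hD, ?_⟩
  intro H _ _ _ _ _ _ ρ _ Λ G Ω _ P _ Z _ hK _ hm hB hS hcap hG hZ hind hlaw lam est diff err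
  have hκ0 : 0 < κ := by linarith
  set c := κ ^ (-2 * max (ζ - 1) 0) with hc_def
  have hc : 0 ≤ c := by positivity
  have hc1 : c ≤ 1 := Real.rpow_le_one_of_one_le_of_nonpos hκ
    (by have := le_max_right (ζ - 1) 0; linarith)
  obtain ⟨h, hh⟩ := exists_source hκ0.le hK hζ hS
  have hfilter : ∀ {n}, lam n ∈ Λ → FilterBound (κ ^ 2) τ E F (regParam ζ γ n) (G (lam n)) :=
    fun hn => ⟨fun α hα => hG.bound α hα _ hn, fun α hα => hG.residual α hα _ hn⟩
  set rate : ℕ → ℝ := fun n => regParam ζ γ n ^ (ζ - a) * logFactor ζ γ n ^ (1 - a) with hrate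
  have hrate0 : ∀ {n}, 1 ≤ n → 0 < rate n := fun {n} hn => by
    have h1 := regParam_pos (ζ := ζ) (γ := γ) hn
    have h2 := one_le_logFactor (ζ := ζ) (γ := γ) (n := n)
    positivity
  have htail := fun n (hn : 1 ≤ n) (hΛ : lam n ∈ Λ) u (hu : (1 : ℝ) ≤ u) =>
    hmain ρ hK hm hB hcap c h hc hc1 hh P Z hZ hind hlaw n hn _ (hfilter hΛ) u hu
  have herr : ∀ n (_ : 1 ≤ n) (_ : lam n ∈ Λ) u (_ : (1 : ℝ) ≤ u),
      P {ω | ¬ ‖err n ω‖ ≤ D * rate n * u ^ 2} ≤ ENNReal.ofReal (Real.exp (-u)) := by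
    intro n hn hΛ u hu
    refine le_trans (measure_mono ?_) (htail n hn hΛ u hu)
    intro ω hω hle
    have hsplit := (inDomain_rpow_neg hκ hK hc hc1 (regParam_pos (ζ := ζ) (γ := γ) hn) hh haζ ha2
      (est n ω)).2
    refine hω ((hsplit.trans hle).trans ?_)
    refine mul_le_mul_of_nonneg_left ?_ (mul_pos hD (hrate0 hn)).le
    rw [← Real.rpow_two]
    exact Real.rpow_le_rpow_of_exponent_le hu (by linarith)
  refine ⟨fun n ω => (inDomain_rpow_neg hκ hK hc hc1 one_pos hh haζ ha2 _).1, ?_, ?_, ?_⟩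
  · intro q _ n hn hΛ
    have h1 := lintegral_pow_le_of_tail (mul_pos hD (hrate0 hn)) (fun ω => norm_nonneg (err n ω))
      (herr n hn hΛ) q
    simp only [ofReal_norm] at h1
    refine h1.trans (le_of_eq ?_)
    rw [mul_pow, hrate, rate_pow, mul_right_comm]
  · intro hΛ ε hε _
    have h1 := ae_eventually_le_of_tail (X := fun n ω => ‖err n ω‖) (D := fun n => D * rate n)
      (by filter_upwards [hΛ, eventually_ge_atTop 1] with n hn hn1 using herr n hn1 hn)
    filter_upwards [h1] with ω hω
    refine tendsto_of_tendsto_of_tendsto_of_le_of_le' tendsto_const_nhds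
      (tendsto_rate (ζ := ζ) (a := a) hγ1 ha D hD.le hε) (.of_forall fun n => by positivity) ?_
    filter_upwards [hω] with n hn
    gcongr
  · intro hζ2
    obtain ⟨ωH, h1, h2, h3⟩ := exists_minimal_solution hκ hK hc hc1 hh hζ2 haζ ha2
    refine ⟨ωH, h1, h2, fun n hn hΛ δ hδ hδ1 => ?_⟩
    -- `6 > exp 1`, so that `log (6 / δ)` is an admissible value of the parameter of the tail
    have hu : 1 ≤ Real.log (6 / δ) := by
      rw [Real.le_log_iff_exp_le (by positivity)]
      have h4 : (6 : ℝ) ≤ 6 / δ := by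
        rw [le_div_iff₀ hδ]
        linarith
      linarith [Real.exp_one_lt_d9]
    have hexp : Real.exp (-Real.log (6 / δ)) ≤ δ := by
      rw [Real.exp_neg, Real.exp_log (by positivity), inv_div]
      linarith
    have hrn : rate n = (n : ℝ) ^ (-((ζ - a) / (2 * ζ + γ))) := by
      have hlt : 1 < 2 * ζ + γ := by linarith
      rw [hrate]
      simp only
      rw [logFactor, if_pos hlt, Real.one_rpow, mul_one, regParam, max_eq_right hlt.le,
        ← Real.rpow_mul (Nat.cast_nonneg n)]
      congr 1
      ring
    rw [← hrn]
    refine le_trans (measure_mono ?_)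
      ((htail n hn hΛ _ hu).trans (ENNReal.ofReal_le_ofReal hexp))
    intro ω hω hle
    exact hω ((h3 _ (regParam_pos hn) _).trans hle)
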